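/- **Model.** For $k=1,2$ let $\mathbf X^{(k)}$ be a fixed $n^{(k)}\times q$ matrix whose columns have $\ell_2$ norm $\sqrt{n^{(k)}}$, and let the $n^{(k)}\times p$ matrix $\mathbf Y^{(k)}$ satisfy $\mathbf Y^{(k)}=\mathbf Y^{(k)}\Gamma^{(k)}+\mathbf X^{(k)}\Phi^{(k)}+\mathcal E^{(k)}$, where $\Gamma^{(k)}$ has zero diagonal and, for each $k$, the entries of $\mathcal E^{(k)}$ are independent, those of column $i$ being $N(0,(\sigma_i^{(k)})^2)$ with $\sigma_i^{(k)}\le\sigma_{\max}$. Put $n=n^{(1)}+n^{(2)}$, $n_{\min}=n^{(1)}\wedge n^{(2)}$, $\mathcal A_i^{(k)}=\mathrm{supp}(\Phi^{(k)}_{\cdot i})$, $\pi^{(k)}=\Phi^{(k)}(I-\Gamma^{(k)})^{-1}$, $\mathbf X=\mathrm{diag}(\mathbf X^{(1)},\mathbf X^{(2)})$, $$\Pi=\begin{pmatrix}\pi^{(1)}&\pi^{(1)}\\ \pi^{(2)}&-\pi^{(2)}\end{pmatrix},\qquad \beta_i=\begin{pmatrix}\beta_i^+\\ \beta_i^-\end{pmatrix},\qquad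 \beta_i^{\pm}=\tfrac12\bigl(\gamma_i^{(1)}\pm\gamma_i^{(2)}\bigr),$$ where $\gamma_i^{(k)}$ is the $i$-th column of $\Gamma^{(k)}$ without its $i$-th entry. Let $\mathcal S_i=\mathrm{supp}(\beta_i)$ and $\mathbf B=[\beta_1,\dots,\beta_p]$. A subscript $-i$ on $\Pi$ or on an estimate of it means that the $i$-th columns of both blocks are deleted. $\|\cdot\|_1$ and $\|\cdot\|_\infty$ of a matrix are the maximal column and row sums of absolute values, and $\|v\|_{-\infty}=\min_j|v_j|$ for a vector. $\mathbf H_i=\mathrm{diag}(\mathbf H_i^{(1)},\mathbf H_i^{(2)})$, where $\mathbf H_i^{(k)}$ is the projection onto the orthogonal complement of the columns of $\mathbf X^{(k)}$ indexed by $\mathcal A_i^{(k)}$. **Estimators.** $\mathcal M_i^{(k)}\subseteq\{1,\dots,q\}$ are fixed sets with $|\mathcal M_i^{(k)}|=d$ that contain every exogenous variable which regulates node $i$ of network $k$ directly or indirectly. $\hat\pi_i^{(k)}$ is the ridge estimate $(\mathbf X_{\mathcal M}^T\mathbf X_{\mathcal M}+\lambda_i^{(k)}I)^{-1}\mathbf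 X_{\mathcal M}^T\mathbf Y_i^{(k)}$ with $\mathcal M=\mathcal M_i^{(k)}$, $\mathbf X_{\mathcal M}=\mathbf X^{(k)}_{\mathcal M}$ and ridge parameter $\lambda_i^{(k)}\ge0$, extended by zeros; $\hat\Pi$ is built from $\hat\pi^{(1)},\hat\pi^{(2)}$ as $\Pi$ is from $\pi^{(1)},\pi^{(2)}$, $\hat{\mathbf Z}_{-i}=\mathbf X\hat\Pi_{-i}$, and $\mathbf Y_i$ stacks $\mathbf Y_i^{(1)}$ and $\mathbf Y_i^{(2)}$. For positive, possibly data-dependent, weights $\omega_i$ and tuning parameter $\lambda_i$, $\hat\beta_i$ is any minimizer of $\frac1n\|\mathbf H_i\mathbf Y_i-\mathbf H_i\hat{\mathbf Z}_{-i}\beta\|_2^2+\lambda_i\sum_j\omega_{ij}|\beta_j|$, and $\hat{\mathcal S}_i=\{j:\hat\beta_{ij}\ne0\}$. **Notation.** Let $f^{(1)},f^{(2)}>0$, $r_{\max}=\max_{i,k}(\lambda_i^{(k)})^2\|\pi_i^{(k)}\|_2^2/n^{(k)}$, $D=d\vee r_{\max}\vee f^{(1)}\vee f^{(2)}$ and $h_n=(\|\mathbf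 B\|_1^2\wedge1)\bigl((n\|\Pi\|_1^2/d)\wedge D\bigr)\log p$. Let $W_i=\mathrm{diag}(\omega_i)$, $\mathcal I_i=\frac1n\Pi_{-i}^T\mathbf X^T\mathbf H_i\mathbf X\Pi_{-i}$, and $\hat{\mathcal I}_i$ the same with $\hat\Pi_{-i}$; the index $11$ denotes the block with rows and columns in $\mathcal S_i$, the index $21$ the block with rows in $\mathcal S_i^c$ and columns in $\mathcal S_i$. Let $\psi_i=\|\mathcal I_{i,11}^{-1}W_{\mathcal S_i}\|_\infty$ and $b_i=\min_{j\in\mathcal S_i}|\beta_{ij}|$. **Assumptions on the networks**, with positive constants $c_1^{(k)},c_2^{(k)},s,\kappa,\sigma_{\max}$; $c_{\max}=c_1^{(1)}\vee c_1^{(2)}$. 1. In each network, every node that regulates some node, directly or indirectly, has $\mathcal A_i^{(k)}\ne\emptyset$, and $\mathcal A_i^{(k)}\cap\mathcal A_j^{(k)}=\emptyset$ for $i\ne j$. 2. $n^{(k)}\le\kappa n_{\min}$, $p\le\kappa q$, $q\le\kappa p$. 3. The singular values of $I-\Gamma^{(k)}$ are at least $s$; $c_2^{(k)}\le(n^{(k)})^{-1/2}\|\mathbf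 X^{(k)}_{\mathcal M_i^{(k)}}\delta\|_2\le c_1^{(k)}$ for all $i$ and all unit vectors $\delta$; $\lambda_i^{(k)}\le\kappa n_{\min}$. **Assumptions on node $i$**, with constants $\phi_0>0$, $\tau\in(0,1)$ (those involving the weights or $\hat{\mathcal I}_i$ hold almost surely). 4. $\|\mathbf H_i\mathbf X\Pi_{-i}\delta\|_2\ge\phi_0\sqrt n\,\|\delta_{\mathcal S_i}\|_2$ whenever $\|\delta_{\mathcal S_i^c}\|_1\le3\|\delta_{\mathcal S_i}\|_1$; and $\omega_{ij}\le\omega_{il}$ for $j\in\mathcal S_i$, $l\notin\mathcal S_i$. 5. $\|W_{\mathcal S_i^c}^{-1}\mathcal I_{i,21}\mathcal I_{i,11}^{-1}W_{\mathcal S_i}\|_\infty<1-\tau$. **Theorem 4 (Variable selection consistency).** There is a constant $C_2>0$, depending only on $c_1^{(k)},c_2^{(k)},s,\kappa,\sigma_{\max}$, such that, under Assumptions 1–3, for each column $j$ the first-stage prediction bound $\|\mathbf X(\hat\Pi_j-\Pi_j)\|_2^2\le C_2D$ holds with probability at least $1-e^{-f^{(1)}}-e^{-f^{(2)}}$, and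 such that the following is true. For all $\tau\in(0,1)$ and $\phi_0>0$ there is $t_0>0$, and for all $0<a\le b$ there is $C_5>0$ (these constants depend only on the constants named before them), such that, under Assumptions 1–5, if $a\sqrt{\log p}\ge t_0$, if almost surely $$aR_i\le\lambda_i\le bR_i,\qquad R_i=\|\omega_i\|_{-\infty}^{-1}\|\mathbf B\|_1\|\Pi\|_1\sqrt{D\log(p)/n_{\min}},$$ if $\hat{\mathcal I}_{i,11}$ is almost surely invertible and if, in case $\mathcal S_i\ne\emptyset$, almost surely $b_i>\lambda_i\psi_i/(2-\tau)$ and $$\sqrt{D/n}+c_{\max}\|\Pi\|_1\le\sqrt{c_{\max}^2\|\Pi\|_1^2+\min\Bigl(\frac{\phi_0^2}{64},\frac{\tau}{4-\tau}\,\frac{\|\omega_i\|_{-\infty}}{\psi_i}\Bigr)\Big/(C_2|\mathcal S_i|)},$$ then $\hat{\mathcal S}_i=\mathcal S_i$ with probability at least $1-3e^{-C_5h_n+\log(4pq)}-e^{-f^{(1)}+\log p}-e^{-f^{(2)}+\log p}$. -/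

import Mathlib

open MeasureTheory ProbabilityTheory Matrix
open scoped NNReal ENNReal

universe u

noncomputable section

namespace ReDNet

/-! ### Vector and matrix norms, supports, blocks -/

section Linear

variable {m ι : Type*} [Fintype m] [Fintype ι]

/-- Euclidean norm of a vector. -/
def ltwo (v : ι → ℝ) : ℝ := ‖WithLp.toLp 2 v‖

/-- Sum of the absolute values of the components of a vector. -/
def lone (v : ι → ℝ) : ℝ := ∑ j, |v j|

/-- Minimal absolute value of the components of a vector. -/
def minAbs (v : ι → ℝ) : ℝ := ⨅ j, |v j|

/-- Maximal column sum of absolute values of a matrix. -/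
def matOne (A : Matrix m ι ℝ) : ℝ := ⨆ j, ∑ r, |A r j|

/-- Maximal row sum of absolute values of a matrix. -/
def matInf (A : Matrix m ι ℝ) : ℝ := ⨆ r, ∑ j, |A r j|

open Classical in
/-- Set of the indices of the nonzero components of a vector. -/
def supp (v : ι → ℝ) : Finset ι := Finset.univ.filter fun j => v j ≠ 0

/-- Restricted eigenvalue of a matrix with `n` rows on an index set `S`: the infimum of
`‖A δ‖₂ / (√n ‖δ_S‖₂)` over the `δ` with `‖δ_{Sᶜ}‖₁ ≤ 3 ‖δ_S‖₁` and `δ_S ≠ 0`. It is `∞` if `S` is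
empty. -/
def restrictedEigenvalue [DecidableEq ι] (A : Matrix m ι ℝ) (S : Finset ι) : ℝ≥0∞ :=
  ⨅ (δ : ι → ℝ) (_ : ∑ j ∈ Sᶜ, |δ j| ≤ 3 * ∑ j ∈ S, |δ j|) (_ : ∃ j ∈ S, δ j ≠ 0),
    ENNReal.ofReal
      (ltwo (A *ᵥ δ) / (√(Fintype.card m) * ltwo (fun j : {j // j ∈ S} => δ j)))

/-- Submatrix with rows and columns indexed by `S`. -/
def block11 (A : Matrix ι ι ℝ) (S : Finset ι) : Matrix {j // j ∈ S} {j // j ∈ S} ℝ :=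
  A.submatrix Subtype.val Subtype.val

/-- Submatrix with rows indexed by the complement of `S` and columns indexed by `S`. -/
def block21 (A : Matrix ι ι ℝ) (S : Finset ι) : Matrix {j // j ∉ S} {j // j ∈ S} ℝ :=
  A.submatrix Subtype.val Subtype.val

/-- Ridge estimator `(Xᵀ X + ρ I)⁻¹ Xᵀ y`. -/
def ridge [DecidableEq ι] (X : Matrix m ι ℝ) (ρ : ℝ) (y : m → ℝ) : ι → ℝ :=
  (Xᵀ * X + ρ • (1 : Matrix ι ι ℝ))⁻¹ *ᵥ (Xᵀ *ᵥ y)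

/-- The matrix `I - X (Xᵀ X)⁻¹ Xᵀ`. -/
def annihilator [DecidableEq m] [DecidableEq ι] (X : Matrix m ι ℝ) : Matrix m m ℝ :=
  1 - X * (Xᵀ * X)⁻¹ * Xᵀ

end Linear

/-- The submatrix with the columns indexed by `S`. -/
def cols {m ι : Type*} (A : Matrix m ι ℝ) (S : Finset ι) : Matrix m {j // j ∈ S} ℝ :=
  A.submatrix id Subtype.val

/-- The submatrix without the `i`-th column. -/
def dropCol {m ι : Type*} (A : Matrix m ι ℝ) (i : ι) : Matrix m {l // l ≠ i} ℝ :=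
  A.submatrix id Subtype.val

/-- The matrix with block rows `(A, A)` and `(B, -B)`. -/
def pair {m₁ m₂ ι : Type*} (A : Matrix m₁ ι ℝ) (B : Matrix m₂ ι ℝ) :
    Matrix (m₁ ⊕ m₂) (ι ⊕ ι) ℝ :=
  Matrix.fromBlocks A A B (-B)

/-- Indices of the coefficients of the reparameterized regression of node `i`: the left copy of the
other nodes indexes the average effects, the right copy the differential effects. -/
abbrev Coef (p : ℕ) (i : Fin p) : Type := {l : Fin p // l ≠ i} ⊕ {l : Fin p // l ≠ i}

/-! ### The two networks -/

/-- The non-random data of two structural equation models (`k = 0, 1`) with `p` endogenous and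
`q` exogenous variables, and of the calibration stage. -/
structure Networks (p q : ℕ) where
  /-- sample sizes -/
  n : Fin 2 → ℕ
  /-- observations of the exogenous variables -/
  X : (k : Fin 2) → Matrix (Fin (n k)) (Fin q) ℝ
  /-- effects of endogenous variables on each other: `Γ k j i` is the effect of `j` on `i` -/
  Γ : Fin 2 → Matrix (Fin p) (Fin p) ℝ
  /-- effects of exogenous variables: `Φ k l i` is the effect of `l` on node `i` -/
  Φ : Fin 2 → Matrix (Fin q) (Fin p) ℝ
  /-- standard deviations of the errors -/
  σ : Fin 2 → Fin p → ℝ≥0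
  /-- exogenous variables that screening keeps for each node -/
  M : Fin 2 → Fin p → Finset (Fin q)
  /-- number of exogenous variables that screening keeps -/
  d : ℕ
  /-- ridge parameters -/
  ρ : Fin 2 → Fin p → ℝ
  /-- the numbers `f` that govern the probability of the calibration bounds -/
  f : Fin 2 → ℝ

namespace Networks

variable {p q : ℕ} (N : Networks p q)

/-- Total sample size. -/
def nTot : ℕ := N.n 0 + N.n 1

/-- Smaller sample size. -/
def nMin : ℕ := min (N.n 0) (N.n 1)

/-- Exogenous variables with a direct effect on node `i`. -/
def A (k : Fin 2) (i : Fin p) : Finset (Fin q) := supp fun l => N.Φ k l i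

/-- Node `j` has a direct effect on node `i`. -/
def Edge (k : Fin 2) (j i : Fin p) : Prop := N.Γ k j i ≠ 0

/-- Exogenous variable `l` regulates node `i`, directly or through a chain of other nodes. -/
def ExoRegulates (k : Fin 2) (l : Fin q) (i : Fin p) : Prop :=
  ∃ j, l ∈ N.A k j ∧ Relation.ReflTransGen (N.Edge k) j i

/-- Reduced-form coefficients `Φ (I - Γ)⁻¹`. -/
def redForm (k : Fin 2) : Matrix (Fin q) (Fin p) ℝ := N.Φ k * (1 - N.Γ k)⁻¹

/-- `‖Π‖₁` and the columns of `Π` refer to this matrix. -/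
def PiMat : Matrix (Fin q ⊕ Fin q) (Fin p ⊕ Fin p) ℝ := pair (N.redForm 0) (N.redForm 1)

/-- `Π` without the two columns of node `i`. -/
def PiMinus (i : Fin p) : Matrix (Fin q ⊕ Fin q) (Coef p i) ℝ :=
  pair (dropCol (N.redForm 0) i) (dropCol (N.redForm 1) i)

/-- Block diagonal matrix of the exogenous observations. -/
def XX : Matrix (Fin (N.n 0) ⊕ Fin (N.n 1)) (Fin q ⊕ Fin q) ℝ :=
  Matrix.fromBlocks (N.X 0) 0 0 (N.X 1)

/-- Block diagonal projection matrix that removes the anchoring exogenous variables of node `i`. -/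
def H (i : Fin p) : Matrix (Fin (N.n 0) ⊕ Fin (N.n 1)) (Fin (N.n 0) ⊕ Fin (N.n 1)) ℝ :=
  Matrix.fromBlocks (annihilator (cols (N.X 0) (N.A 0 i))) 0 0
    (annihilator (cols (N.X 1) (N.A 1 i)))

/-- Average and differential effects on node `i`. -/
def β (i : Fin p) : Coef p i → ℝ :=
  Sum.elim (fun l => (N.Γ 0 l i + N.Γ 1 l i) / 2) (fun l => (N.Γ 0 l i - N.Γ 1 l i) / 2)

/-- Indices of the nonzero average and differential effects on node `i`. -/
def S (i : Fin p) : Finset (Coef p i) := supp (N.β i)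

/-- `‖B‖₁` for the matrix `B` whose columns are the vectors `β i`. -/
def oneB : ℝ := ⨆ i, lone (N.β i)

/-- `r_max`, the maximum of `ρ² ‖π_i‖₂² / n` over nodes and networks. -/
def rMax : ℝ :=
  ⨆ i : Fin p, ⨆ k : Fin 2, N.ρ k i ^ 2 * ltwo (fun l => N.redForm k l i) ^ 2 / N.n k

/-- `d ∨ r_max ∨ f_max`. -/
def D : ℝ := max (N.d : ℝ) (max N.rMax (max (N.f 0) (N.f 1)))

/-- `h_n = (‖B‖₁² ∧ 1) ((n ‖Π‖₁² / d) ∧ (d ∨ r_max ∨ f_max)) log p`. -/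
def h : ℝ :=
  min (N.oneB ^ 2) 1 * min (N.nTot * matOne N.PiMat ^ 2 / N.d) N.D * Real.log p

/-- `n⁻¹ Pᵀ Xᵀ H_i X P`. -/
def gram (i : Fin p) (P : Matrix (Fin q ⊕ Fin q) (Coef p i) ℝ) : Matrix (Coef p i) (Coef p i) ℝ :=
  (N.nTot : ℝ)⁻¹ • (Pᵀ * N.XXᵀ * N.H i * N.XX * P)

/-- Population Gram matrix. -/
def I (i : Fin p) : Matrix (Coef p i) (Coef p i) ℝ := N.gram i (N.PiMinus i)

/-- `ψ_i = ‖I_{i,11}⁻¹ W_S‖_∞` for weights `w`. -/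
def ψ (i : Fin p) (w : Coef p i → ℝ) : ℝ :=
  matInf ((block11 (N.I i) (N.S i))⁻¹ * diagonal fun j : {j // j ∈ N.S i} => w j)

/-- `‖W_{Sᶜ}⁻¹ I_{i,21} I_{i,11}⁻¹ W_S‖_∞` for weights `w`. -/
def irrep (i : Fin p) (w : Coef p i → ℝ) : ℝ :=
  matInf ((diagonal fun j : {j // j ∉ N.S i} => w j)⁻¹ * block21 (N.I i) (N.S i) *
    (block11 (N.I i) (N.S i))⁻¹ * diagonal fun j : {j // j ∈ N.S i} => w j)

/-- Minimal signal strength: the minimum of `|β_ij|` over the support. -/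
def signal (i : Fin p) : ℝ := ⨅ j : {j // j ∈ N.S i}, |N.β i j|

/-- The rate `‖w‖_{-∞}⁻¹ ‖B‖₁ ‖Π‖₁ √((d ∨ r_max ∨ f_max) log p / n_min)` of the tuning parameter of
the construction stage. -/
def rate (i : Fin p) (w : Coef p i → ℝ) : ℝ :=
  (minAbs w)⁻¹ * N.oneB * matOne N.PiMat * √(N.D * Real.log p / N.nMin)

/-! ### The two stages of the estimation -/

/-- Observations of the endogenous variables in the two networks. -/
abbrev Obs : Type := (k : Fin 2) → Matrix (Fin (N.n k)) (Fin p) ℝ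

/-- Ridge estimate of the reduced-form coefficients from the screened exogenous variables, with zero
coefficients for the excluded ones. -/
def redFormHat (Y : N.Obs) (k : Fin 2) : Matrix (Fin q) (Fin p) ℝ := fun l i =>
  if hl : l ∈ N.M k i then
    ridge (cols (N.X k) (N.M k i)) (N.ρ k i) (fun r => Y k r i) ⟨l, hl⟩
  else 0

/-- Estimate of `Π`. -/
def PiHat (Y : N.Obs) : Matrix (Fin q ⊕ Fin q) (Fin p ⊕ Fin p) ℝ :=
  pair (N.redFormHat Y 0) (N.redFormHat Y 1)

/-- Estimate of `Π` without the two columns of node `i`. -/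
def PiHatMinus (Y : N.Obs) (i : Fin p) : Matrix (Fin q ⊕ Fin q) (Coef p i) ℝ :=
  pair (dropCol (N.redFormHat Y 0) i) (dropCol (N.redFormHat Y 1) i)

/-- Estimated Gram matrix. -/
def IHat (Y : N.Obs) (i : Fin p) : Matrix (Coef p i) (Coef p i) ℝ := N.gram i (N.PiHatMinus Y i)

/-- Predicted regressors of node `i` in the construction stage. -/
def ZHat (Y : N.Obs) (i : Fin p) : Matrix (Fin (N.n 0) ⊕ Fin (N.n 1)) (Coef p i) ℝ :=
  pair (dropCol (N.X 0 * N.redFormHat Y 0) i) (dropCol (N.X 1 * N.redFormHat Y 1) i)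

/-- Stacked observations of node `i`. -/
def stack (Y : N.Obs) (i : Fin p) : Fin (N.n 0) ⊕ Fin (N.n 1) → ℝ :=
  Sum.elim (fun r => Y 0 r i) (fun r => Y 1 r i)

/-- Objective function of the adaptive lasso for node `i` with tuning parameter `t` and weights
`w`. -/
def objective (Y : N.Obs) (i : Fin p) (t : ℝ) (w : Coef p i → ℝ) (b : Coef p i → ℝ) : ℝ :=
  (N.nTot : ℝ)⁻¹ * ltwo (N.H i *ᵥ N.stack Y i - N.H i *ᵥ (N.ZHat Y i *ᵥ b)) ^ 2 +
    t * ∑ j, w j * |b j|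

/-- `b` is an adaptive lasso estimate for node `i`. -/
def IsAdaptiveLasso (Y : N.Obs) (i : Fin p) (t : ℝ) (w : Coef p i → ℝ) (b : Coef p i → ℝ) : Prop :=
  ∀ b' : Coef p i → ℝ, N.objective Y i t w b ≤ N.objective Y i t w b'

/-! ### The model and the standing assumptions -/

/-- General conventions: nonempty samples, no self-regulation, standardized exogenous variables, and
screening sets of size `d` that contain all exogenous variables which regulate the node, directly or
indirectly. -/
structure Standing : Prop where
  n_pos : ∀ k, 0 < N.n k
  f_pos : ∀ k, 0 < N.f k
  diag_zero : ∀ k i, N.Γ k i i = 0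
  standardized : ∀ k l, ltwo (fun r => N.X k r l) = √(N.n k)
  card_M : ∀ k i, (N.M k i).card = N.d
  screening : ∀ k l i, N.ExoRegulates k l i → l ∈ N.M k i

/-- Identifiability: a node that regulates some node, directly or indirectly, has an anchoring
exogenous variable, and different nodes have disjoint sets of anchoring exogenous variables. -/
structure Identifiable : Prop where
  anchored : ∀ k i, (∃ j, Relation.TransGen (N.Edge k) i j) → (N.A k i).Nonempty
  disjoint : ∀ k i j, i ≠ j → Disjoint (N.A k i) (N.A k j)

/-- The sample sizes are of the same order, and so are the numbers of endogenous and of exogenous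
variables, with constant `κ`. -/
structure SameOrder (κ : ℝ) : Prop where
  n_le : ∀ k, (N.n k : ℝ) ≤ κ * N.nMin
  p_le : (p : ℝ) ≤ κ * q
  q_le : (q : ℝ) ≤ κ * p

/-- Regularity of the calibration stage: the singular values of `I - Γ` are at least `s`, those of
the screened exogenous observations divided by `√n` lie between `c₂` and `c₁`, and the ridge
parameters are nonnegative and at most `κ n_min`. -/
structure Calibration (s κ : ℝ) (c₁ c₂ : Fin 2 → ℝ) : Prop where
  sing : ∀ k (v : Fin p → ℝ), ltwo v = 1 → s ≤ ltwo ((1 - N.Γ k) *ᵥ v)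
  upper : ∀ k i (δ : {l // l ∈ N.M k i} → ℝ), ltwo δ = 1 →
    (√(N.n k))⁻¹ * ltwo (cols (N.X k) (N.M k i) *ᵥ δ) ≤ c₁ k
  lower : ∀ k i (δ : {l // l ∈ N.M k i} → ℝ), ltwo δ = 1 →
    c₂ k ≤ (√(N.n k))⁻¹ * ltwo (cols (N.X k) (N.M k i) *ᵥ δ)
  ridge_nonneg : ∀ k i, 0 ≤ N.ρ k i
  ridge_le : ∀ k i, N.ρ k i ≤ κ * N.nMin

/-- All assumptions that concern the model and the calibration stage, together with the bound
`σmax` on the standard deviations of the errors. -/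
structure Admissible (s σmax κ : ℝ) (c₁ c₂ : Fin 2 → ℝ) : Prop where
  standing : N.Standing
  identifiable : N.Identifiable
  sameOrder : N.SameOrder κ
  calibration : N.Calibration s κ c₁ c₂
  sd_le : ∀ k i, (N.σ k i : ℝ) ≤ σmax

/-- `Y` is generated by the structural equations `Y = Y Γ + X Φ + E` in each network, where
the entries of the error matrix are independent centered normal variables with the given
standard deviations. -/
def IsSample {Ω : Type*} [MeasurableSpace Ω] (μ : Measure Ω) (Y : Ω → N.Obs) : Prop :=
  ∃ E : Ω → N.Obs,
    (∀ k r i, HasLaw (fun ω => E ω k r i) (gaussianReal 0 (N.σ k i ^ 2)) μ) ∧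
    (∀ k, iIndepFun (fun (e : Fin (N.n k) × Fin p) ω => E ω k e.1 e.2) μ) ∧
    (∀ ω k, Y ω k = Y ω k * N.Γ k + N.X k * N.Φ k + E ω k)

end Networks

end ReDNet

end

set_option linter.unusedSectionVars false
set_option linter.unusedDecidableInType false
set_option linter.unusedFintypeInType false

namespace ReDNet

/-! ### Norms -/

section Norms

variable {m ι κ : Type*} [Fintype m] [Fintype ι] [Fintype κ]

/-! Selection is a primal-dual witness argument, run on an event of large probability. With `Z = H_i
Ẑ_{-i}`, call `n⁻¹ Zᵀ(H_i Y_i - Z β_i)` the score. Solving the stationarity equations on `S_i` with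
the signs of `β_i` prescribed gives a candidate supported on `S_i`. If the score is at most `τ/8`
times `λ w_j / 2`, if the signal exceeds the correction to `β_i`, and if the irrepresentability
coefficient of the estimated Gram matrix leaves room for the score, then the candidate keeps the
signs of `β_i` and is strictly dual feasible. Every minimizer then equals it (`lasso_unique`,
`lasso_supp`).

Irrepresentability and `ψ_i` concern the population Gram matrix. A resolvent identity transfers them
to the estimated one (`gram_perturbation`), provided that `|S_i|` times the entrywise error of the
Gram matrix (`abs_IHat_sub_le`) is small. The condition on the first-stage error, once squared, says
just this (`sq_bound_of_sqrt_bound`).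

For the score, `H_i` annihilates the anchors of node `i`, so the projected response is `H_i (X
Π_{-i} β_i + noise)` with reduced-form noise (`H_mulVec_stack`). At `β_i` the residual is therefore
the calibration error applied to `β_i` plus noise, and the score splits into three parts
(`abs_score_le`). The calibration part is deterministic on the good event and is absorbed by the
choice of `t₀`. The noise meets `X Π_{-i}` directly, and meets the calibration error through its
`ℓ₁` norm times the largest correlation of the noise with a column of `X`. The tails of these two
noise parts correspond to the two arguments of the inner minimum in `h_n`.

In the first stage, `π_j` is supported on the screened set (`redForm_eq_zero`), so the ridge error
consists of a noise term and a bias term (`ridge_error`). The bias is what `r_max` measures, and the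
squared norm of `X_Mᵀ noise` is controlled by `quadratic_tail` outside an event of probability
`e^{-f}`. The union over the `p` nodes produces the terms `e^{-f + log p}`. -/

lemma ltwo_nonneg (v : ι → ℝ) : 0 ≤ ltwo v := norm_nonneg _

lemma ltwo_sq (v : ι → ℝ) : ltwo v ^ 2 = v ⬝ᵥ v := by
  rw [ltwo, EuclideanSpace.norm_sq_eq]
  simp [dotProduct, sq]

lemma ltwo_add_le (v w : ι → ℝ) : ltwo (v + w) ≤ ltwo v + ltwo w := by
  simpa [ltwo] using norm_add_le (WithLp.toLp 2 v) (WithLp.toLp 2 w)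

lemma ltwo_smul (c : ℝ) (v : ι → ℝ) : ltwo (c • v) = |c| * ltwo v := by
  simp [ltwo, norm_smul]

lemma ltwo_zero : ltwo (0 : ι → ℝ) = 0 := by simp [ltwo]

lemma ltwo_neg (v : ι → ℝ) : ltwo (-v) = ltwo v := by simp [ltwo]

lemma ltwo_eq_zero {v : ι → ℝ} : ltwo v = 0 ↔ v = 0 := by
  simp [ltwo]

lemma ltwo_pos {v : ι → ℝ} (hv : v ≠ 0) : 0 < ltwo v :=
  lt_of_le_of_ne (ltwo_nonneg v) fun h => hv (ltwo_eq_zero.1 h.symm)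

lemma abs_dotProduct_le (v w : ι → ℝ) : |v ⬝ᵥ w| ≤ ltwo v * ltwo w := by
  have h := abs_real_inner_le_norm (WithLp.toLp 2 w) (WithLp.toLp 2 v)
  rw [EuclideanSpace.inner_eq_star_dotProduct] at h
  simpa [ltwo, mul_comm] using h

lemma ltwo_le_of_sq_le {v : ι → ℝ} {c : ℝ} (hc : 0 ≤ c) (h : v ⬝ᵥ v ≤ c ^ 2) : ltwo v ≤ c := by
  rw [← ltwo_sq] at h
  exact (sq_le_sq₀ (ltwo_nonneg v) hc).1 h

lemma ltwo_sum_smul_le (s : Finset κ) (b : κ → ℝ) (V : κ → ι → ℝ) {c : ℝ}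
    (hV : ∀ j ∈ s, ltwo (V j) ≤ c) : ltwo (∑ j ∈ s, b j • V j) ≤ (∑ j ∈ s, |b j|) * c := by
  classical
  induction s using Finset.induction_on with
  | empty => simp [ltwo_zero]
  | insert a s ha ih =>
    rw [Finset.sum_insert ha, Finset.sum_insert ha, add_mul]
    refine (ltwo_add_le _ _).trans (add_le_add ?_ (ih fun j hj => hV j (Finset.mem_insert_of_mem hj)))
    rw [ltwo_smul]
    exact mul_le_mul_of_nonneg_left (hV a (Finset.mem_insert_self a s)) (abs_nonneg _)

lemma ltwo_mulVec_le_lone (A : Matrix m ι ℝ) (b : ι → ℝ) {c : ℝ}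
    (hA : ∀ j, ltwo (fun r => A r j) ≤ c) : ltwo (A *ᵥ b) ≤ lone b * c := by
  have h : A *ᵥ b = ∑ j, b j • fun r => A r j := by
    ext r
    simp [mulVec, dotProduct, mul_comm]
  rw [h]
  exact ltwo_sum_smul_le _ _ _ fun j _ => hA j

lemma ltwo_sq_sumElim (v : m → ℝ) (w : ι → ℝ) :
    ltwo (Sum.elim v w) ^ 2 = ltwo v ^ 2 + ltwo w ^ 2 := by
  simp only [ltwo_sq, dotProduct, Fintype.sum_sum_type, Sum.elim_inl, Sum.elim_inr]

lemma abs_le_ltwo (v : ι → ℝ) (j : ι) : |v j| ≤ ltwo v := by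
  rw [← sq_le_sq₀ (abs_nonneg _) (ltwo_nonneg _), sq_abs, ltwo_sq, dotProduct, sq]
  exact Finset.single_le_sum (f := fun j => v j * v j) (fun j _ => mul_self_nonneg _)
    (Finset.mem_univ j)

lemma lone_nonneg (v : ι → ℝ) : 0 ≤ lone v := Finset.sum_nonneg fun _ _ => abs_nonneg _

lemma lone_sq_le (v : ι → ℝ) : lone v ^ 2 ≤ Fintype.card ι * ltwo v ^ 2 := by
  have h := Finset.sum_mul_sq_le_sq_mul_sq Finset.univ (fun _ : ι => (1 : ℝ)) fun j => |v j|
  rw [ltwo_sq]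
  simpa [lone, dotProduct, sq] using h

lemma abs_dotProduct_le_lone (v w : ι → ℝ) {c : ℝ} (hw : ∀ j, |w j| ≤ c) :
    |v ⬝ᵥ w| ≤ lone v * c := by
  rw [lone, Finset.sum_mul]
  refine (Finset.abs_sum_le_sum_abs _ _).trans (Finset.sum_le_sum fun j _ => ?_)
  rw [abs_mul]
  exact mul_le_mul_of_nonneg_left (hw j) (abs_nonneg _)

lemma minAbs_le (v : ι → ℝ) (j : ι) : minAbs v ≤ |v j| :=
  ciInf_le (Set.finite_range _).bddBelow j

lemma minAbs_pos [Nonempty ι] {v : ι → ℝ} (hv : ∀ j, v j ≠ 0) : 0 < minAbs v := by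
  obtain ⟨j, hj⟩ := exists_eq_ciInf_of_finite (f := fun j => |v j|)
  rw [minAbs, ← hj]
  exact abs_pos.2 (hv j)

lemma sum_le_matOne (A : Matrix m ι ℝ) (j : ι) : ∑ r, |A r j| ≤ matOne A :=
  le_ciSup (f := fun j => ∑ r, |A r j|) (Set.finite_range _).bddAbove j

lemma matOne_nonneg (A : Matrix m ι ℝ) : 0 ≤ matOne A :=
  Real.iSup_nonneg fun _ => Finset.sum_nonneg fun _ _ => abs_nonneg _

lemma sum_le_matInf (A : Matrix m ι ℝ) (r : m) : ∑ j, |A r j| ≤ matInf A :=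
  le_ciSup (f := fun r => ∑ j, |A r j|) (Set.finite_range _).bddAbove r

lemma matInf_nonneg (A : Matrix m ι ℝ) : 0 ≤ matInf A :=
  Real.iSup_nonneg fun _ => Finset.sum_nonneg fun _ _ => abs_nonneg _

lemma matInf_le {A : Matrix m ι ℝ} {c : ℝ} (hc : 0 ≤ c) (h : ∀ r, ∑ j, |A r j| ≤ c) :
    matInf A ≤ c :=
  Real.iSup_le h hc

lemma abs_mulVec_le (A : Matrix m ι ℝ) {v : ι → ℝ} {c : ℝ} (hv : ∀ j, |v j| ≤ c)
    (hc : 0 ≤ c) (r : m) : |(A *ᵥ v) r| ≤ matInf A * c :=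
  (abs_dotProduct_le_lone _ _ hv).trans (mul_le_mul_of_nonneg_right (sum_le_matInf A r) hc)

lemma matInf_add_le (A B : Matrix m ι ℝ) : matInf (A + B) ≤ matInf A + matInf B := by
  refine matInf_le (add_nonneg (matInf_nonneg _) (matInf_nonneg _)) fun r => ?_
  refine le_trans ?_ (add_le_add (sum_le_matInf A r) (sum_le_matInf B r))
  rw [← Finset.sum_add_distrib]
  exact Finset.sum_le_sum fun j _ => abs_add_le _ _

lemma matInf_mul_le (A : Matrix m ι ℝ) (B : Matrix ι κ ℝ) :
    matInf (A * B) ≤ matInf A * matInf B := by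
  refine matInf_le (mul_nonneg (matInf_nonneg _) (matInf_nonneg _)) fun r => ?_
  calc ∑ j, |(A * B) r j| ≤ ∑ j, ∑ l, |A r l| * |B l j| := by
        refine Finset.sum_le_sum fun j _ => ?_
        rw [mul_apply]
        refine (Finset.abs_sum_le_sum_abs _ _).trans_eq (by simp [abs_mul])
    _ = ∑ l, |A r l| * ∑ j, |B l j| := by
        rw [Finset.sum_comm]
        simp [Finset.mul_sum]
    _ ≤ ∑ l, |A r l| * matInf B :=
        Finset.sum_le_sum fun l _ => mul_le_mul_of_nonneg_left (sum_le_matInf B l) (abs_nonneg _)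
    _ ≤ matInf A * matInf B := by
        rw [← Finset.sum_mul]
        exact mul_le_mul_of_nonneg_right (sum_le_matInf A r) (matInf_nonneg B)

lemma matInf_diagonal_le [DecidableEq ι] {v : ι → ℝ} {c : ℝ} (hc : 0 ≤ c) (hv : ∀ j, |v j| ≤ c) :
    matInf (diagonal v) ≤ c := by
  refine matInf_le hc fun r => ?_
  rw [Finset.sum_eq_single r]
  · simpa using hv r
  · intro b _ hb
    simp [diagonal_apply_ne' _ hb]
  · simp

end Norms

/-! ### Symmetric projections -/

section Projection

variable {m ι : Type*} [Fintype m] [Fintype ι] [DecidableEq m] [DecidableEq ι]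

lemma annihilator_transpose (X : Matrix m ι ℝ) : (annihilator X)ᵀ = annihilator X := by
  simp [annihilator, transpose_mul, transpose_nonsing_inv, Matrix.mul_assoc]

lemma annihilator_mul_self {X : Matrix m ι ℝ} (h : IsUnit (Xᵀ * X).det) :
    annihilator X * X = 0 := by
  rw [annihilator, Matrix.sub_mul, Matrix.one_mul, Matrix.mul_assoc, Matrix.mul_assoc,
    nonsing_inv_mul _ h, Matrix.mul_one, sub_self]

lemma annihilator_idem {X : Matrix m ι ℝ} (h : IsUnit (Xᵀ * X).det) :
    annihilator X * annihilator X = annihilator X := by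
  conv_lhs => enter [2]; rw [annihilator]
  rw [Matrix.mul_sub, Matrix.mul_one, ← Matrix.mul_assoc, ← Matrix.mul_assoc,
    annihilator_mul_self h, Matrix.zero_mul, Matrix.zero_mul, sub_zero]

/-- Symmetry and idempotence give `‖Pv‖² = v ⬝ Pv`, to which Cauchy–Schwarz applies. -/
lemma ltwo_mulVec_le_of_idem {P : Matrix m m ℝ} (hT : Pᵀ = P) (hP : P * P = P) (v : m → ℝ) :
    ltwo (P *ᵥ v) ≤ ltwo v := by
  have h1 : ltwo (P *ᵥ v) ^ 2 = v ⬝ᵥ P *ᵥ v := by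
    rw [ltwo_sq, dotProduct_mulVec, vecMul_mulVec, hT, hP, dotProduct_comm, ← mulVec_transpose, hT]
  have h2 := (le_abs_self _).trans (abs_dotProduct_le v (P *ᵥ v))
  by_contra! h
  nlinarith [ltwo_nonneg v]

end Projection

/-! ### Variable selection by the weighted lasso: deterministic part -/

section Lasso

variable {m ι : Type*} [Fintype m] [Fintype ι] [DecidableEq ι]

lemma ltwo_sub_sq (v w : m → ℝ) : ltwo (v - w) ^ 2 = ltwo v ^ 2 - 2 * (w ⬝ᵥ v) + ltwo w ^ 2 := by
  simp only [ltwo_sq, sub_dotProduct, dotProduct_sub]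
  rw [dotProduct_comm v w]
  ring

/-- A minimizer of the weighted lasso coincides with a strictly dual feasible stationary point
whose active Gram matrix is invertible. -/
lemma lasso_unique {Z : Matrix m ι ℝ} {y : m → ℝ} {c t : ℝ} {w b u : ι → ℝ} {S : Finset ι}
    (hc : 0 < c) (ht : 0 < t) (hw : ∀ j, 0 < w j)
    (hmin : c * ltwo (y - Z *ᵥ b) ^ 2 + t * ∑ j, w j * |b j| ≤
      c * ltwo (y - Z *ᵥ u) ^ 2 + t * ∑ j, w j * |u j|)
    (hS : ∀ j ∉ S, u j = 0)
    (hstat : ∀ j ∈ S, c * (Zᵀ *ᵥ (y - Z *ᵥ u)) j = t / 2 * w j * SignType.sign (u j))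
    (hdual : ∀ j ∉ S, |c * (Zᵀ *ᵥ (y - Z *ᵥ u)) j| < t / 2 * w j)
    (hinj : ∀ v : ι → ℝ, (∀ j ∉ S, v j = 0) → Z *ᵥ v = 0 → v = 0) : b = u := by
  set r := c • (Zᵀ *ᵥ (y - Z *ᵥ u)) with hr
  -- Exact expansion of the quadratic loss around `u`; `r` is minus half its gradient there.
  have hexp : c * ltwo (y - Z *ᵥ b) ^ 2 = c * ltwo (y - Z *ᵥ u) ^ 2 - 2 * ∑ j, (b j - u j) * r j
      + c * ltwo (Z *ᵥ (b - u)) ^ 2 := by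
    have h1 : y - Z *ᵥ b = (y - Z *ᵥ u) - Z *ᵥ (b - u) := by
      rw [mulVec_sub]; abel
    have h2 : ∑ j, (b j - u j) * r j = c * ((Z *ᵥ (b - u)) ⬝ᵥ (y - Z *ᵥ u)) := by
      rw [← vecMul_transpose, ← dotProduct_mulVec, hr]
      simp only [dotProduct, Finset.mul_sum, Pi.smul_apply, smul_eq_mul, Pi.sub_apply]
      exact Finset.sum_congr rfl fun j _ => by ring
    rw [h1, ltwo_sub_sq, h2]
    ring
  -- Subgradient inequality for the penalty, coordinate by coordinate. Minimality of `b` forces all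
  -- these terms and the quadratic remainder to vanish.
  have hterm : ∀ j, 0 ≤ t * (w j * |b j|) - t * (w j * |u j|) - 2 * ((b j - u j) * r j) := by
    intro j
    by_cases hj : j ∈ S
    · have h1 : r j = t / 2 * w j * SignType.sign (u j) := hstat j hj
      have h2 : u j * SignType.sign (u j) = |u j| := by rw [mul_comm]; exact sign_mul_self (u j)
      have h3 : b j * SignType.sign (u j) ≤ |b j| := by
        refine (le_abs_self _).trans ?_
        rw [abs_mul]
        refine mul_le_of_le_one_right (abs_nonneg _) ?_
        rcases lt_trichotomy (u j) 0 with h | h | h <;> simp [h]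
      have h4 : t * (w j * |b j|) - t * (w j * |u j|) - 2 * ((b j - u j) * r j) =
          t * w j * (|b j| - b j * SignType.sign (u j)) := by
        rw [h1, ← h2]
        ring
      rw [h4]
      exact mul_nonneg (mul_pos ht (hw j)).le (sub_nonneg.2 h3)
    · have h1 : |r j| < t / 2 * w j := hdual j hj
      have h2 : b j * r j ≤ |b j| * |r j| := (le_abs_self _).trans (abs_mul _ _).le
      rw [hS j hj]
      simp only [abs_zero, sub_zero, mul_zero]
      nlinarith [mul_le_mul_of_nonneg_left h1.le (abs_nonneg (b j))]
  have hsum : 0 ≤ ∑ j, (t * (w j * |b j|) - t * (w j * |u j|) - 2 * ((b j - u j) * r j)) :=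
    Finset.sum_nonneg fun j _ => hterm j
  have hsum' : ∑ j, (t * (w j * |b j|) - t * (w j * |u j|) - 2 * ((b j - u j) * r j)) =
      t * ∑ j, w j * |b j| - t * ∑ j, w j * |u j| - 2 * ∑ j, (b j - u j) * r j := by
    simp only [Finset.sum_sub_distrib, Finset.mul_sum]
  have hZ : 0 ≤ c * ltwo (Z *ᵥ (b - u)) ^ 2 := mul_nonneg hc.le (sq_nonneg _)
  have h0 : ∑ j, (t * (w j * |b j|) - t * (w j * |u j|) - 2 * ((b j - u j) * r j)) = 0 := by
    linarith
  have hZ0 : Z *ᵥ (b - u) = 0 := by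
    have : c * ltwo (Z *ᵥ (b - u)) ^ 2 = 0 := by linarith
    exact ltwo_eq_zero.1 (pow_eq_zero_iff two_ne_zero |>.1
      ((mul_eq_zero.1 this).resolve_left hc.ne'))
  have hbu : b - u = 0 := by
    -- Off `S` the dual bound is strict, so a vanishing term leaves only `b j = 0`; then `b - u`
    -- lives on `S`, where `Z` is injective.
    refine hinj _ (fun j hj => ?_) hZ0
    have h1 := (Finset.sum_eq_zero_iff_of_nonneg fun j _ => hterm j).1 h0 j (Finset.mem_univ j)
    have h2 : |r j| < t / 2 * w j := hdual j hj
    have h3 : b j * r j ≤ |b j| * |r j| := (le_abs_self _).trans (abs_mul _ _).le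
    rw [hS j hj] at h1
    simp only [abs_zero, sub_zero, mul_zero] at h1
    have h4 : |b j| * (t / 2 * w j - |r j|) ≤ 0 := by linarith
    have h5 : |b j| ≤ 0 := by
      by_contra! h
      nlinarith [mul_pos h (sub_pos.2 h2)]
    simp [hS j hj, abs_nonpos_iff.1 h5]
  exact sub_eq_zero.1 hbu

lemma diagonal_inv_of_le {v : ι → ℝ} {c : ℝ} (hc : 0 < c) (hv : ∀ j, c ≤ v j) :
    (diagonal v)⁻¹ = diagonal (fun j => (v j)⁻¹) ∧ matInf (diagonal fun j => (v j)⁻¹) ≤ c⁻¹ := by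
  constructor
  · refine inv_eq_right_inv ?_
    rw [diagonal_mul_diagonal, ← diagonal_one]
    congr 1
    ext j
    exact mul_inv_cancel₀ (hc.trans_le (hv j)).ne'
  · refine matInf_diagonal_le (inv_nonneg.2 hc.le) fun j => ?_
    rw [abs_of_pos (inv_pos.2 (hc.trans_le (hv j)))]
    exact inv_anti₀ hc (hv j)

/-- Stability of the weighted inverse and of the weighted irrepresentability coefficient under
small perturbations of the Gram matrix. -/
lemma gram_perturbation {s s' : Type*} [Fintype s] [Fintype s'] [DecidableEq s] [DecidableEq s']
    {A A' : Matrix s s ℝ} {C C' : Matrix s' s ℝ} {w : s → ℝ} {w' : s' → ℝ} {wmin ε θ η : ℝ}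
    (hA : IsUnit A) (hA' : IsUnit A') (hwmin : 0 < wmin)
    (hw : ∀ j, wmin ≤ w j) (hw' : ∀ j, wmin ≤ w' j)
    (hAA : matInf (A' - A) ≤ ε) (hCC : matInf (C' - C) ≤ ε)
    (hεθ : ε * matInf (A⁻¹ * diagonal w) ≤ θ * wmin)
    (hη : matInf ((diagonal w')⁻¹ * C * A⁻¹ * diagonal w) ≤ η) :
    (1 - θ) * matInf (A'⁻¹ * diagonal w) ≤ matInf (A⁻¹ * diagonal w) ∧
    (1 - θ) * matInf ((diagonal w')⁻¹ * C' * A'⁻¹ * diagonal w) ≤ η + θ := by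
  have hA1 := (isUnit_iff_isUnit_det A).1 hA
  have hA2 := (isUnit_iff_isUnit_det A').1 hA'
  have hwpos : ∀ j, 0 < w j := fun j => hwmin.trans_le (hw j)
  have hdet : IsUnit (diagonal w).det := by
    rw [det_diagonal]
    exact (Finset.prod_pos fun j _ => hwpos j).ne'.isUnit
  set P := A⁻¹ * diagonal w with hP
  have hψ := matInf_nonneg P
  have hε : 0 ≤ ε := (matInf_nonneg _).trans hAA
  obtain ⟨hi, hi'⟩ := diagonal_inv_of_le hwmin hw
  obtain ⟨hj, hj'⟩ := diagonal_inv_of_le hwmin hw'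
  have hθP : wmin⁻¹ * (ε * matInf P) ≤ θ := by
    rw [inv_mul_le_iff₀ hwmin, mul_comm wmin]
    exact hεθ
  -- The relative size of the perturbation: the factor `(diagonal w)⁻¹` costs `1 / wmin`, which
  -- `hεθ` pays for.
  have hAP : matInf ((diagonal w)⁻¹ * ((A - A') * P)) ≤ θ := by
    refine le_trans ?_ hθP
    rw [hi]
    refine (matInf_mul_le _ _).trans (mul_le_mul hi' ((matInf_mul_le _ _).trans ?_)
      (matInf_nonneg _) (inv_nonneg.2 hwmin.le))
    refine mul_le_mul_of_nonneg_right ?_ hψ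
    refine le_trans (le_of_eq ?_) hAA
    simp only [matInf, Matrix.sub_apply, abs_sub_comm (A _ _)]
  have hCP : matInf ((diagonal w')⁻¹ * ((C' - C) * P)) ≤ θ := by
    refine le_trans ?_ hθP
    rw [hj]
    exact (matInf_mul_le _ _).trans (mul_le_mul hj' ((matInf_mul_le _ _).trans
      (mul_le_mul_of_nonneg_right hCC hψ)) (matInf_nonneg _) (inv_nonneg.2 hwmin.le))
  have hAAinv : A * P = diagonal w := by
    rw [hP, ← Matrix.mul_assoc, mul_nonsing_inv _ hA1, Matrix.one_mul]
  -- the resolvent identity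
  have key : A'⁻¹ * diagonal w = P + A'⁻¹ * diagonal w * ((diagonal w)⁻¹ * ((A - A') * P)) := by
    rw [Matrix.mul_assoc A'⁻¹ (diagonal w), ← Matrix.mul_assoc (diagonal w),
      mul_nonsing_inv _ hdet, Matrix.one_mul, Matrix.sub_mul, hAAinv, Matrix.mul_sub,
      ← Matrix.mul_assoc A'⁻¹ A', nonsing_inv_mul _ hA2, Matrix.one_mul]
    abel
  constructor
  · have h := congrArg matInf key
    have h1 := matInf_add_le P (A'⁻¹ * diagonal w * ((diagonal w)⁻¹ * ((A - A') * P)))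
    have h2 := matInf_mul_le (A'⁻¹ * diagonal w) ((diagonal w)⁻¹ * ((A - A') * P))
    have h3 := mul_le_mul_of_nonneg_left hAP (matInf_nonneg (A'⁻¹ * diagonal w))
    nlinarith
  · set K := (diagonal w')⁻¹ * C' * A'⁻¹ * diagonal w with hK
    -- The identity `key` multiplied from the left by `(diagonal w')⁻¹ * C'`. Since `K` reappears on
    -- the right with a factor of norm at most `θ`, it can be absorbed on the left.
    have key2 : K = (diagonal w')⁻¹ * C * A⁻¹ * diagonal w +
        (diagonal w')⁻¹ * ((C' - C) * P) + K * ((diagonal w)⁻¹ * ((A - A') * P)) := by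
      have h1 : K = (diagonal w')⁻¹ * C' * (A'⁻¹ * diagonal w) := by
        simp only [hK, Matrix.mul_assoc]
      have h2 : K = (diagonal w')⁻¹ * C' * P +
          K * ((diagonal w)⁻¹ * ((A - A') * P)) := by
        conv_lhs => rw [h1, key, Matrix.mul_add]
        rw [h1]
        simp only [Matrix.mul_assoc]
      conv_lhs => rw [h2]
      congr 1
      rw [hP, Matrix.sub_mul, Matrix.mul_sub]
      simp only [Matrix.mul_assoc]
      abel
    have h := congrArg matInf key2
    have h1 := matInf_add_le ((diagonal w')⁻¹ * C * A⁻¹ * diagonal w +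
      (diagonal w')⁻¹ * ((C' - C) * P)) (K * ((diagonal w)⁻¹ * ((A - A') * P)))
    have h1' := matInf_add_le ((diagonal w')⁻¹ * C * A⁻¹ * diagonal w)
      ((diagonal w')⁻¹ * ((C' - C) * P))
    have h2 := matInf_mul_le K ((diagonal w)⁻¹ * ((A - A') * P))
    have h3 := mul_le_mul_of_nonneg_left hAP (matInf_nonneg K)
    nlinarith

open Classical in
/-- The extension by zero of a vector on `S`. -/
def extend (S : Finset ι) (v : {j // j ∈ S} → ℝ) : ι → ℝ := fun j => if h : j ∈ S then v ⟨j, h⟩ else 0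

lemma extend_mem (S : Finset ι) (v : {j // j ∈ S} → ℝ) (j : {j // j ∈ S}) : extend S v j = v j := by
  simp [extend]

lemma extend_notMem (S : Finset ι) (v : {j // j ∈ S} → ℝ) {j : ι} (hj : j ∉ S) :
    extend S v j = 0 := by
  simp [extend, hj]

lemma mulVec_extend (S : Finset ι) (A : Matrix m ι ℝ) (v : {j // j ∈ S} → ℝ) (r : m) :
    (A *ᵥ extend S v) r = (A.submatrix id Subtype.val *ᵥ v) r := by
  simp only [mulVec, dotProduct]
  rw [← Finset.sum_subset (Finset.subset_univ S) fun j _ hj => by rw [extend_notMem S v hj, mul_zero],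
    ← Finset.sum_coe_sort S]
  exact Finset.sum_congr rfl fun j _ => by rw [extend_mem]; rfl

lemma mem_supp {v : ι → ℝ} {j : ι} : j ∈ supp v ↔ v j ≠ 0 := by simp [supp]

/-- Sign consistency of the weighted lasso. -/
lemma lasso_supp {Z : Matrix m ι ℝ} {y e : m → ℝ} {c t ε : ℝ} {w b β : ι → ℝ} {S : Finset ι}
    (hc : 0 < c) (ht : 0 < t) (hw : ∀ j, 0 < w j) (hε : 0 ≤ ε) (hS : S = supp β)
    (hy : y = Z *ᵥ β + e)
    (hmin : ∀ u, c * ltwo (y - Z *ᵥ b) ^ 2 + t * ∑ j, w j * |b j| ≤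
      c * ltwo (y - Z *ᵥ u) ^ 2 + t * ∑ j, w j * |u j|)
    (hJ : ∀ j, |c * (Zᵀ *ᵥ e) j| ≤ ε * (t / 2 * w j))
    (hunit : IsUnit (block11 (c • (Zᵀ * Z)) S))
    (hsig : ∀ j ∈ S, matInf ((block11 (c • (Zᵀ * Z)) S)⁻¹ * diagonal fun j : {j // j ∈ S} => w j) *
      ((1 + ε) * (t / 2)) < |β j|)
    (hirr : matInf ((diagonal fun j : {j // j ∉ S} => w j)⁻¹ * block21 (c • (Zᵀ * Z)) S *
      (block11 (c • (Zᵀ * Z)) S)⁻¹ * diagonal fun j : {j // j ∈ S} => w j) * (1 + ε) + ε < 1) :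
    supp b = S := by
  set Q := c • (Zᵀ * Z) with hQ
  set Q11 := block11 Q S with hQ11
  have hdet := (isUnit_iff_isUnit_det Q11).1 hunit
  -- Chosen so that `v = Q11⁻¹ W z` solves the stationarity equations on `S` for `u = β + v`, with
  -- the signs of `β` in place of those of `u`. The signal bound `hsig` shows afterwards that the
  -- signs agree.
  set z : {j // j ∈ S} → ℝ := fun j => (w j)⁻¹ * (c * (Zᵀ *ᵥ e) j) - t / 2 * SignType.sign (β j)
    with hz
  have hzle : ∀ j, |z j| ≤ (1 + ε) * (t / 2) := by
    intro j
    have h1 : |(w j)⁻¹ * (c * (Zᵀ *ᵥ e) j)| ≤ ε * (t / 2) := by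
      rw [abs_mul, abs_of_pos (inv_pos.2 (hw j)), inv_mul_le_iff₀ (hw j)]
      linarith [hJ j]
    have h2 : |t / 2 * SignType.sign (β j)| ≤ t / 2 := by
      rw [abs_mul, abs_of_pos (half_pos ht)]
      refine mul_le_of_le_one_right (half_pos ht).le ?_
      rcases lt_trichotomy (β j) 0 with h | h | h <;> simp [h]
    linarith [abs_sub ((w j)⁻¹ * (c * (Zᵀ *ᵥ e) j)) (t / 2 * SignType.sign (β j))]
  have hc0 : 0 ≤ (1 + ε) * (t / 2) := by positivity
  set W := diagonal fun j : {j // j ∈ S} => w j with hW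
  set v := (Q11⁻¹ * W) *ᵥ z with hv
  have hvle : ∀ j, |v j| < |β j| := fun j =>
    (abs_mulVec_le _ hzle hc0 j).trans_lt (hsig j j.2)
  set u := β + extend S v with hu
  have hgrad : c • (Zᵀ *ᵥ (y - Z *ᵥ u)) = c • (Zᵀ *ᵥ e) - Q *ᵥ extend S v := by
    rw [hy, hu, mulVec_add, add_sub_add_left_eq_sub, mulVec_sub, smul_sub, hQ, smul_mulVec,
      mulVec_mulVec]
  have hgrad' : ∀ j, c * (Zᵀ *ᵥ (y - Z *ᵥ u)) j = c * (Zᵀ *ᵥ e) j - (Q *ᵥ extend S v) j :=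
    fun j => congrFun hgrad j
  have hsign : ∀ j ∈ S, SignType.sign (u j) = SignType.sign (β j) := by
    intro j hj
    have h1 := abs_lt.1 (hvle ⟨j, hj⟩)
    have h2 : u j = β j + v ⟨j, hj⟩ := by
      rw [hu, Pi.add_apply, extend_mem S v ⟨j, hj⟩]
    rw [h2]
    rcases lt_trichotomy (β j) 0 with h | h | h
    · rw [sign_neg h, sign_neg]
      rw [abs_of_neg h] at h1
      linarith
    · simp [h] at h1
      linarith
    · rw [sign_pos h, sign_pos]
      rw [abs_of_pos h] at h1
      linarith
  have hβ0 : ∀ j ∉ S, β j = 0 := fun j hj => by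
    by_contra h
    exact hj (hS ▸ mem_supp.2 h)
  have hbu : b = u := by
    refine lasso_unique hc ht hw (hmin u) (S := S) (fun j hj => ?_) (fun j hj => ?_)
      (fun j hj => ?_) fun x hx hZx => ?_
    · rw [hu, Pi.add_apply, extend_notMem S v hj, hβ0 j hj, add_zero]
    · have h1 : (Q *ᵥ extend S v) j = (Q11 *ᵥ v) ⟨j, hj⟩ := mulVec_extend S Q v j
      have h2 : Q11 *ᵥ v = W *ᵥ z := by
        rw [hv, mulVec_mulVec, ← Matrix.mul_assoc, mul_nonsing_inv _ hdet, Matrix.one_mul]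
      rw [hgrad', h1, h2, hW, mulVec_diagonal, hz, hsign j hj]
      simp only
      rw [mul_sub, ← mul_assoc (w j), mul_inv_cancel₀ (hw j).ne']
      ring
    · have h1 : (Q *ᵥ extend S v) j = (block21 Q S *ᵥ v) ⟨j, hj⟩ := mulVec_extend S Q v j
      set K := (diagonal fun j : {j // j ∉ S} => w j)⁻¹ * block21 Q S * Q11⁻¹ * W with hK
      have hwc : IsUnit (diagonal fun j : {j // j ∉ S} => w j).det := by
        rw [det_diagonal]
        exact (Finset.prod_pos fun (j : {j // j ∉ S}) _ => hw j).ne'.isUnit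
      have h2 : block21 Q S *ᵥ v = (diagonal fun j : {j // j ∉ S} => w j) *ᵥ (K *ᵥ z) := by
        rw [hv, mulVec_mulVec, mulVec_mulVec, hK]
        simp only [← Matrix.mul_assoc]
        rw [mul_nonsing_inv _ hwc, Matrix.one_mul]
      have h3 := abs_mulVec_le K hzle hc0 ⟨j, hj⟩
      rw [hgrad', h1, h2, mulVec_diagonal]
      calc |c * (Zᵀ *ᵥ e) j - w j * (K *ᵥ z) ⟨j, hj⟩|
          ≤ |c * (Zᵀ *ᵥ e) j| + |w j * (K *ᵥ z) ⟨j, hj⟩| := abs_sub _ _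
        _ ≤ ε * (t / 2 * w j) + w j * (matInf K * ((1 + ε) * (t / 2))) := by
            rw [abs_mul (w j), abs_of_pos (hw j)]
            exact add_le_add (hJ j) (mul_le_mul_of_nonneg_left h3 (hw j).le)
        _ = (matInf K * (1 + ε) + ε) * (t / 2 * w j) := by ring
        _ < 1 * (t / 2 * w j) := mul_lt_mul_of_pos_right hirr (mul_pos (half_pos ht) (hw j))
        _ = t / 2 * w j := one_mul _
    · have hx' : x = extend S fun j => x j := by
        ext j
        by_cases hj : j ∈ S
        · exact (extend_mem S (fun j => x j) ⟨j, hj⟩).symm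
        · rw [hx j hj, extend_notMem _ _ hj]
      have h1 : Q11 *ᵥ (fun j : {j // j ∈ S} => x j) = 0 := by
        ext j
        rw [hQ11, block11]
        refine (mulVec_extend S Q _ j).symm.trans ?_
        rw [← hx', hQ, smul_mulVec, ← mulVec_mulVec, hZx]
        simp
      have h2 : (fun j : {j // j ∈ S} => x j) = 0 := by
        rw [← one_mulVec (fun j : {j // j ∈ S} => x j), ← nonsing_inv_mul _ hdet, ← mulVec_mulVec,
          h1, mulVec_zero]
      rw [hx', h2]
      ext j
      simp [extend]
  rw [hbu]
  ext j
  rw [mem_supp]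
  by_cases hj : j ∈ S
  · refine iff_of_true (fun h => ?_) hj
    have h1 := hsign j hj
    rw [h, sign_zero, eq_comm, sign_eq_zero_iff] at h1
    exact mem_supp.1 (hS ▸ hj) h1
  · rw [hu, Pi.add_apply, extend_notMem S v hj, hβ0 j hj]
    simp [hj]

end Lasso

/-! ### Subgaussian vectors -/

section Subgaussian

variable {Ω : Type*} [MeasurableSpace Ω] {μ : Measure Ω}

lemma _root_.ProbabilityTheory.HasSubgaussianMGF.mono_const {X : Ω → ℝ} {c c' : ℝ≥0}
    (h : HasSubgaussianMGF X c μ) (hc : c ≤ c') : HasSubgaussianMGF X c' μ where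
  integrable_exp_mul := h.integrable_exp_mul
  mgf_le t := (h.mgf_le t).trans (Real.exp_le_exp.2 (by gcongr))

lemma hasSubgaussianMGF_of_hasLaw {X : Ω → ℝ} {c : ℝ≥0} (h : HasLaw X (gaussianReal 0 c) μ) :
    HasSubgaussianMGF X c μ where
  integrable_exp_mul t := by
    have h1 := integrable_exp_mul_gaussianReal (μ := 0) (v := c) t
    rw [← h.map_eq] at h1
    exact (integrable_map_measure h1.aestronglyMeasurable h.aemeasurable).1 h1
  mgf_le t := by
    rw [mgf_gaussianReal h.map_eq]
    simp

/-- A random vector is subgaussian with variance proxy `v` if every linear functional `u` of it is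
subgaussian with variance proxy `v ‖u‖₂²`. -/
def SubgaussianVector {ι : Type*} [Fintype ι] (ξ : Ω → ι → ℝ) (v : ℝ≥0) (μ : Measure Ω) : Prop :=
  ∀ u : ι → ℝ, HasSubgaussianMGF (fun ω => u ⬝ᵥ ξ ω) (v * (u ⬝ᵥ u).toNNReal) μ

variable {ι κ : Type*} [Fintype ι] [Fintype κ] {ξ : Ω → ι → ℝ} {v : ℝ≥0}

lemma SubgaussianVector.aemeasurable (h : SubgaussianVector ξ v μ) (u : ι → ℝ) :
    AEMeasurable (fun ω => u ⬝ᵥ ξ ω) μ :=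
  (h u).aemeasurable

lemma SubgaussianVector.tail [IsProbabilityMeasure μ] (h : SubgaussianVector ξ v μ) {u : ι → ℝ}
    {L T : ℝ} (hu : u ⬝ᵥ u ≤ L) (hL : 0 ≤ L) (hT : 0 ≤ T) :
    μ.real {ω | T ≤ |u ⬝ᵥ ξ ω|} ≤ 2 * Real.exp (-T ^ 2 / (2 * (v * L))) := by
  have hc : v * (u ⬝ᵥ u).toNNReal ≤ v * L.toNNReal :=
    mul_le_mul_right (Real.toNNReal_le_toNNReal hu) v
  have h1 := ((h u).mono_const hc).measure_ge_le hT
  have h2 := ((h u).mono_const hc).neg.measure_ge_le hT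
  rw [NNReal.coe_mul, Real.coe_toNNReal _ hL] at h1 h2
  have hsub : {ω | T ≤ |u ⬝ᵥ ξ ω|} ⊆
      {ω | T ≤ u ⬝ᵥ ξ ω} ∪ {ω | T ≤ (-fun ω => u ⬝ᵥ ξ ω) ω} := by
    intro ω hω
    exact (le_abs (a := T) (b := u ⬝ᵥ ξ ω)).1 hω
  have h3 := (measureReal_mono (μ := μ) hsub).trans (measureReal_union_le _ _)
  linarith

/-- The coordinates are independent, so the integral factorizes; writing each factor as `exp (c i)`
turns the product into a sum of exponents. -/
lemma lintegral_exp_sum_pi_gaussianReal (f : κ → ℝ → ℝ) (c : κ → ℝ)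
    (hf : ∀ i, Integrable (fun x => Real.exp (f i x)) (gaussianReal 0 1))
    (hc : ∀ i, ∫ x, Real.exp (f i x) ∂gaussianReal 0 1 = Real.exp (c i)) :
    ∫⁻ g : κ → ℝ, ENNReal.ofReal (Real.exp (∑ i, f i (g i))) ∂Measure.pi (fun _ => gaussianReal 0 1)
      = ENNReal.ofReal (Real.exp (∑ i, c i)) := by
  simp only [Real.exp_sum]
  rw [← ofReal_integral_eq_lintegral_ofReal (Integrable.fintype_prod hf)
    (Filter.Eventually.of_forall fun _ => Finset.prod_nonneg fun _ _ => (Real.exp_pos _).le),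
    integral_fintype_prod_eq_prod (fun i x => Real.exp (f i x))]
  simp only [hc]

lemma lintegral_exp_dotProduct_pi_gaussianReal (x : κ → ℝ) :
    ∫⁻ g : κ → ℝ, ENNReal.ofReal (Real.exp (x ⬝ᵥ g)) ∂Measure.pi (fun _ => gaussianReal 0 1)
      = ENNReal.ofReal (Real.exp (x ⬝ᵥ x / 2)) := by
  have h := lintegral_exp_sum_pi_gaussianReal (fun i g => x i * g) (fun i => x i ^ 2 / 2)
    (fun i => integrable_exp_mul_gaussianReal (x i)) fun i => ?_
  · rw [← Finset.sum_div] at h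
    simpa only [dotProduct, sq] using h
  · have := mgf_gaussianReal (p := gaussianReal 0 1) (X := id) (μ := 0) (v := 1) (by simp) (x i)
    simpa [mgf] using this

/-- The factor `exp (x² / 4)` halves the exponent of the standard normal density, and the resulting
Gaussian integral has the value `√2`. -/
lemma gaussianReal_exp_sq_div_four :
    Integrable (fun x => Real.exp (x ^ 2 / 4)) (gaussianReal 0 1) ∧
      ∫ x, Real.exp (x ^ 2 / 4) ∂gaussianReal 0 1 = Real.exp (Real.log 2 / 2) := by
  have hpdf : ∀ x : ℝ, gaussianPDFReal 0 1 x • Real.exp (x ^ 2 / 4) =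
      (√(2 * Real.pi))⁻¹ * Real.exp (-(1 / 4) * x ^ 2) := by
    intro x
    rw [gaussianPDFReal_def]
    simp only [NNReal.coe_one, mul_one, sub_zero, smul_eq_mul]
    rw [mul_assoc, ← Real.exp_add]
    ring_nf
  constructor
  · rw [gaussianReal_of_var_ne_zero _ one_ne_zero,
      integrable_withDensity_iff_integrable_smul' (measurable_gaussianPDF 0 1)
        (Filter.Eventually.of_forall fun _ => gaussianPDF_lt_top)]
    simp only [toReal_gaussianPDF, hpdf]
    exact (integrable_exp_neg_mul_sq (by norm_num)).const_mul _
  · rw [integral_gaussianReal_eq_integral_smul one_ne_zero]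
    simp only [hpdf]
    rw [integral_const_mul, integral_gaussian, ← Real.sqrt_inv, ← Real.sqrt_mul (by positivity),
      Real.sqrt_eq_rpow, Real.rpow_def_of_pos (by positivity)]
    have : (2 * Real.pi)⁻¹ * (Real.pi / (1 / 4)) = 2 := by
      field_simp
      norm_num
    rw [this]
    ring_nf

lemma lintegral_exp_sq_pi_gaussianReal :
    ∫⁻ g : κ → ℝ, ENNReal.ofReal (Real.exp (g ⬝ᵥ g / 4)) ∂Measure.pi (fun _ => gaussianReal 0 1)
      ≤ ENNReal.ofReal (Real.exp (Fintype.card κ)) := by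
  have h := lintegral_exp_sum_pi_gaussianReal (κ := κ) (fun _ g => g ^ 2 / 4)
    (fun _ => Real.log 2 / 2)
    (fun i => gaussianReal_exp_sq_div_four.1) fun i => gaussianReal_exp_sq_div_four.2
  simp only [← Finset.sum_div] at h
  simp only [dotProduct, ← sq]
  rw [h]
  refine ENNReal.ofReal_le_ofReal (Real.exp_le_exp.2 ?_)
  have h2 : Real.log 2 ≤ 1 := by linarith [Real.log_two_lt_d9]
  rw [Finset.sum_const, nsmul_eq_mul, Finset.card_univ]
  nlinarith [Nat.cast_nonneg (α := ℝ) (Fintype.card κ)]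

/-- Tail bound for a quadratic form of a subgaussian vector. -/
lemma SubgaussianVector.quadratic_tail [IsProbabilityMeasure μ] (h : SubgaussianVector ξ v μ)
    (A : Matrix κ ι ℝ) {K D f : ℝ} (hv : 0 < v) (hK : 0 < K)
    (hA : ∀ g, ltwo (Aᵀ *ᵥ g) ^ 2 ≤ K * ltwo g ^ 2) (hd : (Fintype.card κ : ℝ) ≤ D) (hf : f ≤ D) :
    μ.real {ω | 8 * v * K * D < ltwo (A *ᵥ ξ ω) ^ 2} ≤ Real.exp (-f) := by
  have hv' : (0 : ℝ) < v := hv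
  -- With this value the moment generating function bound below becomes `exp (‖g‖² / 4)`, still
  -- integrable against a standard Gaussian `g`.
  set a : ℝ := (2 * v * K)⁻¹ with ha
  have ha0 : 0 < a := by positivity
  have hmeas : ∀ j, AEMeasurable (fun ω => (A *ᵥ ξ ω) j) μ := fun j => h.aemeasurable _
  have hvec : AEMeasurable (fun ω => A *ᵥ ξ ω) μ := aemeasurable_pi_lambda _ hmeas
  -- Linearization of the square by an auxiliary Gaussian vector: `exp (‖x‖² / 2)` is the mean of
  -- `exp (x ⬝ g)`. After Tonelli only linear functionals of `ξ` occur, so no independence of its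
  -- components is needed.
  have hF : ∀ ω, ENNReal.ofReal (Real.exp (a * ltwo (A *ᵥ ξ ω) ^ 2 / 2)) =
      ∫⁻ g : κ → ℝ, ENNReal.ofReal (Real.exp ((√a • (A *ᵥ ξ ω)) ⬝ᵥ g))
        ∂Measure.pi (fun _ => gaussianReal 0 1) := by
    intro ω
    rw [lintegral_exp_dotProduct_pi_gaussianReal, smul_dotProduct, dotProduct_smul, smul_smul,
      Real.mul_self_sqrt ha0.le, ltwo_sq, smul_eq_mul]
  have hFm : AEMeasurable (fun ω => ENNReal.ofReal (Real.exp (a * ltwo (A *ᵥ ξ ω) ^ 2 / 2))) μ := by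
    refine ENNReal.measurable_ofReal.comp_aemeasurable (Real.measurable_exp.comp_aemeasurable ?_)
    simp only [ltwo_sq, dotProduct]
    fun_prop
  have hint : ∫⁻ ω, ENNReal.ofReal (Real.exp (a * ltwo (A *ᵥ ξ ω) ^ 2 / 2)) ∂μ ≤
      ENNReal.ofReal (Real.exp (Fintype.card κ)) := by
    simp only [hF]
    rw [lintegral_lintegral_swap]
    · refine le_trans (lintegral_mono fun g => ?_) lintegral_exp_sq_pi_gaussianReal
      have h1 : ∀ ω, (√a • (A *ᵥ ξ ω)) ⬝ᵥ g = (√a • (Aᵀ *ᵥ g)) ⬝ᵥ ξ ω := by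
        intro ω
        rw [smul_dotProduct, smul_dotProduct, dotProduct_comm, dotProduct_mulVec, ← mulVec_transpose]
      have h2 := (h (√a • (Aᵀ *ᵥ g))).integrable_exp_mul 1
      have h3 := (h (√a • (Aᵀ *ᵥ g))).mgf_le 1
      simp only [one_mul] at h2
      simp only [h1]
      rw [← ofReal_integral_eq_lintegral_ofReal h2
        (Filter.Eventually.of_forall fun _ => (Real.exp_pos _).le)]
      refine ENNReal.ofReal_le_ofReal ?_
      simp only [mgf, one_mul] at h3
      refine h3.trans (Real.exp_le_exp.2 ?_)
      rw [smul_dotProduct, dotProduct_smul, smul_smul, Real.mul_self_sqrt ha0.le, ← ltwo_sq,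
        ← ltwo_sq, smul_eq_mul, NNReal.coe_mul, Real.coe_toNNReal _ (by positivity)]
      have h4 := mul_le_mul_of_nonneg_left (hA g) (mul_nonneg hv'.le ha0.le)
      have h5 : v * a * (K * ltwo g ^ 2) = ltwo g ^ 2 / 2 := by
        rw [ha]
        field_simp
      linarith
    · refine ENNReal.measurable_ofReal.comp_aemeasurable (Real.measurable_exp.comp_aemeasurable ?_)
      have h1 : AEMeasurable (fun z : Ω × (κ → ℝ) => A *ᵥ ξ z.1)
          (μ.prod (Measure.pi fun _ => gaussianReal 0 1)) := hvec.comp_fst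
      have h2 : ∀ j, AEMeasurable (fun z : Ω × (κ → ℝ) => (A *ᵥ ξ z.1) j)
          (μ.prod (Measure.pi fun _ => gaussianReal 0 1)) := fun j =>
        (measurable_pi_apply j).comp_aemeasurable h1
      simp only [dotProduct, Pi.smul_apply, smul_eq_mul]
      refine Finset.aemeasurable_fun_sum _ fun j _ => ?_
      exact ((h2 j).const_mul _).mul (by fun_prop)
  -- Markov's inequality at level `e^{2D}`: one `D` pays for the dimension factor `e^{card κ}`, the
  -- other leaves `e^{-D} ≤ e^{-f}`.
  have hmark := mul_meas_ge_le_lintegral₀ hFm (ENNReal.ofReal (Real.exp (2 * D)))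
  have hsub : {ω | 8 * v * K * D < ltwo (A *ᵥ ξ ω) ^ 2} ⊆ {ω | ENNReal.ofReal (Real.exp (2 * D)) ≤
      ENNReal.ofReal (Real.exp (a * ltwo (A *ᵥ ξ ω) ^ 2 / 2))} := by
    intro ω hω
    refine ENNReal.ofReal_le_ofReal (Real.exp_le_exp.2 ?_)
    have h1 := mul_le_mul_of_nonneg_left (le_of_lt hω) ha0.le
    have h2 : a * (8 * v * K * D) = 4 * D := by
      rw [ha]
      field_simp
      ring
    linarith
  have h1 : ENNReal.ofReal (Real.exp (2 * D)) * μ {ω | 8 * v * K * D < ltwo (A *ᵥ ξ ω) ^ 2} ≤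
      ENNReal.ofReal (Real.exp (Fintype.card κ)) :=
    ((mul_le_mul_right (measure_mono hsub) _).trans hmark).trans hint
  have h2 := ENNReal.toReal_mono ENNReal.ofReal_ne_top h1
  rw [ENNReal.toReal_mul, ENNReal.toReal_ofReal (Real.exp_pos _).le,
    ENNReal.toReal_ofReal (Real.exp_pos _).le] at h2
  have h3 : μ.real {ω | 8 * v * K * D < ltwo (A *ᵥ ξ ω) ^ 2} ≤
      Real.exp (Fintype.card κ) / Real.exp (2 * D) := by
    rw [le_div_iff₀ (Real.exp_pos _), mul_comm]
    exact h2
  refine h3.trans ?_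
  rw [← Real.exp_sub]
  exact Real.exp_le_exp.2 (by linarith)

/-- The rows of a Gaussian matrix with independent entries, applied to a fixed vector, form a
subgaussian vector. -/
lemma subgaussianVector_mulVec [IsProbabilityMeasure μ] {E : Ω → Matrix ι κ ℝ} {σ : κ → ℝ≥0}
    (hlaw : ∀ r i, HasLaw (fun ω => E ω r i) (gaussianReal 0 (σ i ^ 2)) μ)
    (hind : iIndepFun (fun (e : ι × κ) ω => E ω e.1 e.2) μ) {σmax : ℝ≥0} (hσ : ∀ i, σ i ≤ σmax)
    (g : κ → ℝ) : SubgaussianVector (fun ω => E ω *ᵥ g) (σmax ^ 2 * (g ⬝ᵥ g).toNNReal) μ := by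
  intro u
  have hind' : iIndepFun (fun (e : ι × κ) ω => (u e.1 * g e.2) * E ω e.1 e.2) μ :=
    hind.comp (fun e x => (u e.1 * g e.2) * x) fun e => measurable_const_mul _
  have h := HasSubgaussianMGF.sum_of_iIndepFun hind' (s := Finset.univ) fun e _ =>
    (hasSubgaussianMGF_of_hasLaw (hlaw e.1 e.2)).const_mul (u e.1 * g e.2)
  have heq : (fun ω => ∑ e : ι × κ, (u e.1 * g e.2) * E ω e.1 e.2) = fun ω => u ⬝ᵥ (E ω *ᵥ g) := by
    ext ω
    simp only [dotProduct, mulVec, Fintype.sum_prod_type, Finset.mul_sum]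
    exact Finset.sum_congr rfl fun r _ => Finset.sum_congr rfl fun i _ => by ring
  rw [heq] at h
  refine h.mono_const ?_
  rw [← NNReal.coe_le_coe]
  push_cast
  rw [Real.coe_toNNReal _ (by rw [← ltwo_sq]; positivity),
    Real.coe_toNNReal _ (by rw [← ltwo_sq]; positivity)]
  calc ∑ e : ι × κ, (u e.1 * g e.2) ^ 2 * (σ e.2 : ℝ) ^ 2
      ≤ ∑ e : ι × κ, (u e.1 * g e.2) ^ 2 * (σmax : ℝ) ^ 2 := by
        refine Finset.sum_le_sum fun e _ => ?_
        have : (σ e.2 : ℝ) ≤ σmax := hσ e.2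
        gcongr
    _ = σmax ^ 2 * (g ⬝ᵥ g) * (u ⬝ᵥ u) := by
        simp only [dotProduct, Fintype.sum_prod_type, Finset.mul_sum, Finset.sum_mul]
        exact Finset.sum_congr rfl fun r _ => Finset.sum_congr rfl fun i _ => by ring

end Subgaussian

/-! ### Matrices bounded below, ridge regression -/

section Ridge

variable {m ι : Type*} [Fintype m] [Fintype ι]

lemma ltwo_le_lone (v : ι → ℝ) : ltwo v ≤ lone v := by
  have h := (le_abs_self _).trans (abs_dotProduct_le_lone v v (abs_le_ltwo v))
  rw [← ltwo_sq] at h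
  by_contra! h'
  nlinarith [lone_nonneg v]

/-- Homogeneity. The relation `P` stands for `≤` or `≥`, so that one argument serves lower and upper
bounds on singular values. -/
lemma ltwo_mulVec_of_unit {A : Matrix m ι ℝ} {P : ℝ → ℝ → Prop}
    (hP : ∀ (c : ℝ), 0 ≤ c → ∀ x y, P x y → P (c * x) (c * y)) {c a : ℝ} (v : ι → ℝ)
    (h : ∀ v : ι → ℝ, ltwo v = 1 → P c (a * ltwo (A *ᵥ v))) (h0 : P 0 0) :
    P (c * ltwo v) (a * ltwo (A *ᵥ v)) := by
  by_cases hv : v = 0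
  · subst hv
    simpa [ltwo_zero] using h0
  · have hpos := ltwo_pos hv
    have h1 := hP _ hpos.le _ _ (h ((ltwo v)⁻¹ • v) (by
      rw [ltwo_smul, abs_of_pos (inv_pos.2 hpos), inv_mul_cancel₀ hpos.ne']))
    rw [mulVec_smul, ltwo_smul, abs_of_pos (inv_pos.2 hpos)] at h1
    convert h1 using 1
    · ring
    · field_simp

lemma le_ltwo_mulVec_of_unit {A : Matrix m ι ℝ} {c a : ℝ}
    (h : ∀ v : ι → ℝ, ltwo v = 1 → c ≤ a * ltwo (A *ᵥ v)) (v : ι → ℝ) :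
    c * ltwo v ≤ a * ltwo (A *ᵥ v) :=
  ltwo_mulVec_of_unit (P := fun x y => x ≤ y)
    (fun _ hc _ _ h => mul_le_mul_of_nonneg_left h hc) v h le_rfl

lemma ltwo_mulVec_le_of_unit {A : Matrix m ι ℝ} {c a : ℝ}
    (h : ∀ v : ι → ℝ, ltwo v = 1 → a * ltwo (A *ᵥ v) ≤ c) (v : ι → ℝ) :
    a * ltwo (A *ᵥ v) ≤ c * ltwo v :=
  ltwo_mulVec_of_unit (P := fun x y => y ≤ x)
    (fun _ hc _ _ h => mul_le_mul_of_nonneg_left h hc) v h le_rfl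

lemma isUnit_of_bounded_below [DecidableEq ι] {A : Matrix ι ι ℝ} {c : ℝ} (hc : 0 < c)
    (h : ∀ v, c * ltwo v ≤ ltwo (A *ᵥ v)) : IsUnit A := by
  rw [← mulVec_injective_iff_isUnit]
  intro v w hvw
  have h1 := h (v - w)
  rw [mulVec_sub, sub_eq_zero.2 hvw, ltwo_zero] at h1
  have h2 : ltwo (v - w) = 0 := by
    by_contra hne
    have := lt_of_le_of_ne (ltwo_nonneg _) (Ne.symm hne)
    nlinarith
  exact sub_eq_zero.1 (ltwo_eq_zero.1 h2)

/-- The quadratic form of the matrix at `v` is at least `a ‖v‖²`, and by Cauchy–Schwarz at most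
`‖v‖` times the norm of the image. -/
lemma bounded_below_gram [DecidableEq ι] {X : Matrix m ι ℝ} {a ρ : ℝ} (hρ : 0 ≤ ρ)
    (h : ∀ v, a * ltwo v ^ 2 ≤ ltwo (X *ᵥ v) ^ 2) (v : ι → ℝ) :
    a * ltwo v ≤ ltwo ((Xᵀ * X + ρ • (1 : Matrix ι ι ℝ)) *ᵥ v) := by
  by_cases hv : v = 0
  · subst hv
    simp [ltwo_zero]
  have hpos := ltwo_pos hv
  have h1 : v ⬝ᵥ ((Xᵀ * X + ρ • (1 : Matrix ι ι ℝ)) *ᵥ v) = ltwo (X *ᵥ v) ^ 2 + ρ * ltwo v ^ 2 := by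
    rw [add_mulVec, smul_mulVec, one_mulVec, dotProduct_add, dotProduct_smul, ltwo_sq, ltwo_sq,
      smul_eq_mul, dotProduct_mulVec (X *ᵥ v), vecMul_mulVec, ← dotProduct_mulVec]
  have h2 := (le_abs_self _).trans
    (abs_dotProduct_le v ((Xᵀ * X + ρ • (1 : Matrix ι ι ℝ)) *ᵥ v))
  have h3 := h v
  have h4 : 0 ≤ ρ * ltwo v ^ 2 := by positivity
  rw [h1] at h2
  refine le_of_mul_le_mul_left ?_ hpos
  nlinarith

/-- Estimation error of the ridge estimator. -/
lemma ridge_error [DecidableEq ι] {X : Matrix m ι ℝ} {a ρ : ℝ} (ha : 0 < a) (hρ : 0 ≤ ρ)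
    (h : ∀ v, a * ltwo v ^ 2 ≤ ltwo (X *ᵥ v) ^ 2) (b : ι → ℝ) (e : m → ℝ) :
    a * ltwo (ridge X ρ (X *ᵥ b + e) - b) ≤ ltwo (Xᵀ *ᵥ e) + ρ * ltwo b := by
  have hb := bounded_below_gram hρ h
  have hu := (isUnit_iff_isUnit_det _).1 (isUnit_of_bounded_below ha hb)
  refine (hb _).trans ?_
  -- The normal equations separate the error into the noise `Xᵀ e` and the bias `-ρ b`.
  have h1 : (Xᵀ * X + ρ • (1 : Matrix ι ι ℝ)) *ᵥ (ridge X ρ (X *ᵥ b + e) - b) =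
      Xᵀ *ᵥ e + (-ρ) • b := by
    rw [ridge, mulVec_sub, mulVec_mulVec _ _ (_)⁻¹, mul_nonsing_inv _ hu, one_mulVec, mulVec_add,
      add_mulVec, mulVec_mulVec, smul_mulVec, one_mulVec, neg_smul]
    abel
  rw [h1]
  refine (ltwo_add_le _ _).trans ?_
  rw [ltwo_smul, abs_neg, abs_of_nonneg hρ]

end Ridge

/-! ### Reduced form of a structural equation model -/

namespace Networks

variable {p q : ℕ} {N : Networks p q}

/-- The reduced-form errors. -/
noncomputable def noise (N : Networks p q) (Y : N.Obs) (k : Fin 2) : Matrix (Fin (N.n k)) (Fin p) ℝ :=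
  Y k - N.X k * N.redForm k

section ReducedForm

variable {s κ : ℝ} {c₁ c₂ : Fin 2 → ℝ}

lemma bounded_below_one_sub (h : N.Calibration s κ c₁ c₂) (k : Fin 2) (v : Fin p → ℝ) :
    s * ltwo v ≤ ltwo ((1 - N.Γ k) *ᵥ v) := by
  simpa using le_ltwo_mulVec_of_unit (a := 1) (by simpa using h.sing k) v

lemma isUnit_det_one_sub (hs : 0 < s) (h : N.Calibration s κ c₁ c₂) (k : Fin 2) :
    IsUnit (1 - N.Γ k).det :=
  (isUnit_iff_isUnit_det _).1 (isUnit_of_bounded_below hs (bounded_below_one_sub h k))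

lemma ltwo_col_inv_le (hs : 0 < s) (h : N.Calibration s κ c₁ c₂) (k : Fin 2) (j : Fin p) :
    ltwo (fun l => (1 - N.Γ k)⁻¹ l j) ≤ s⁻¹ := by
  have h1 := bounded_below_one_sub h k ((1 - N.Γ k)⁻¹ *ᵥ Pi.single j 1)
  rw [mulVec_mulVec, mul_nonsing_inv _ (isUnit_det_one_sub hs h k), one_mulVec,
    mulVec_single_one] at h1
  have h2 : ltwo (Pi.single j 1 : Fin p → ℝ) = 1 := by simp [ltwo]
  rw [h2] at h1
  rw [← mul_one s⁻¹, le_inv_mul_iff₀ hs]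
  exact h1

lemma redForm_mul (hs : 0 < s) (h : N.Calibration s κ c₁ c₂) (k : Fin 2) :
    N.redForm k = N.redForm k * N.Γ k + N.Φ k := by
  have h1 : N.redForm k * (1 - N.Γ k) = N.Φ k := by
    rw [redForm, Matrix.mul_assoc, nonsing_inv_mul _ (isUnit_det_one_sub hs h k), Matrix.mul_one]
  rw [Matrix.mul_sub, Matrix.mul_one] at h1
  rw [← h1]
  abel

lemma noise_eq (hs : 0 < s) (h : N.Calibration s κ c₁ c₂) {Y E : N.Obs} {k : Fin 2}
    (hY : Y k = Y k * N.Γ k + N.X k * N.Φ k + E k) : N.noise Y k = E k * (1 - N.Γ k)⁻¹ := by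
  have h1 : Y k * (1 - N.Γ k) = N.X k * N.Φ k + E k := by
    rw [Matrix.mul_sub, Matrix.mul_one]
    nth_rw 1 [hY]
    abel
  have h2 : Y k = (N.X k * N.Φ k + E k) * (1 - N.Γ k)⁻¹ := by
    rw [← h1, Matrix.mul_assoc, mul_nonsing_inv _ (isUnit_det_one_sub hs h k), Matrix.mul_one]
  rw [noise, redForm]
  nth_rw 1 [h2]
  rw [Matrix.add_mul, Matrix.mul_assoc]
  abel

/-- The error vector of a node in the reduced form is subgaussian. -/
lemma subgaussianVector_noise {σmax : ℝ} (hs : 0 < s) (hσ : 0 < σmax)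
    (h : N.Calibration s κ c₁ c₂) (hsd : ∀ k i, (N.σ k i : ℝ) ≤ σmax)
    {Ω : Type*} [MeasurableSpace Ω] {μ : Measure Ω} [IsProbabilityMeasure μ] {Y : Ω → N.Obs}
    (hY : N.IsSample μ Y) (k : Fin 2) (j : Fin p) :
    SubgaussianVector (fun ω r => N.noise (Y ω) k r j) (Real.toNNReal (σmax ^ 2 / s ^ 2)) μ := by
  obtain ⟨E, hlaw, hind, hE⟩ := hY
  have h1 := subgaussianVector_mulVec (hlaw k) (hind k) (σmax := σmax.toNNReal)
    (fun i => NNReal.le_toNNReal_of_coe_le (hsd k i)) fun l => (1 - N.Γ k)⁻¹ l j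
  have h2 : (fun ω => E ω k *ᵥ fun l => (1 - N.Γ k)⁻¹ l j) =
      fun ω r => N.noise (Y ω) k r j := by
    ext ω r
    rw [noise_eq hs h (hE ω k)]
    rfl
  rw [h2] at h1
  intro u
  refine (h1 u).mono_const (mul_le_mul_left ?_ _)
  rw [← NNReal.coe_le_coe]
  push_cast
  rw [Real.coe_toNNReal _ hσ.le, ← ltwo_sq, Real.coe_toNNReal _ (sq_nonneg _),
    Real.coe_toNNReal _ (by positivity), div_eq_mul_inv, ← inv_pow]
  have := ltwo_col_inv_le hs h k j
  have h0 := ltwo_nonneg fun l => (1 - N.Γ k)⁻¹ l j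
  gcongr

/-- The columns of the inverse of `I - Γ` vanish outside the ancestors of a node. -/
lemma inv_apply_eq_zero (hs : 0 < s) (h : N.Calibration s κ c₁ c₂) (k : Fin 2) {i j : Fin p}
    (hij : ¬ Relation.ReflTransGen (N.Edge k) i j) : (1 - N.Γ k)⁻¹ i j = 0 := by
  -- Vectors supported on the ancestors of `j` form a subspace invariant under `I - Γ`. Being
  -- injective, `I - Γ` is also surjective on it by finite dimension, so the solution of `(I - Γ) v
  -- = e_j` lies in it. A Neumann series might diverge, because cycles are allowed and the spectral
  -- radius of `Γ` is not controlled.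
  let V : Submodule ℝ (Fin p → ℝ) :=
    { carrier := {v | ∀ i, ¬ Relation.ReflTransGen (N.Edge k) i j → v i = 0}
      add_mem' := fun {v w} hv hw i hi => by simp [hv i hi, hw i hi]
      zero_mem' := fun _ _ => rfl
      smul_mem' := fun c v hv i hi => by simp [hv i hi] }
  have hmaps : ∀ v ∈ V, (1 - N.Γ k).mulVecLin v ∈ V := by
    intro v hv i hi
    rw [mulVecLin_apply, sub_mulVec, one_mulVec, Pi.sub_apply, hv i hi, zero_sub, neg_eq_zero]
    change ∑ l, N.Γ k i l * v l = 0
    refine Finset.sum_eq_zero fun l _ => ?_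
    by_cases hl : Relation.ReflTransGen (N.Edge k) l j
    · have : N.Γ k i l = 0 := by
        by_contra hne
        exact hi (Relation.ReflTransGen.head hne hl)
      rw [this, zero_mul]
    · rw [hv l hl, mul_zero]
  have hinj : Function.Injective ((1 - N.Γ k).mulVecLin.restrict hmaps) := by
    intro v w hvw
    have h1 := congrArg Subtype.val hvw
    exact Subtype.ext (mulVec_injective_iff_isUnit.2
      ((isUnit_iff_isUnit_det _).2 (isUnit_det_one_sub hs h k)) h1)
  have he : (Pi.single j 1 : Fin p → ℝ) ∈ V := by
    intro i hi
    have : i ≠ j := fun hEq => hi (hEq ▸ Relation.ReflTransGen.refl)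
    simp [this]
  obtain ⟨v, hv⟩ := (LinearMap.injective_iff_surjective.1 hinj) ⟨_, he⟩
  have h1 : (1 - N.Γ k) *ᵥ v.1 = Pi.single j 1 := congrArg Subtype.val hv
  have h2 : v.1 = (1 - N.Γ k)⁻¹ *ᵥ Pi.single j 1 := by
    rw [← h1, mulVec_mulVec, nonsing_inv_mul _ (isUnit_det_one_sub hs h k), one_mulVec]
  rw [mulVec_single_one] at h2
  have h3 := congrFun h2 i
  rw [v.2 i hij] at h3
  exact h3.symm

/-- Entry `(l, j)` of `Φ (I - Γ)⁻¹` only collects direct effects of `l` on ancestors of `j`; an `l`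
with such an effect regulates `j` and has been kept by screening. -/
lemma redForm_eq_zero (hs : 0 < s) (hst : N.Standing) (h : N.Calibration s κ c₁ c₂) (k : Fin 2)
    {l : Fin q} {j : Fin p} (hl : l ∉ N.M k j) : N.redForm k l j = 0 := by
  rw [redForm, mul_apply]
  refine Finset.sum_eq_zero fun i _ => ?_
  by_cases hij : Relation.ReflTransGen (N.Edge k) i j
  · have : N.Φ k l i = 0 := by
      by_contra hne
      exact hl (hst.screening k l j ⟨i, mem_supp.2 hne, hij⟩)
    rw [this, zero_mul]
  · rw [inv_apply_eq_zero hs h k hij, mul_zero]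

end ReducedForm

end Networks

/-! ### Vectors supported on a subset of the indices -/

section Extend

variable {m ι : Type*} [Fintype m] [Fintype ι] [DecidableEq ι] {S : Finset ι}

lemma extend_restrict {v : ι → ℝ} (hv : ∀ j ∉ S, v j = 0) : extend S (fun j => v j) = v := by
  ext j
  by_cases hj : j ∈ S
  · exact extend_mem S (fun j => v j) ⟨j, hj⟩
  · rw [extend_notMem _ _ hj, hv j hj]

lemma mulVec_eq_cols {X : Matrix m ι ℝ} {v : ι → ℝ} (hv : ∀ j ∉ S, v j = 0) :
    X *ᵥ v = cols X S *ᵥ fun j => v j := by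
  conv_lhs => rw [← extend_restrict hv]
  ext r
  exact mulVec_extend S X _ r

lemma sum_restrict {v : ι → ℝ} (hv : ∀ j ∉ S, v j = 0) (f : ℝ → ℝ) (hf : f 0 = 0) :
    ∑ j : {j // j ∈ S}, f (v j) = ∑ j, f (v j) := by
  rw [← Finset.sum_subset (Finset.subset_univ S) fun j _ hj => by rw [hv j hj, hf],
    ← Finset.sum_coe_sort S]

lemma ltwo_restrict {v : ι → ℝ} (hv : ∀ j ∉ S, v j = 0) :
    ltwo (fun j : {j // j ∈ S} => v j) = ltwo v := by
  rw [← sq_eq_sq₀ (ltwo_nonneg _) (ltwo_nonneg _), ltwo_sq, ltwo_sq]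
  exact sum_restrict hv (fun x => x * x) (by simp)

lemma lone_restrict {v : ι → ℝ} (hv : ∀ j ∉ S, v j = 0) :
    lone (fun j : {j // j ∈ S} => v j) = lone v :=
  sum_restrict hv (fun x => |x|) (by simp)

end Extend

namespace Networks

variable {p q : ℕ} {N : Networks p q}

/-! ### The calibration stage -/

/-- Estimation error of a column of the reduced-form coefficients. -/
noncomputable def calErr (N : Networks p q) (Y : N.Obs) (k : Fin 2) (j : Fin p) : Fin q → ℝ :=
  fun l => N.redFormHat Y k l j - N.redForm k l j

/-- The event on which the noise part of the calibration error of node `j` is large. -/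
noncomputable def calBad (N : Networks p q) {Ω : Type*} (Y : Ω → N.Obs) (v : ℝ) (c₁ : Fin 2 → ℝ)
    (k : Fin 2) (j : Fin p) : Set Ω :=
  {ω | 8 * v * (c₁ k ^ 2 * N.n k) * N.D <
    ltwo ((cols (N.X k) (N.M k j))ᵀ *ᵥ fun r => N.noise (Y ω) k r j) ^ 2}

/-- The constant of the bound for the estimation error of the calibration stage. -/
noncomputable def calConst (v c₁ c₂ : ℝ) : ℝ := 2 * (8 * v * c₁ ^ 2 + 1) / c₂ ^ 4

lemma calConst_pos {v c₁ c₂ : ℝ} (hv : 0 < v) (hc₂ : 0 < c₂) : 0 < calConst v c₁ c₂ := by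
  unfold calConst
  positivity

lemma d_le_D : (N.d : ℝ) ≤ N.D := le_max_left _ _

lemma rMax_le_D : N.rMax ≤ N.D := (le_max_left _ _).trans (le_max_right _ _)

lemma f_le_D (k : Fin 2) : N.f k ≤ N.D := by
  refine le_trans ?_ ((le_max_right _ _).trans (le_max_right _ _))
  fin_cases k
  · exact le_max_left _ _
  · exact le_max_right _ _

lemma D_pos (hst : N.Standing) : 0 < N.D := (hst.f_pos 0).trans_le (f_le_D 0)

lemma ridge_bias_le (k : Fin 2) (j : Fin p) :
    N.ρ k j ^ 2 * ltwo (fun l => N.redForm k l j) ^ 2 / N.n k ≤ N.rMax := by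
  refine le_trans ?_ (le_ciSup (f := fun i => ⨆ k : Fin 2, N.ρ k i ^ 2 *
    ltwo (fun l => N.redForm k l i) ^ 2 / N.n k) (Set.finite_range _).bddAbove j)
  exact le_ciSup (f := fun k : Fin 2 => N.ρ k j ^ 2 *
    ltwo (fun l => N.redForm k l j) ^ 2 / N.n k) (Set.finite_range _).bddAbove k

section

variable {s κ : ℝ} {c₁ c₂ : Fin 2 → ℝ}

lemma ltwo_screened_le (hst : N.Standing) (h : N.Calibration s κ c₁ c₂) (k : Fin 2) (j : Fin p)
    (v : {l // l ∈ N.M k j} → ℝ) : ltwo (cols (N.X k) (N.M k j) *ᵥ v) ≤ c₁ k * √(N.n k) * ltwo v := by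
  have h1 := ltwo_mulVec_le_of_unit (h.upper k j) v
  have h2 : (0 : ℝ) < √(N.n k) := Real.sqrt_pos.2 (Nat.cast_pos.2 (hst.n_pos k))
  rw [inv_mul_le_iff₀ h2] at h1
  linarith

lemma le_ltwo_screened (hst : N.Standing) (h : N.Calibration s κ c₁ c₂) (hc₂ : ∀ k, 0 < c₂ k)
    (k : Fin 2) (j : Fin p) (v : {l // l ∈ N.M k j} → ℝ) :
    (c₂ k ^ 2 * N.n k) * ltwo v ^ 2 ≤ ltwo (cols (N.X k) (N.M k j) *ᵥ v) ^ 2 := by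
  have h1 := le_ltwo_mulVec_of_unit (h.lower k j) v
  have h0 : (0 : ℝ) < N.n k := Nat.cast_pos.2 (hst.n_pos k)
  have h2 : (0 : ℝ) < √(N.n k) := Real.sqrt_pos.2 h0
  rw [le_inv_mul_iff₀ h2] at h1
  have h3 := pow_le_pow_left₀ (by have := ltwo_nonneg v; have := hc₂ k; positivity) h1 2
  rw [mul_pow, Real.sq_sqrt h0.le, mul_pow] at h3
  linarith

lemma redFormHat_eq_zero (Y : N.Obs) (k : Fin 2) {l : Fin q} {j : Fin p} (hl : l ∉ N.M k j) :
    N.redFormHat Y k l j = 0 := by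
  simp [redFormHat, hl]

lemma calErr_eq_zero (hs : 0 < s) (hst : N.Standing) (h : N.Calibration s κ c₁ c₂) (Y : N.Obs)
    (k : Fin 2) (j : Fin p) : ∀ l ∉ N.M k j, N.calErr Y k j l = 0 := fun l hl => by
  rw [calErr, redFormHat_eq_zero Y k hl, redForm_eq_zero hs hst h k hl, sub_zero]

lemma obs_eq (hs : 0 < s) (hst : N.Standing) (h : N.Calibration s κ c₁ c₂) (Y : N.Obs)
    (k : Fin 2) (j : Fin p) : (fun r => Y k r j) =
      cols (N.X k) (N.M k j) *ᵥ (fun l : {l // l ∈ N.M k j} => N.redForm k l j) +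
        fun r => N.noise Y k r j := by
  rw [← mulVec_eq_cols (v := fun l => N.redForm k l j) fun l hl => redForm_eq_zero hs hst h k hl]
  ext r
  simp [noise, mulVec, dotProduct, mul_apply]

/-- Outside the bad event both the noise and the bias in the ridge error are of order `√(n D)`,
while the Gram matrix of the screened variables is bounded below by `c₂² n`. -/
lemma n_mul_ltwo_calErr_le (hs : 0 < s) (hst : N.Standing) (h : N.Calibration s κ c₁ c₂)
    (hc₂ : ∀ k, 0 < c₂ k) {v : ℝ} {Ω : Type*} {Y : Ω → N.Obs} {k : Fin 2}
    {j : Fin p} {ω : Ω} (hω : ω ∉ N.calBad Y v c₁ k j) :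
    N.n k * ltwo (N.calErr (Y ω) k j) ^ 2 ≤ calConst v (c₁ k) (c₂ k) * N.D := by
  have h0 : (0 : ℝ) < N.n k := Nat.cast_pos.2 (hst.n_pos k)
  have hc := hc₂ k
  have ha : 0 < c₂ k ^ 2 * N.n k := by positivity
  have hρ := h.ridge_nonneg k j
  have h1 := ridge_error ha hρ (le_ltwo_screened hst h hc₂ k j)
    (fun l : {l // l ∈ N.M k j} => N.redForm k l j) fun r => N.noise (Y ω) k r j
  rw [← obs_eq hs hst h] at h1
  have h2 : ridge (cols (N.X k) (N.M k j)) (N.ρ k j) (fun r => Y ω k r j) -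
      (fun l : {l // l ∈ N.M k j} => N.redForm k l j) =
      fun l : {l // l ∈ N.M k j} => N.calErr (Y ω) k j l := by
    ext l
    simp [calErr, redFormHat]
  rw [h2, ltwo_restrict (calErr_eq_zero hs hst h (Y ω) k j),
    ltwo_restrict (v := fun l => N.redForm k l j) fun l hl => redForm_eq_zero hs hst h k hl] at h1
  set a := ltwo ((cols (N.X k) (N.M k j))ᵀ *ᵥ fun r => N.noise (Y ω) k r j)
  set b := ltwo fun l => N.redForm k l j
  set e := ltwo (N.calErr (Y ω) k j)
  have h3 : a ^ 2 ≤ 8 * v * (c₁ k ^ 2 * N.n k) * N.D := not_lt.1 hω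
  have h4 : N.ρ k j ^ 2 * b ^ 2 ≤ N.D * N.n k := by
    rw [← div_le_iff₀ h0]
    exact (ridge_bias_le k j).trans rMax_le_D
  have h5 : (c₂ k ^ 2 * N.n k * e) ^ 2 ≤ (a + N.ρ k j * b) ^ 2 :=
    pow_le_pow_left₀ (mul_nonneg ha.le (ltwo_nonneg _)) h1 2
  have h6 : (a + N.ρ k j * b) ^ 2 ≤ 2 * a ^ 2 + 2 * (N.ρ k j ^ 2 * b ^ 2) := by
    nlinarith [sq_nonneg (a - N.ρ k j * b)]
  have h7 : N.n k * (N.n k * (c₂ k ^ 4 * e ^ 2)) ≤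
      N.n k * (2 * (8 * v * c₁ k ^ 2 + 1) * N.D) := by nlinarith
  have h8 := le_of_mul_le_mul_left h7 h0
  rw [calConst, div_mul_eq_mul_div, le_div_iff₀ (by positivity)]
  linarith

lemma ltwo_prediction_le (hs : 0 < s) (hst : N.Standing) (h : N.Calibration s κ c₁ c₂)
    (hc₂ : ∀ k, 0 < c₂ k) {v : ℝ} {Ω : Type*} {Y : Ω → N.Obs}
    {k : Fin 2} {j : Fin p} {ω : Ω} (hω : ω ∉ N.calBad Y v c₁ k j) :
    ltwo (N.X k *ᵥ N.calErr (Y ω) k j) ^ 2 ≤ c₁ k ^ 2 * calConst v (c₁ k) (c₂ k) * N.D := by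
  have h0 : (0 : ℝ) < N.n k := Nat.cast_pos.2 (hst.n_pos k)
  have hz := calErr_eq_zero hs hst h (Y ω) k j
  have h1 := ltwo_screened_le hst h k j fun l => N.calErr (Y ω) k j l
  rw [← mulVec_eq_cols hz, ltwo_restrict hz] at h1
  have h2 := pow_le_pow_left₀ (ltwo_nonneg _) h1 2
  rw [mul_pow, mul_pow, Real.sq_sqrt h0.le] at h2
  have h3 := n_mul_ltwo_calErr_le hs hst h hc₂ hω
  have := mul_le_mul_of_nonneg_left h3 (sq_nonneg (c₁ k))
  linarith

/-- The quadratic tail bound, applied to the transposed screened design: its dimension is `d ≤ D`,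
and `c₁² n` bounds the square of its operator norm. -/
lemma measure_calBad_le {σmax : ℝ} (hs : 0 < s) (hσ : 0 < σmax) (hst : N.Standing)
    (h : N.Calibration s κ c₁ c₂) (hsd : ∀ k i, (N.σ k i : ℝ) ≤ σmax) (hc₁ : ∀ k, 0 < c₁ k)
    {Ω : Type*} [MeasurableSpace Ω] {μ : Measure Ω} [IsProbabilityMeasure μ] {Y : Ω → N.Obs}
    (hY : N.IsSample μ Y) (k : Fin 2) (j : Fin p) :
    μ.real (N.calBad Y (σmax ^ 2 / s ^ 2) c₁ k j) ≤ Real.exp (-N.f k) := by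
  have h0 : (0 : ℝ) < N.n k := Nat.cast_pos.2 (hst.n_pos k)
  have hc := hc₁ k
  have hv : 0 < σmax ^ 2 / s ^ 2 := by positivity
  have h1 := (subgaussianVector_noise hs hσ h hsd hY k j).quadratic_tail
    (cols (N.X k) (N.M k j))ᵀ (K := c₁ k ^ 2 * N.n k) (D := N.D) (f := N.f k)
    (Real.toNNReal_pos.2 hv) (by positivity) (fun g => ?_) ?_ (f_le_D k)
  · rw [Real.coe_toNNReal _ hv.le] at h1
    exact h1
  · rw [transpose_transpose]
    have h2 := pow_le_pow_left₀ (ltwo_nonneg _) (ltwo_screened_le hst h k j g) 2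
    rwa [mul_pow, mul_pow, Real.sq_sqrt h0.le] at h2
  · rw [Fintype.card_coe, hst.card_M]
    exact d_le_D

end

end Networks

/-! ### Columns of paired matrices and perturbation of bilinear forms -/

section Blocks

variable {m₁ m₂ ι : Type*} [Fintype m₁] [Fintype m₂]

lemma pair_col (A : Matrix m₁ ι ℝ) (B : Matrix m₂ ι ℝ) (j : ι ⊕ ι) :
    ∃ ε : ℝ, |ε| = 1 ∧ (fun r => pair A B r j) =
      Sum.elim (fun r => A r (Sum.elim id id j)) (ε • fun r => B r (Sum.elim id id j)) := by
  rcases j with l | l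
  · refine ⟨1, by simp, ?_⟩
    ext r
    rcases r with r | r <;> simp [pair]
  · refine ⟨-1, by simp, ?_⟩
    ext r
    rcases r with r | r <;> simp [pair]

lemma ltwo_sq_pair_col (A : Matrix m₁ ι ℝ) (B : Matrix m₂ ι ℝ) (j : ι ⊕ ι) :
    ltwo (fun r => pair A B r j) ^ 2 =
      ltwo (fun r => A r (Sum.elim id id j)) ^ 2 + ltwo (fun r => B r (Sum.elim id id j)) ^ 2 := by
  obtain ⟨ε, hε, h⟩ := pair_col A B j
  rw [h, ltwo_sq_sumElim, ltwo_smul, hε, one_mul]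

/-- Separates the networks. The errors of the two networks are not assumed to be independent of each
other, so their contributions are bounded one by one. -/
lemma abs_pair_col_dotProduct_le (A : Matrix m₁ ι ℝ) (B : Matrix m₂ ι ℝ) (j : ι ⊕ ι)
    (x : m₁ → ℝ) (y : m₂ → ℝ) : |(fun r => pair A B r j) ⬝ᵥ Sum.elim x y| ≤
      |(fun r => A r (Sum.elim id id j)) ⬝ᵥ x| + |(fun r => B r (Sum.elim id id j)) ⬝ᵥ y| := by
  obtain ⟨ε, hε, h⟩ := pair_col A B j
  rw [h, sumElim_dotProduct_sumElim, smul_dotProduct, smul_eq_mul]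
  refine (abs_add_le _ _).trans ?_
  rw [abs_mul ε, hε, one_mul]

lemma pair_sub (A A' : Matrix m₁ ι ℝ) (B B' : Matrix m₂ ι ℝ) :
    pair A B - pair A' B' = pair (A - A') (B - B') := by
  ext r j
  rcases r with r | r <;> rcases j with j | j <;> simp [pair]
  ring

lemma dropCol_mulVec [Fintype ι] [DecidableEq ι] (A : Matrix m₁ ι ℝ) {i : ι} {g : ι → ℝ}
    (hg : g i = 0) : dropCol A i *ᵥ (fun l => g l) = A *ᵥ g := by
  ext r
  change ∑ l : {l // l ≠ i}, A r l * g l = ∑ l, A r l * g l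
  rw [← Finset.sum_erase (Finset.univ) (a := i) (by rw [hg, mul_zero])]
  exact (Finset.sum_subtype (Finset.univ.erase i) (by simp) fun l => A r l * g l).symm

/-- One argument is changed at a time; the term `δ²` comes from `‖v'‖ ≤ K + δ`. -/
lemma abs_bilin_sub_le {H : Matrix m₁ m₁ ℝ} (hH : ∀ v, ltwo (H *ᵥ v) ≤ ltwo v)
    {u u' v v' : m₁ → ℝ} {K δ : ℝ} (hu : ltwo u ≤ K) (hv : ltwo v ≤ K)
    (hu' : ltwo (u' - u) ≤ δ) (hv' : ltwo (v' - v) ≤ δ) :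
    |u' ⬝ᵥ H *ᵥ v' - u ⬝ᵥ H *ᵥ v| ≤ 2 * K * δ + δ ^ 2 := by
  have hK := (ltwo_nonneg u).trans hu
  have hδ := (ltwo_nonneg _).trans hu'
  have h1 : u' ⬝ᵥ H *ᵥ v' - u ⬝ᵥ H *ᵥ v = (u' - u) ⬝ᵥ H *ᵥ v' + u ⬝ᵥ H *ᵥ (v' - v) := by
    rw [mulVec_sub, dotProduct_sub, sub_dotProduct]
    ring
  have h2 : ltwo v' ≤ K + δ := by
    have := ltwo_add_le v (v' - v)
    rw [add_sub_cancel] at this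
    linarith
  have h3 : |(u' - u) ⬝ᵥ H *ᵥ v'| ≤ δ * (K + δ) := (abs_dotProduct_le _ _).trans
    (mul_le_mul hu' ((hH _).trans h2) (ltwo_nonneg _) hδ)
  have h4 : |u ⬝ᵥ H *ᵥ (v' - v)| ≤ K * δ := (abs_dotProduct_le _ _).trans
    (mul_le_mul hu ((hH _).trans hv') (ltwo_nonneg _) hK)
  rw [h1]
  nlinarith [abs_add_le ((u' - u) ⬝ᵥ H *ᵥ v') (u ⬝ᵥ H *ᵥ (v' - v))]

end Blocks

namespace Networks

variable {p q : ℕ} {N : Networks p q}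

/-! ### The construction stage -/

/-- Projection onto the orthogonal complement of the anchoring exogenous variables of a node. -/
noncomputable def proj (N : Networks p q) (k : Fin 2) (i : Fin p) :
    Matrix (Fin (N.n k)) (Fin (N.n k)) ℝ :=
  annihilator (cols (N.X k) (N.A k i))

/-- The stacked reduced-form errors of a node. -/
noncomputable def stackNoise (N : Networks p q) (Y : N.Obs) (i : Fin p) :
    Fin (N.n 0) ⊕ Fin (N.n 1) → ℝ :=
  Sum.elim (fun r => N.noise Y 0 r i) (fun r => N.noise Y 1 r i)

lemma XX_mul_pair {ι : Type*} (A B : Matrix (Fin q) ι ℝ) :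
    N.XX * pair A B = pair (N.X 0 * A) (N.X 1 * B) := by
  simp [XX, pair, fromBlocks_multiply]

lemma XX_mul_PiMinus (i : Fin p) : N.XX * N.PiMinus i =
    pair (dropCol (N.X 0 * N.redForm 0) i) (dropCol (N.X 1 * N.redForm 1) i) :=
  XX_mul_pair _ _

lemma XX_mul_PiHatMinus (Y : N.Obs) (i : Fin p) : N.XX * N.PiHatMinus Y i = N.ZHat Y i :=
  XX_mul_pair _ _

lemma ZHat_sub (Y : N.Obs) (i : Fin p) : N.ZHat Y i - N.XX * N.PiMinus i =
    pair (dropCol (N.X 0 * (N.redFormHat Y 0 - N.redForm 0)) i)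
      (dropCol (N.X 1 * (N.redFormHat Y 1 - N.redForm 1)) i) := by
  rw [ZHat, XX_mul_PiMinus, pair_sub, Matrix.mul_sub, Matrix.mul_sub]
  rfl

lemma lone_redForm_add_le (l : Fin p) :
    lone (fun m => N.redForm 0 m l) + lone (fun m => N.redForm 1 m l) ≤ matOne N.PiMat := by
  have h := sum_le_matOne N.PiMat (Sum.inl l)
  simpa [Fintype.sum_sum_type, PiMat, pair, lone] using h

lemma lone_redForm_le (k : Fin 2) (l : Fin p) : lone (fun m => N.redForm k m l) ≤ matOne N.PiMat := by
  have h := lone_redForm_add_le (N := N) l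
  have h0 := lone_nonneg fun m => N.redForm 0 m l
  have h1 := lone_nonneg fun m => N.redForm 1 m l
  revert k
  rw [Fin.forall_fin_two]
  exact ⟨by linarith, by linarith⟩

lemma lone_β_le (i : Fin p) : lone (N.β i) ≤ N.oneB :=
  le_ciSup (f := fun i => lone (N.β i)) (Set.finite_range _).bddAbove i

lemma nTot_eq : (N.nTot : ℝ) = N.n 0 + N.n 1 := by simp [nTot]

section

variable {s κ : ℝ} {c₁ c₂ : Fin 2 → ℝ}

/-- An anchor of `i` regulates `i`, hence was kept by screening, and the lower singular value bound
on the screened columns passes to a subset of them. -/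
lemma isUnit_det_anchor (hst : N.Standing) (h : N.Calibration s κ c₁ c₂) (hc₂ : ∀ k, 0 < c₂ k)
    (k : Fin 2) (i : Fin p) :
    IsUnit ((cols (N.X k) (N.A k i))ᵀ * cols (N.X k) (N.A k i)).det := by
  have hsub : N.A k i ⊆ N.M k i := fun l hl =>
    hst.screening k l i ⟨i, hl, Relation.ReflTransGen.refl⟩
  have h0 : (0 : ℝ) < N.n k := Nat.cast_pos.2 (hst.n_pos k)
  have hc := hc₂ k
  have hlow : ∀ v : {l // l ∈ N.A k i} → ℝ,
      c₂ k ^ 2 * N.n k * ltwo v ^ 2 ≤ ltwo (cols (N.X k) (N.A k i) *ᵥ v) ^ 2 := by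
    intro v
    have hv : ∀ l ∉ N.A k i, extend (N.A k i) v l = 0 := fun l hl => extend_notMem _ v hl
    have hv' : ∀ l ∉ N.M k i, extend (N.A k i) v l = 0 := fun l hl => hv l fun hA => hl (hsub hA)
    have h1 := le_ltwo_screened hst h hc₂ k i fun l => extend (N.A k i) v l
    rw [← mulVec_eq_cols hv', ltwo_restrict hv', mulVec_eq_cols hv, ← ltwo_restrict hv] at h1
    simpa only [extend_mem] using h1
  have h2 := bounded_below_gram le_rfl hlow
  rw [zero_smul, add_zero] at h2
  exact (isUnit_iff_isUnit_det _).1 (isUnit_of_bounded_below (by positivity) h2)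

lemma proj_transpose (k : Fin 2) (i : Fin p) : (N.proj k i)ᵀ = N.proj k i :=
  annihilator_transpose _

lemma proj_contraction (hst : N.Standing) (h : N.Calibration s κ c₁ c₂) (hc₂ : ∀ k, 0 < c₂ k)
    (k : Fin 2) (i : Fin p) (v : Fin (N.n k) → ℝ) : ltwo (N.proj k i *ᵥ v) ≤ ltwo v :=
  ltwo_mulVec_le_of_idem (proj_transpose k i)
    (annihilator_idem (isUnit_det_anchor hst h hc₂ k i)) v

lemma proj_mulVec_anchor (hst : N.Standing) (h : N.Calibration s κ c₁ c₂) (hc₂ : ∀ k, 0 < c₂ k)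
    (k : Fin 2) (i : Fin p) : N.proj k i *ᵥ (N.X k *ᵥ fun l => N.Φ k l i) = 0 := by
  have h1 : ∀ l ∉ N.A k i, N.Φ k l i = 0 := fun l hl => by
    by_contra hne
    exact hl (mem_supp.2 hne)
  rw [mulVec_eq_cols (v := fun l => N.Φ k l i) h1, mulVec_mulVec, proj,
    annihilator_mul_self (isUnit_det_anchor hst h hc₂ k i), zero_mulVec]

lemma H_mulVec (i : Fin p) (x : Fin (N.n 0) → ℝ) (y : Fin (N.n 1) → ℝ) :
    N.H i *ᵥ Sum.elim x y = Sum.elim (N.proj 0 i *ᵥ x) (N.proj 1 i *ᵥ y) := by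
  rw [H, fromBlocks_mulVec]
  simp [proj]

lemma H_transpose (i : Fin p) : (N.H i)ᵀ = N.H i := by
  simp [H, fromBlocks_transpose, annihilator_transpose]

lemma H_idem (hst : N.Standing) (h : N.Calibration s κ c₁ c₂) (hc₂ : ∀ k, 0 < c₂ k) (i : Fin p) :
    N.H i * N.H i = N.H i := by
  simp [H, fromBlocks_multiply, annihilator_idem (isUnit_det_anchor hst h hc₂ 0 i),
    annihilator_idem (isUnit_det_anchor hst h hc₂ 1 i)]

lemma H_contraction (hst : N.Standing) (h : N.Calibration s κ c₁ c₂) (hc₂ : ∀ k, 0 < c₂ k)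
    (i : Fin p) (v : Fin (N.n 0) ⊕ Fin (N.n 1) → ℝ) : ltwo (N.H i *ᵥ v) ≤ ltwo v :=
  ltwo_mulVec_le_of_idem (H_transpose i) (H_idem hst h hc₂ i) v

/-- Idempotence of `H i` exhibits the matrix as the Gram matrix of the projected regressors, the
form in which the lasso sees it. -/
lemma gram_eq (hst : N.Standing) (h : N.Calibration s κ c₁ c₂) (hc₂ : ∀ k, 0 < c₂ k) (i : Fin p)
    (P : Matrix (Fin q ⊕ Fin q) (Coef p i) ℝ) : N.gram i P =
      (N.nTot : ℝ)⁻¹ • ((N.H i * (N.XX * P))ᵀ * (N.H i * (N.XX * P))) := by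
  rw [gram, transpose_mul, transpose_mul, H_transpose]
  conv_lhs => rw [← H_idem hst h hc₂ i]
  simp only [Matrix.mul_assoc]

lemma gram_apply (i : Fin p) (P : Matrix (Fin q ⊕ Fin q) (Coef p i) ℝ) (j l : Coef p i) :
    N.gram i P j l = (N.nTot : ℝ)⁻¹ *
      ((fun r => (N.XX * P) r j) ⬝ᵥ N.H i *ᵥ fun r => (N.XX * P) r l) := by
  have h1 : Pᵀ * N.XXᵀ * N.H i * N.XX * P = (N.XX * P)ᵀ * (N.H i * (N.XX * P)) := by
    rw [transpose_mul]
    simp only [Matrix.mul_assoc]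
  rw [gram, h1]
  rfl

/-- Sum and difference of the average and differential effects are the original effects in the two
networks; the zero diagonal of `Γ` makes the deleted column irrelevant. -/
lemma pair_mulVec_β (hst : N.Standing) {m₁ m₂ : Type*} [Fintype m₁] [Fintype m₂] (i : Fin p)
    (A : Matrix m₁ (Fin p) ℝ) (B : Matrix m₂ (Fin p) ℝ) :
    pair (dropCol A i) (dropCol B i) *ᵥ N.β i =
      Sum.elim (A *ᵥ fun l => N.Γ 0 l i) (B *ᵥ fun l => N.Γ 1 l i) := by
  rw [pair, β, fromBlocks_mulVec, Sum.elim_comp_inl, Sum.elim_comp_inr, neg_mulVec, ← mulVec_add,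
    ← sub_eq_add_neg, ← mulVec_sub, ← dropCol_mulVec A (g := fun l => N.Γ 0 l i) (hst.diag_zero 0 i),
    ← dropCol_mulVec B (g := fun l => N.Γ 1 l i) (hst.diag_zero 1 i)]
  congr 2 <;> ext l <;> simp only [Pi.add_apply, Pi.sub_apply] <;> ring

/-- The response of the construction stage. -/
lemma H_mulVec_stack (hs : 0 < s) (hst : N.Standing) (h : N.Calibration s κ c₁ c₂)
    (hc₂ : ∀ k, 0 < c₂ k) (Y : N.Obs) (i : Fin p) : N.H i *ᵥ N.stack Y i =
      N.H i *ᵥ ((N.XX * N.PiMinus i) *ᵥ N.β i + N.stackNoise Y i) := by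
  -- From `π = π Γ + Φ`: the reduced-form mean of node `i` is the combination of the means of the
  -- other nodes plus the anchor term, which the projection kills.
  have hY : ∀ k, (fun r => Y k r i) = ((N.X k * N.redForm k) *ᵥ fun l => N.Γ k l i) +
      (fun r => N.noise Y k r i) + N.X k *ᵥ fun l => N.Φ k l i := by
    intro k
    have h1 : N.X k * N.redForm k = N.X k * N.redForm k * N.Γ k + N.X k * N.Φ k := by
      conv_lhs => rw [redForm_mul hs h k]
      rw [Matrix.mul_add, Matrix.mul_assoc]
    ext r
    have h2 := congrFun (congrFun h1 r) i
    have h3 : N.noise Y k r i = Y k r i - (N.X k * N.redForm k) r i := rfl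
    rw [Pi.add_apply, Pi.add_apply, h3, h2]
    simp only [Matrix.add_apply, mul_apply (M := N.X k * N.redForm k), mul_apply (N := N.Φ k),
      mulVec, dotProduct]
    ring
  rw [XX_mul_PiMinus, pair_mulVec_β hst, stackNoise, ← Sum.elim_add_add, stack, hY 0, hY 1,
    H_mulVec, H_mulVec, mulVec_add (N.proj 0 i), mulVec_add (N.proj 1 i),
    proj_mulVec_anchor hst h hc₂, proj_mulVec_anchor hst h hc₂, add_zero, add_zero]

lemma ltwo_design_col_le (hst : N.Standing) (k : Fin 2) (l : Fin p) :
    ltwo (fun r => (N.X k * N.redForm k) r l) ≤ matOne N.PiMat * √(N.n k) := by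
  have h1 : (fun r => (N.X k * N.redForm k) r l) = N.X k *ᵥ fun m => N.redForm k m l := rfl
  rw [h1]
  exact (ltwo_mulVec_le_lone _ _ fun m => (hst.standardized k m).le).trans
    (mul_le_mul_of_nonneg_right (lone_redForm_le k l) (Real.sqrt_nonneg _))

/-- The bound is stated with `c_max ‖Π‖₁ √n` because this is the quantity in the condition on the
first-stage error. -/
lemma ltwo_XX_mul_PiMinus_col_le (hs : 0 < s) (hst : N.Standing) (h : N.Calibration s κ c₁ c₂)
    (hc₁ : ∀ k, 0 < c₁ k) (i : Fin p) (j : Coef p i) :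
    ltwo (fun r => (N.XX * N.PiMinus i) r j) ≤
      max (c₁ 0) (c₁ 1) * matOne N.PiMat * √N.nTot := by
  have hm : 0 < max (c₁ 0) (c₁ 1) := lt_max_of_lt_left (hc₁ 0)
  have hP := matOne_nonneg N.PiMat
  have hk : ∀ k l, ltwo (fun r => (N.X k * N.redForm k) r l) ^ 2 ≤
      (max (c₁ 0) (c₁ 1) * matOne N.PiMat) ^ 2 * N.n k := by
    intro k l
    have hz : ∀ m ∉ N.M k l, N.redForm k m l = 0 := fun m hm => redForm_eq_zero hs hst h k hm
    have h1 := ltwo_screened_le hst h k l fun m => N.redForm k m l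
    rw [← mulVec_eq_cols (v := fun m => N.redForm k m l) hz,
      ltwo_restrict (v := fun m => N.redForm k m l) hz] at h1
    have hck : c₁ k ≤ max (c₁ 0) (c₁ 1) := by
      fin_cases k
      · exact le_max_left _ _
      · exact le_max_right _ _
    have h2 : ltwo (fun m => N.redForm k m l) ≤ matOne N.PiMat :=
      (ltwo_le_lone _).trans (lone_redForm_le k l)
    have h3 : ltwo (N.X k *ᵥ fun m => N.redForm k m l) ≤
        max (c₁ 0) (c₁ 1) * √(N.n k) * matOne N.PiMat :=
      h1.trans (mul_le_mul (mul_le_mul_of_nonneg_right hck (Real.sqrt_nonneg _)) h2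
        (ltwo_nonneg _) (by positivity))
    have h4 := pow_le_pow_left₀ (ltwo_nonneg _) h3 2
    rw [mul_pow, mul_pow, Real.sq_sqrt (Nat.cast_nonneg _)] at h4
    refine h4.trans (le_of_eq ?_)
    ring
  refine ltwo_le_of_sq_le (by positivity) ?_
  rw [← ltwo_sq, XX_mul_PiMinus, ltwo_sq_pair_col, mul_pow _ (√_), Real.sq_sqrt (Nat.cast_nonneg _),
    nTot_eq, mul_add]
  exact add_le_add (hk 0 _) (hk 1 _)

lemma ltwo_ZHat_sub_col_le (hs : 0 < s) (hst : N.Standing) (h : N.Calibration s κ c₁ c₂)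
    (hc₂ : ∀ k, 0 < c₂ k) {v C₂ : ℝ}
    (hC₂ : c₁ 0 ^ 2 * calConst v (c₁ 0) (c₂ 0) + c₁ 1 ^ 2 * calConst v (c₁ 1) (c₂ 1) ≤ C₂)
    {Ω : Type*} {Y : Ω → N.Obs} {ω : Ω} (hω : ∀ k l, ω ∉ N.calBad Y v c₁ k l) (i : Fin p)
    (j : Coef p i) :
    ltwo (fun r => (N.ZHat (Y ω) i - N.XX * N.PiMinus i) r j) ≤ √(C₂ * N.D) := by
  refine Real.le_sqrt_of_sq_le ?_
  rw [ZHat_sub, ltwo_sq_pair_col]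
  have hk := fun k l => ltwo_prediction_le hs hst h hc₂ (hω k l)
  have h1 := add_le_add (hk 0 (Sum.elim id id j : {l // l ≠ i})) (hk 1 (Sum.elim id id j : {l // l ≠ i}))
  refine h1.trans ?_
  rw [← add_mul]
  exact mul_le_mul_of_nonneg_right hC₂ (D_pos hst).le

lemma abs_IHat_sub_le (hs : 0 < s) (hst : N.Standing) (h : N.Calibration s κ c₁ c₂)
    (hc₁ : ∀ k, 0 < c₁ k) (hc₂ : ∀ k, 0 < c₂ k) {v C₂ : ℝ}
    (hC₂ : c₁ 0 ^ 2 * calConst v (c₁ 0) (c₂ 0) + c₁ 1 ^ 2 * calConst v (c₁ 1) (c₂ 1) ≤ C₂)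
    (hC₂' : 1 ≤ C₂) {Ω : Type*} {Y : Ω → N.Obs} {ω : Ω} (hω : ∀ k l, ω ∉ N.calBad Y v c₁ k l)
    (i : Fin p) (j l : Coef p i) : |N.IHat (Y ω) i j l - N.I i j l| ≤
      C₂ * (2 * (max (c₁ 0) (c₁ 1) * matOne N.PiMat) * √(N.D / N.nTot) + N.D / N.nTot) := by
  have hn : (0 : ℝ) < N.nTot := by
    rw [nTot_eq]
    exact add_pos (Nat.cast_pos.2 (hst.n_pos 0)) (Nat.cast_pos.2 (hst.n_pos 1))
  have hD := D_pos hst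
  have hm : 0 < max (c₁ 0) (c₁ 1) := lt_max_of_lt_left (hc₁ 0)
  have hP := matOne_nonneg N.PiMat
  rw [IHat, I, gram_apply, gram_apply, XX_mul_PiHatMinus, ← mul_sub, abs_mul,
    abs_of_pos (inv_pos.2 hn)]
  have h1 := abs_bilin_sub_le (H_contraction hst h hc₂ i)
    (ltwo_XX_mul_PiMinus_col_le hs hst h hc₁ i j) (ltwo_XX_mul_PiMinus_col_le hs hst h hc₁ i l)
    (ltwo_ZHat_sub_col_le hs hst h hc₂ hC₂ hω i j) (ltwo_ZHat_sub_col_le hs hst h hc₂ hC₂ hω i l)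
  refine (mul_le_mul_of_nonneg_left h1 (inv_pos.2 hn).le).trans ?_
  -- Uses `C₂ ≥ 1`, so that a single factor `C₂` can be taken out of both the linear and the
  -- quadratic error term.
  have h2 : √(C₂ * N.D) ≤ C₂ * √N.D := by
    rw [Real.sqrt_mul (by linarith)]
    refine mul_le_mul_of_nonneg_right ?_ (Real.sqrt_nonneg _)
    exact Real.sqrt_le_iff.2 ⟨by linarith, by nlinarith⟩
  have h3 : √(C₂ * N.D) ^ 2 = C₂ * N.D := Real.sq_sqrt (by positivity)
  have h4 : √(N.D / N.nTot) = √N.D / √N.nTot := Real.sqrt_div hD.le _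
  have h5 : √(N.nTot : ℝ) * √(N.nTot : ℝ) = N.nTot := Real.mul_self_sqrt hn.le
  have h6 : 0 < √(N.nTot : ℝ) := Real.sqrt_pos.2 hn
  rw [h3, h4, inv_mul_le_iff₀ hn]
  calc 2 * (max (c₁ 0) (c₁ 1) * matOne N.PiMat * √N.nTot) * √(C₂ * N.D) + C₂ * N.D
      ≤ 2 * (max (c₁ 0) (c₁ 1) * matOne N.PiMat * √N.nTot) * (C₂ * √N.D) + C₂ * N.D := by
        gcongr
    _ = N.nTot * (C₂ * (2 * (max (c₁ 0) (c₁ 1) * matOne N.PiMat) * (√N.D / √N.nTot) +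
          N.D / N.nTot)) := by
        have e1 : N.nTot * (√N.D / √N.nTot) = √N.nTot * √N.D := by
          rw [mul_div_assoc', div_eq_iff h6.ne', mul_right_comm, h5]
        have e2 : N.nTot * (N.D / N.nTot) = N.D := mul_div_cancel₀ _ hn.ne'
        linear_combination -C₂ * (2 * (max (c₁ 0) (c₁ 1) * matOne N.PiMat)) * e1 - C₂ * e2

/-- Bound for the correlation of the predicted regressors with the errors. -/
lemma abs_score_le (hs : 0 < s) (hst : N.Standing) (h : N.Calibration s κ c₁ c₂)
    (hc₂ : ∀ k, 0 < c₂ k) {v C₂ L T₁ T₂ : ℝ}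
    (hC₂ : c₁ 0 ^ 2 * calConst v (c₁ 0) (c₂ 0) + c₁ 1 ^ 2 * calConst v (c₁ 1) (c₂ 1) ≤ C₂)
    {Ω : Type*} {Y : Ω → N.Obs} {ω : Ω} (hω : ∀ k l, ω ∉ N.calBad Y v c₁ k l) (i : Fin p)
    (hT₁ : ∀ k l, |(N.proj k i *ᵥ fun r => (N.X k * N.redForm k) r l) ⬝ᵥ
      fun r => N.noise (Y ω) k r i| ≤ T₁)
    (hT₂ : ∀ k l, |(N.proj k i *ᵥ fun r => N.X k r l) ⬝ᵥ fun r => N.noise (Y ω) k r i| ≤ T₂)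
    (hT₂' : 0 ≤ T₂) (hL : ∀ k l, lone (N.calErr (Y ω) k l) ≤ L) (j : Coef p i) :
    |((N.H i * N.ZHat (Y ω) i)ᵀ *ᵥ
      (N.H i *ᵥ N.stack (Y ω) i - (N.H i * N.ZHat (Y ω) i) *ᵥ N.β i)) j| ≤
      ltwo (fun r => N.ZHat (Y ω) i r j) * (lone (N.β i) * √(C₂ * N.D)) +
        (2 * T₁ + 2 * (L * T₂)) := by
  set Z := N.ZHat (Y ω) i with hZ
  set V := N.XX * N.PiMinus i with hV
  have hsym : ∀ k (x y : Fin (N.n k) → ℝ), x ⬝ᵥ N.proj k i *ᵥ y = (N.proj k i *ᵥ x) ⬝ᵥ y := by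
    intro k x y
    rw [dotProduct_mulVec, ← mulVec_transpose, proj_transpose]
  -- The residual at `β_i` is minus the calibration error applied to `β_i`, plus the noise.
  -- Splitting `Z = V + (Z - V)` in the noise term only then gives the three parts of the score.
  have h1 : (N.H i * Z)ᵀ *ᵥ (N.H i *ᵥ N.stack (Y ω) i - (N.H i * Z) *ᵥ N.β i) =
      Zᵀ *ᵥ (N.H i *ᵥ (-((Z - V) *ᵥ N.β i) + N.stackNoise (Y ω) i)) := by
    rw [H_mulVec_stack hs hst h hc₂, ← hV, ← mulVec_mulVec (N.β i) (N.H i) Z, ← mulVec_sub,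
      mulVec_mulVec, transpose_mul,
      Matrix.mul_assoc, H_transpose, H_idem hst h hc₂, ← mulVec_mulVec]
    congr 2
    rw [sub_mulVec]
    abel
  have h2 : (Zᵀ *ᵥ (N.H i *ᵥ (-((Z - V) *ᵥ N.β i) + N.stackNoise (Y ω) i))) j =
      (fun r => Z r j) ⬝ᵥ N.H i *ᵥ (-((Z - V) *ᵥ N.β i)) +
        ((fun r => V r j) ⬝ᵥ N.H i *ᵥ N.stackNoise (Y ω) i +
          (fun r => (Z - V) r j) ⬝ᵥ N.H i *ᵥ N.stackNoise (Y ω) i) := by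
    have h3 : (fun r => V r j) + (fun r => (Z - V) r j) = fun r => Z r j := by
      ext r
      simp
    rw [← add_dotProduct, h3, ← dotProduct_add, ← mulVec_add]
    rfl
  rw [h1, h2]
  refine (abs_add_le _ _).trans (add_le_add ?_ ((abs_add_le _ _).trans (add_le_add ?_ ?_)))
  · refine (abs_dotProduct_le _ _).trans (mul_le_mul_of_nonneg_left ?_ (ltwo_nonneg _))
    refine (H_contraction hst h hc₂ i _).trans ?_
    rw [ltwo_neg]
    exact ltwo_mulVec_le_lone _ _ fun j => ltwo_ZHat_sub_col_le hs hst h hc₂ hC₂ hω i j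
  · rw [stackNoise, H_mulVec, hV, XX_mul_PiMinus]
    refine (abs_pair_col_dotProduct_le _ _ _ _ _).trans ?_
    rw [hsym, hsym, two_mul]
    exact add_le_add (hT₁ 0 _) (hT₁ 1 _)
  -- The calibration error depends on the same noise, so no tail bound applies to this product
  -- directly; Hölder's inequality reduces it to correlations with the fixed columns of `X k`.
  · have hk : ∀ k l, |(fun r => (N.X k * (N.redFormHat (Y ω) k - N.redForm k)) r l) ⬝ᵥ
        N.proj k i *ᵥ fun r => N.noise (Y ω) k r i| ≤ L * T₂ := by
      intro k l
      have h3 : (fun r => (N.X k * (N.redFormHat (Y ω) k - N.redForm k)) r l) =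
        N.X k *ᵥ N.calErr (Y ω) k l := rfl
      rw [h3, dotProduct_comm, dotProduct_mulVec, dotProduct_comm]
      refine (abs_dotProduct_le_lone _ _ (c := T₂) fun m => ?_).trans
        (mul_le_mul_of_nonneg_right (hL k l) hT₂')
      refine le_of_eq_of_le ?_ (hT₂ k m)
      rw [← hsym, dotProduct_comm]
      rfl
    rw [stackNoise, H_mulVec, ZHat_sub]
    refine (abs_pair_col_dotProduct_le _ _ _ _ _).trans ?_
    rw [two_mul]
    exact add_le_add (hk 0 _) (hk 1 _)

end

end Networks

/-! ### Consequences of the restricted eigenvalue condition and deterministic support recovery -/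

lemma mul_ltwo_le_of_restrictedEigenvalue {m ι : Type*} [Fintype m] [Fintype ι] [DecidableEq ι]
    [Nonempty m] {A : Matrix m ι ℝ} {S : Finset ι} {φ : ℝ}
    (h : ENNReal.ofReal φ ≤ restrictedEigenvalue A S) {δ : ι → ℝ} (hδ : ∀ j ∉ S, δ j = 0) :
    φ * (√(Fintype.card m) * ltwo δ) ≤ ltwo (A *ᵥ δ) := by
  by_cases h0 : δ = 0
  · subst h0
    simp [ltwo_zero]
  have hex : ∃ j ∈ S, δ j ≠ 0 := by
    by_contra! hne
    exact h0 (funext fun j => by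
      by_cases hj : j ∈ S
      · exact hne j hj
      · exact hδ j hj)
  have hcone : ∑ j ∈ Sᶜ, |δ j| ≤ 3 * ∑ j ∈ S, |δ j| := by
    rw [Finset.sum_eq_zero fun j hj => by rw [hδ j (Finset.mem_compl.1 hj), abs_zero]]
    exact mul_nonneg (by norm_num) (Finset.sum_nonneg fun _ _ => abs_nonneg _)
  have h1 := h.trans ((iInf_le _ δ).trans ((iInf_le _ hcone).trans (iInf_le _ hex)))
  have hc : (0 : ℝ) < √(Fintype.card m) := Real.sqrt_pos.2 (Nat.cast_pos.2 Fintype.card_pos)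
  have hl := ltwo_pos h0
  rw [ltwo_restrict hδ, ENNReal.ofReal_le_ofReal_iff (div_nonneg (ltwo_nonneg _) (by positivity)),
    le_div_iff₀ (by positivity)] at h1
  exact h1

lemma matInf_submatrix_sub_le {ι s : Type*} [Fintype s] {A A' : Matrix ι ι ℝ} {S : Finset ι}
    {c : ℝ} (hc : 0 ≤ c) (h : ∀ j l, |A' j l - A j l| ≤ c) (f : s → ι) :
    matInf (A'.submatrix f (Subtype.val : {j // j ∈ S} → ι) - A.submatrix f Subtype.val) ≤
      S.card * c := by
  refine matInf_le (by positivity) fun r => ?_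
  calc _ ≤ ∑ _j : {j // j ∈ S}, c := Finset.sum_le_sum fun j _ => h (f r) j
    _ = S.card * c := by simp

lemma matInf_eq_zero_of_isEmpty {m ι : Type*} [Fintype ι] [IsEmpty ι] (A : Matrix m ι ℝ) :
    matInf A = 0 := by
  simp [matInf]

namespace Networks

variable {p q : ℕ} {N : Networks p q} {s κ : ℝ} {c₁ c₂ : Fin 2 → ℝ}

lemma nTot_pos (hst : N.Standing) : (0 : ℝ) < N.nTot := by
  rw [nTot_eq]
  exact add_pos (Nat.cast_pos.2 (hst.n_pos 0)) (Nat.cast_pos.2 (hst.n_pos 1))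

lemma bounded_below_design (hst : N.Standing) {i : Fin p} {φ₀ : ℝ}
    (hRE : ENNReal.ofReal φ₀ ≤ restrictedEigenvalue (N.H i * N.XX * N.PiMinus i) (N.S i))
    {δ : Coef p i → ℝ} (hδ : ∀ j ∉ N.S i, δ j = 0) :
    φ₀ * (√N.nTot * ltwo δ) ≤ ltwo ((N.H i * (N.XX * N.PiMinus i)) *ᵥ δ) := by
  have : Nonempty (Fin (N.n 0) ⊕ Fin (N.n 1)) := ⟨Sum.inl ⟨0, hst.n_pos 0⟩⟩
  have h1 := mul_ltwo_le_of_restrictedEigenvalue hRE hδ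
  rw [Matrix.mul_assoc] at h1
  have h2 : Fintype.card (Fin (N.n 0) ⊕ Fin (N.n 1)) = N.nTot := by simp [nTot]
  rwa [h2] at h1

lemma isUnit_block11_I (hst : N.Standing) (h : N.Calibration s κ c₁ c₂) (hc₂ : ∀ k, 0 < c₂ k)
    {i : Fin p} {φ₀ : ℝ} (hφ : 0 < φ₀)
    (hRE : ENNReal.ofReal φ₀ ≤ restrictedEigenvalue (N.H i * N.XX * N.PiMinus i) (N.S i)) :
    IsUnit (block11 (N.I i) (N.S i)) := by
  rw [← mulVec_injective_iff_isUnit]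
  refine (injective_iff_map_eq_zero (block11 (N.I i) (N.S i)).mulVecLin).2 fun v hv => ?_
  have hn := nTot_pos hst
  set δ := extend (N.S i) v with hδ
  set Z := N.H i * (N.XX * N.PiMinus i) with hZ
  have hz : ∀ j ∉ N.S i, δ j = 0 := fun j hj => extend_notMem _ v hj
  have h1 : ∀ j : {j // j ∈ N.S i}, (N.I i *ᵥ δ) j = 0 := fun j => by
    rw [hδ, mulVec_extend]
    exact congrFun hv j
  have h2 : δ ⬝ᵥ (N.I i *ᵥ δ) = 0 := Finset.sum_eq_zero fun j _ => by
    by_cases hj : j ∈ N.S i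
    · rw [h1 ⟨j, hj⟩, mul_zero]
    · rw [hz j hj, zero_mul]
  have h3 : δ ⬝ᵥ (N.I i *ᵥ δ) = (N.nTot : ℝ)⁻¹ * ltwo (Z *ᵥ δ) ^ 2 := by
    rw [I, gram_eq hst h hc₂, ← hZ, smul_mulVec, dotProduct_smul, smul_eq_mul, ltwo_sq,
      dotProduct_mulVec (Z *ᵥ δ), vecMul_mulVec, ← dotProduct_mulVec]
  have h4 : ltwo (Z *ᵥ δ) = 0 := by
    rw [h2] at h3
    exact pow_eq_zero_iff two_ne_zero |>.1
      ((mul_eq_zero.1 h3.symm).resolve_left (inv_ne_zero hn.ne'))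
  have h5 := bounded_below_design hst hRE hz
  rw [← hZ, h4, ← mul_assoc] at h5
  have h6 : δ = 0 := by
    by_contra hne
    have := ltwo_pos hne
    have : 0 < φ₀ * √N.nTot * ltwo δ := by positivity
    linarith
  ext j
  rw [← extend_mem (N.S i) v j, ← hδ, h6]
  rfl

/-- Tested on a coordinate vector from the support. It links `φ₀` to `c_max ‖Π‖₁`, which turns the
term `φ₀² / 64` into a relative bound on the calibration error. -/
lemma re_le (hs : 0 < s) (hst : N.Standing) (h : N.Calibration s κ c₁ c₂) (hc₁ : ∀ k, 0 < c₁ k)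
    (hc₂ : ∀ k, 0 < c₂ k) {i : Fin p} {φ₀ : ℝ} (hS : (N.S i).Nonempty)
    (hRE : ENNReal.ofReal φ₀ ≤ restrictedEigenvalue (N.H i * N.XX * N.PiMinus i) (N.S i)) :
    φ₀ ≤ max (c₁ 0) (c₁ 1) * matOne N.PiMat := by
  obtain ⟨j, hj⟩ := hS
  have hn := nTot_pos hst
  have h1 := bounded_below_design hst hRE (δ := Pi.single j 1) fun l hl => by
    have : l ≠ j := fun hEq => hl (hEq ▸ hj)
    simp [this]
  rw [mulVec_single_one] at h1
  have h2 : ltwo (Pi.single j 1 : Coef p i → ℝ) = 1 := by simp [ltwo]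
  have h3 : (N.H i * (N.XX * N.PiMinus i)).col j =
      N.H i *ᵥ fun r => (N.XX * N.PiMinus i) r j := rfl
  rw [h2, mul_one, h3] at h1
  exact le_of_mul_le_mul_right (h1.trans ((H_contraction hst h hc₂ i _).trans
    (ltwo_XX_mul_PiMinus_col_le hs hst h hc₁ i j))) (Real.sqrt_pos.2 hn)

/-- What the condition on the error of the calibration stage says without square roots. -/
lemma sq_bound_of_sqrt_bound {x c μ C φ : ℝ} {r : ℕ} (hx : 0 ≤ x) (hc : 0 ≤ c) (hC : 1 ≤ C)
    (hr : 0 < r) (hμ0 : 0 ≤ μ) (hμ : μ ≤ φ ^ 2 / 64) (hφ0 : 0 ≤ φ) (hφ : φ ≤ c)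
    (h : x + c ≤ √(c ^ 2 + μ / (C * r))) :
    r * (C * (2 * c * x + x ^ 2)) ≤ μ ∧ x ≤ c / 8 := by
  have hr1 : (1 : ℝ) ≤ r := by exact_mod_cast hr
  have hCr : 1 ≤ C * r := by nlinarith
  have h1 := (Real.le_sqrt (by positivity) (by positivity)).1 h
  have h2 : 2 * c * x + x ^ 2 ≤ μ / (C * r) := by nlinarith
  have h3 := (le_div_iff₀ (by linarith)).1 h2
  refine ⟨by linarith, ?_⟩
  have h4 : 2 * c * x + x ^ 2 ≤ μ := by
    refine le_trans (le_mul_of_one_le_right (by positivity) hCr) h3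
  -- Chain `x² ≤ μ ≤ φ² / 64 ≤ (c / 8)²`.
  have h5 : x ^ 2 ≤ (c / 8) ^ 2 := by nlinarith
  exact (sq_le_sq₀ hx (by positivity)).1 h5

/-- The adaptive lasso recovers the support if the score is small, the calibration errors are
bounded, and the conditions on the design, the weights and the signal hold. -/
lemma supp_eq_of_score_le (hs : 0 < s) (hst : N.Standing) (h : N.Calibration s κ c₁ c₂)
    (hc₁ : ∀ k, 0 < c₁ k) (hc₂ : ∀ k, 0 < c₂ k) {v C₂ : ℝ}
    (hC₂ : c₁ 0 ^ 2 * calConst v (c₁ 0) (c₂ 0) + c₁ 1 ^ 2 * calConst v (c₁ 1) (c₂ 1) ≤ C₂)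
    (hC₂' : 1 ≤ C₂) {Ω : Type*} {Y : Ω → N.Obs} {ω : Ω} (hω : ∀ k l, ω ∉ N.calBad Y v c₁ k l)
    {i : Fin p} {τ φ₀ t : ℝ} (hτ : 0 < τ) (hτ1 : τ < 1) (hφ : 0 < φ₀) (ht : 0 < t)
    {w b : Coef p i → ℝ} (hw : ∀ j, 0 < w j)
    (hb : N.IsAdaptiveLasso (Y ω) i t w b)
    (hRE : ENNReal.ofReal φ₀ ≤ restrictedEigenvalue (N.H i * N.XX * N.PiMinus i) (N.S i))
    (hirr : N.irrep i w < 1 - τ) (hunit : IsUnit (block11 (N.IHat (Y ω) i) (N.S i)))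
    (hsig : (N.S i).Nonempty → t * N.ψ i w / (2 - τ) < N.signal i)
    (hcal : (N.S i).Nonempty → √(N.D / N.nTot) + max (c₁ 0) (c₁ 1) * matOne N.PiMat ≤
      √((max (c₁ 0) (c₁ 1)) ^ 2 * matOne N.PiMat ^ 2 +
        min (φ₀ ^ 2 / 64) (τ * (4 - τ)⁻¹ * minAbs w / N.ψ i w) / (C₂ * (N.S i).card)))
    (hJ : ∀ j, |(N.nTot : ℝ)⁻¹ * ((N.H i * N.ZHat (Y ω) i)ᵀ *ᵥ
      (N.H i *ᵥ N.stack (Y ω) i - (N.H i * N.ZHat (Y ω) i) *ᵥ N.β i)) j| ≤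
        τ / 8 * (t / 2 * w j)) :
    supp b = N.S i := by
  have hn := nTot_pos hst
  have hQ : N.IHat (Y ω) i =
      (N.nTot : ℝ)⁻¹ • ((N.H i * N.ZHat (Y ω) i)ᵀ * (N.H i * N.ZHat (Y ω) i)) := by
    rw [IHat, gram_eq hst h hc₂, XX_mul_PiHatMinus]
  have hτ4 : 0 < 4 - τ := by linarith
  have hψ : 0 ≤ N.ψ i w := matInf_nonneg _
  have key : (N.S i).Nonempty → (∀ j ∈ N.S i, matInf ((block11 (N.IHat (Y ω) i) (N.S i))⁻¹ *
        diagonal fun j : {j // j ∈ N.S i} => w j) * ((1 + τ / 8) * (t / 2)) < |N.β i j|) ∧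
      matInf ((diagonal fun j : {j // j ∉ N.S i} => w j)⁻¹ * block21 (N.IHat (Y ω) i) (N.S i) *
        (block11 (N.IHat (Y ω) i) (N.S i))⁻¹ * diagonal fun j : {j // j ∈ N.S i} => w j) *
          (1 + τ / 8) + τ / 8 < 1 := by
    intro hS
    have : Nonempty (Coef p i) := ⟨hS.choose⟩
    have hwmin : 0 < minAbs w := minAbs_pos fun j => (hw j).ne'
    have hwle : ∀ j, minAbs w ≤ w j := fun j => (minAbs_le w j).trans_eq (abs_of_pos (hw j))
    have hcm : 0 < max (c₁ 0) (c₁ 1) := lt_max_of_lt_left (hc₁ 0)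
    have hcal' := hcal hS
    rw [← mul_pow] at hcal'
    set μ := min (φ₀ ^ 2 / 64) (τ * (4 - τ)⁻¹ * minAbs w / N.ψ i w) with hμ
    have hμ0 : 0 ≤ μ := le_min (by positivity) (by positivity)
    have hx := (sq_bound_of_sqrt_bound (Real.sqrt_nonneg _)
      (mul_nonneg hcm.le (matOne_nonneg _)) hC₂' hS.card_pos hμ0 (min_le_left _ _) hφ.le
      (re_le hs hst h hc₁ hc₂ hS hRE) hcal').1
    rw [Real.sq_sqrt (div_nonneg (D_pos hst).le hn.le)] at hx
    have hdev := abs_IHat_sub_le hs hst h hc₁ hc₂ hC₂ hC₂' hω i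
    have hdev0 := (abs_nonneg _).trans (hdev hS.choose hS.choose)
    have hpert := gram_perturbation (isUnit_block11_I hst h hc₂ hφ hRE) hunit
      (C := block21 (N.I i) (N.S i)) (C' := block21 (N.IHat (Y ω) i) (N.S i))
      (w := fun j : {j // j ∈ N.S i} => w j) (w' := fun j : {j // j ∉ N.S i} => w j) (ε := μ)
      (θ := τ * (4 - τ)⁻¹) (η := 1 - τ) hwmin
      (fun j => hwle j) (fun j => hwle j) ((matInf_submatrix_sub_le hdev0 hdev _).trans hx)
      ((matInf_submatrix_sub_le hdev0 hdev _).trans hx) (by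
        -- For `ψ = 0` the quotient by `ψ` has the default value `0` and carries no information, but
        -- then the claim is trivial.
        rcases hψ.eq_or_lt with h0 | h0
        · change μ * N.ψ i w ≤ _
          rw [← h0, mul_zero]
          positivity
        · exact (le_div_iff₀ h0).1 (min_le_right _ _)) hirr.le
    have hθ : 1 - τ * (4 - τ)⁻¹ = (4 - 2 * τ) / (4 - τ) := by
      field_simp
      ring
    rw [hθ] at hpert
    constructor
    · intro j hj
      have h1 := hpert.1
      rw [div_mul_eq_mul_div, div_le_iff₀ hτ4] at h1
      have h2 : N.signal i ≤ |N.β i j| :=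
        ciInf_le (f := fun j : {j // j ∈ N.S i} => |N.β i j|) (Set.finite_range _).bddBelow ⟨j, hj⟩
      refine lt_of_le_of_lt ?_ ((hsig hS).trans_le h2)
      rw [le_div_iff₀ (by linarith)]
      change (4 - 2 * τ) * _ ≤ N.ψ i w * (4 - τ) at h1
      set Ψ := matInf ((block11 (N.IHat (Y ω) i) (N.S i))⁻¹ *
        diagonal fun j : {j // j ∈ N.S i} => w j)
      -- Perturbation and score together enlarge the correction by at most `4 / (4 - 2τ)`, since `(4
      -- - τ)(1 + τ/8) ≤ 4`. Times `t / 2` this is the `t ψ / (2 - τ)` of the signal condition.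
      have h3 : (4 - 2 * τ) * Ψ * (1 + τ / 8) ≤ N.ψ i w * 4 := by
        calc (4 - 2 * τ) * Ψ * (1 + τ / 8) ≤ N.ψ i w * (4 - τ) * (1 + τ / 8) :=
              mul_le_mul_of_nonneg_right h1 (by positivity)
          _ = N.ψ i w * ((4 - τ) * (1 + τ / 8)) := by ring
          _ ≤ N.ψ i w * 4 := mul_le_mul_of_nonneg_left (by nlinarith) hψ
      nlinarith [mul_le_mul_of_nonneg_right h3 ht.le]
    · have h1 := hpert.2
      rw [div_mul_eq_mul_div, div_le_iff₀ hτ4] at h1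
      set K := matInf ((diagonal fun j : {j // j ∉ N.S i} => w j)⁻¹ *
        block21 (N.IHat (Y ω) i) (N.S i) * (block11 (N.IHat (Y ω) i) (N.S i))⁻¹ *
          diagonal fun j : {j // j ∈ N.S i} => w j)
      -- This perfect square is why `θ = τ / (4 - τ)`: the irrepresentability bound `1 - τ` degrades
      -- to `1 - τ/2`, and `(1 - τ/2)(1 + τ/8) + τ/8 < 1`.
      have h2 : (1 - τ + τ * (4 - τ)⁻¹) * (4 - τ) = (2 - τ) ^ 2 := by
        field_simp
        ring
      rw [h2] at h1
      have h3 : K ≤ (2 - τ) / 2 := by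
        have : 0 < 2 - τ := by linarith
        refine le_of_mul_le_mul_left ?_ this
        nlinarith
      nlinarith [mul_le_mul_of_nonneg_right h3 (show (0 : ℝ) ≤ 1 + τ / 8 by positivity)]
  refine lasso_supp (Z := N.H i * N.ZHat (Y ω) i) (y := N.H i *ᵥ N.stack (Y ω) i)
    (e := N.H i *ᵥ N.stack (Y ω) i - (N.H i * N.ZHat (Y ω) i) *ᵥ N.β i)
    (β := N.β i) (S := N.S i) (inv_pos.2 hn) ht hw (ε := τ / 8) (by positivity) rfl (by abel)
    (fun u => ?_) hJ (hQ ▸ hunit) (fun j hj => ?_) ?_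
  · have h1 := hb u
    simpa only [objective, mulVec_mulVec] using h1
  · rw [← hQ]
    exact (key ⟨j, hj⟩).1 j hj
  · rw [← hQ]
    rcases (N.S i).eq_empty_or_nonempty with hS | hS
    · have : IsEmpty {j // j ∈ N.S i} := by rw [hS]; infer_instance
      rw [matInf_eq_zero_of_isEmpty]
      linarith
    · exact (key hS).2

end Networks

/-! ### Probability of the exceptional events -/

/-- The union bound in complementary form. Only subadditivity is used, so neither `G` nor the bad
sets need be measurable; weights, tuning parameter and estimator are arbitrary functions of `ω`. -/
lemma one_sub_sum_le_measureReal {Ω ι : Type*} [MeasurableSpace Ω] {μ : Measure Ω}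
    [IsProbabilityMeasure μ] [Fintype ι] {bad : ι → Set Ω} {G : Set Ω}
    (h : ∀ᵐ ω ∂μ, (∀ x, ω ∉ bad x) → ω ∈ G) : 1 - ∑ x, μ.real (bad x) ≤ μ.real G := by
  have h1 : μ Set.univ ≤ μ (G ∪ ⋃ x, bad x) := by
    refine measure_mono_ae ?_
    filter_upwards [h] with ω hω _
    by_cases hb : ∀ x, ω ∉ bad x
    · exact Or.inl (hω hb)
    · push Not at hb
      exact Or.inr (Set.mem_iUnion.2 hb)
  have h2 : (1 : ℝ) ≤ μ.real (G ∪ ⋃ x, bad x) := by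
    have := ENNReal.toReal_mono (measure_ne_top _ _) h1
    simpa [measureReal_def] using this
  have h3 := measureReal_union_le (μ := μ) G (⋃ x, bad x)
  have h4 := measureReal_iUnion_fintype_le (μ := μ) bad
  linarith

namespace Networks

variable {p q : ℕ} {N : Networks p q} {s κ : ℝ} {c₁ c₂ : Fin 2 → ℝ}

/-- The constant of the prediction error of the calibration stage. -/
noncomputable def predConst (v : ℝ) (c₁ c₂ : Fin 2 → ℝ) : ℝ :=
  max 1 (c₁ 0 ^ 2 * calConst v (c₁ 0) (c₂ 0) + c₁ 1 ^ 2 * calConst v (c₁ 1) (c₂ 1))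

/-- Prediction error of the calibration stage. -/
lemma prediction_bound {σmax : ℝ} (hs : 0 < s) (hσ : 0 < σmax) (hc₁ : ∀ k, 0 < c₁ k)
    (hc₂ : ∀ k, 0 < c₂ k) (hN : N.Admissible s σmax κ c₁ c₂) {Ω : Type*} [MeasurableSpace Ω]
    {μ : Measure Ω} [IsProbabilityMeasure μ] {Y : Ω → N.Obs} (hY : N.IsSample μ Y)
    (j : Fin p ⊕ Fin p) : 1 - Real.exp (-N.f 0) - Real.exp (-N.f 1) ≤
      μ.real {ω | ltwo (N.XX *ᵥ fun l => N.PiHat (Y ω) l j - N.PiMat l j) ^ 2 ≤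
        predConst (σmax ^ 2 / s ^ 2) c₁ c₂ * N.D} := by
  have hst := hN.standing
  have h := hN.calibration
  refine le_trans ?_ (one_sub_sum_le_measureReal
    (bad := fun k => N.calBad Y (σmax ^ 2 / s ^ 2) c₁ k (Sum.elim id id j))
    (Filter.Eventually.of_forall fun ω hω => ?_))
  · rw [Fin.sum_univ_two]
    have h1 := fun k => measure_calBad_le hs hσ hst h hN.sd_le hc₁ hY k (Sum.elim id id j)
    linarith [h1 0, h1 1]
  · have h1 : (N.XX *ᵥ fun l => N.PiHat (Y ω) l j - N.PiMat l j) =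
        fun r => pair (N.X 0 * (N.redFormHat (Y ω) 0 - N.redForm 0))
          (N.X 1 * (N.redFormHat (Y ω) 1 - N.redForm 1)) r j := by
      rw [← XX_mul_pair, ← pair_sub]
      rfl
    rw [Set.mem_ofPred_eq, h1, ltwo_sq_pair_col]
    have hk := fun k => ltwo_prediction_le hs hst h hc₂ (hω k)
    refine (add_le_add (hk 0) (hk 1)).trans ?_
    rw [← add_mul]
    exact mul_le_mul_of_nonneg_right (le_max_right _ _) (D_pos hst).le

/-- This bound serves the correlation of the noise with `X Π`, and `h_le_right` its correlation with
the calibration error; `h` has to be below both exponents. -/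
lemma h_le_left (hst : N.Standing) (hL : 0 ≤ Real.log p) :
    N.h ≤ N.oneB ^ 2 * N.D * Real.log p := by
  have hD := (D_pos hst).le
  refine mul_le_mul_of_nonneg_right ?_ hL
  exact mul_le_mul (min_le_left _ _) (min_le_right _ _) (le_min (by positivity) hD) (sq_nonneg _)

lemma h_le_right (hst : N.Standing) (hL : 0 ≤ Real.log p) :
    N.h ≤ N.oneB ^ 2 * (N.nTot * matOne N.PiMat ^ 2 / N.d) * Real.log p := by
  have hD := (D_pos hst).le
  refine mul_le_mul_of_nonneg_right ?_ hL
  exact mul_le_mul (min_le_left _ _) (min_le_left _ _) (le_min (by positivity) hD) (sq_nonneg _)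

lemma nMin_pos (hst : N.Standing) : (0 : ℝ) < N.nMin := by
  rw [nMin]
  exact_mod_cast lt_min (hst.n_pos 0) (hst.n_pos 1)

lemma nMin_le (k : Fin 2) : (N.nMin : ℝ) ≤ N.n k := by
  rw [nMin]
  revert k
  rw [Fin.forall_fin_two]
  exact ⟨by exact_mod_cast min_le_left _ _, by exact_mod_cast min_le_right _ _⟩

lemma n_le_nTot (k : Fin 2) : (N.n k : ℝ) ≤ N.nTot := by
  rw [nTot_eq]
  revert k
  rw [Fin.forall_fin_two]
  exact ⟨by simp, by simp⟩

lemma oneB_nonneg : 0 ≤ N.oneB := Real.iSup_nonneg fun _ => lone_nonneg _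

lemma lone_calErr_le (hs : 0 < s) (hst : N.Standing) (h : N.Calibration s κ c₁ c₂)
    (hc₂ : ∀ k, 0 < c₂ k) {v C : ℝ} (hC : ∀ k, calConst v (c₁ k) (c₂ k) ≤ C)
    {Ω : Type*} {Y : Ω → N.Obs} {k : Fin 2} {j : Fin p} {ω : Ω} (hω : ω ∉ N.calBad Y v c₁ k j) :
    lone (N.calErr (Y ω) k j) ≤ √(N.d * C * N.D / N.nMin) := by
  have hz := calErr_eq_zero hs hst h (Y ω) k j
  have h1 := lone_sq_le fun l : {l // l ∈ N.M k j} => N.calErr (Y ω) k j l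
  rw [lone_restrict hz, ltwo_restrict hz, Fintype.card_coe, hst.card_M] at h1
  have h2 := n_mul_ltwo_calErr_le hs hst h hc₂ hω
  have h3 := nMin_pos hst
  refine Real.le_sqrt_of_sq_le (h1.trans ?_)
  rw [mul_assoc, mul_div_assoc]
  refine mul_le_mul_of_nonneg_left ?_ (Nat.cast_nonneg _)
  rw [le_div_iff₀ h3]
  have h4 := mul_le_mul_of_nonneg_right (nMin_le (N := N) k) (sq_nonneg (ltwo (N.calErr (Y ω) k j)))
  have h5 := mul_le_mul_of_nonneg_right (hC k) (D_pos hst).le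
  linarith

/-- The event on which the errors of node `i` correlate with the reduced-form regressors. -/
noncomputable def regBad (N : Networks p q) {Ω : Type*} (Y : Ω → N.Obs) (i : Fin p) (T : ℝ)
    (k : Fin 2) (l : Fin p) : Set Ω :=
  {ω | T ≤ |(N.proj k i *ᵥ fun r => (N.X k * N.redForm k) r l) ⬝ᵥ fun r => N.noise (Y ω) k r i|}

/-- The event on which the errors of node `i` correlate with the exogenous variables. -/
noncomputable def exoBad (N : Networks p q) {Ω : Type*} (Y : Ω → N.Obs) (i : Fin p) (T : ℝ)
    (k : Fin 2) (l : Fin q) : Set Ω :=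
  {ω | T ≤ |(N.proj k i *ᵥ fun r => N.X k r l) ⬝ᵥ fun r => N.noise (Y ω) k r i|}

section Tails

variable {σmax : ℝ} {Ω : Type*} [MeasurableSpace Ω] {μ : Measure Ω} [IsProbabilityMeasure μ]
  {Y : Ω → N.Obs}

lemma measure_regBad_le (hs : 0 < s) (hσ : 0 < σmax) (hc₂ : ∀ k, 0 < c₂ k)
    (hN : N.Admissible s σmax κ c₁ c₂) (hY : N.IsSample μ Y) (i : Fin p) {T x : ℝ} (hT : 0 ≤ T)
    (k : Fin 2) (l : Fin p) (hP : 0 < matOne N.PiMat)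
    (hx : x * (2 * (σmax ^ 2 / s ^ 2 * (matOne N.PiMat ^ 2 * N.n k))) ≤ T ^ 2) :
    μ.real (N.regBad Y i T k l) ≤ 2 * Real.exp (-x) := by
  have h0 : (0 : ℝ) < N.n k := Nat.cast_pos.2 (hN.standing.n_pos k)
  have hv : 0 < σmax ^ 2 / s ^ 2 := by positivity
  have hu := (proj_contraction hN.standing hN.calibration hc₂ k i
    fun r => (N.X k * N.redForm k) r l).trans (ltwo_design_col_le hN.standing k l)
  have hu2 := pow_le_pow_left₀ (ltwo_nonneg _) hu 2
  rw [mul_pow, Real.sq_sqrt h0.le, ltwo_sq] at hu2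
  have h1 := (subgaussianVector_noise hs hσ hN.calibration hN.sd_le hY k i).tail hu2
    (by positivity) hT
  rw [Real.coe_toNNReal _ hv.le] at h1
  refine h1.trans ?_
  have h2 : -T ^ 2 / (2 * (σmax ^ 2 / s ^ 2 * (matOne N.PiMat ^ 2 * N.n k))) ≤ -x := by
    rw [div_le_iff₀ (by positivity)]
    linarith
  have := Real.exp_le_exp.2 h2
  linarith

lemma measure_exoBad_le (hs : 0 < s) (hσ : 0 < σmax) (hc₂ : ∀ k, 0 < c₂ k)
    (hN : N.Admissible s σmax κ c₁ c₂) (hY : N.IsSample μ Y) (i : Fin p) {T x : ℝ} (hT : 0 ≤ T)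
    (k : Fin 2) (l : Fin q) (hx : x * (2 * (σmax ^ 2 / s ^ 2 * N.n k)) ≤ T ^ 2) :
    μ.real (N.exoBad Y i T k l) ≤ 2 * Real.exp (-x) := by
  have h0 : (0 : ℝ) < N.n k := Nat.cast_pos.2 (hN.standing.n_pos k)
  have hv : 0 < σmax ^ 2 / s ^ 2 := by positivity
  have hu := (proj_contraction hN.standing hN.calibration hc₂ k i fun r => N.X k r l).trans_eq
    (hN.standing.standardized k l)
  have hu2 := pow_le_pow_left₀ (ltwo_nonneg _) hu 2
  rw [Real.sq_sqrt h0.le, ltwo_sq] at hu2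
  have h1 := (subgaussianVector_noise hs hσ hN.calibration hN.sd_le hY k i).tail hu2
    (by positivity) hT
  rw [Real.coe_toNNReal _ hv.le] at h1
  refine h1.trans ?_
  have h2 : -T ^ 2 / (2 * (σmax ^ 2 / s ^ 2 * N.n k)) ≤ -x := by
    rw [div_le_iff₀ (by positivity)]
    linarith
  have := Real.exp_le_exp.2 h2
  linarith

end Tails

/-- The probability bound is trivial if one of the factors of `h` vanishes. -/
lemma bound_nonpos_of_h_eq_zero {C : ℝ} (hp : 0 < p) (hq : 0 < q) (hh : N.h = 0) :
    1 - 3 * Real.exp (-C * N.h + Real.log (4 * p * q)) - Real.exp (-N.f 0 + Real.log p) -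
      Real.exp (-N.f 1 + Real.log p) ≤ 0 := by
  have hp' : (1 : ℝ) ≤ p := by exact_mod_cast hp
  have hq' : (1 : ℝ) ≤ q := by exact_mod_cast hq
  rw [hh, mul_zero, zero_add, Real.exp_log (by positivity)]
  have := Real.exp_pos (-N.f 0 + Real.log p)
  have := Real.exp_pos (-N.f 1 + Real.log p)
  nlinarith

/-- Sum of the probabilities of the exceptional events. -/
lemma bound_le_of_tails {C : ℝ} (hp : 0 < p) (hq : 0 < q) {μcal : Fin 2 × Fin p → ℝ}
    {μreg : Fin 2 × Fin p → ℝ} {μexo : Fin 2 × Fin q → ℝ}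
    (h1 : ∀ x, μcal x ≤ Real.exp (-N.f x.1)) (h2 : ∀ x, μreg x ≤ 2 * Real.exp (-(C * N.h)))
    (h3 : ∀ x, μexo x ≤ 2 * Real.exp (-(C * N.h))) :
    1 - 3 * Real.exp (-C * N.h + Real.log (4 * p * q)) - Real.exp (-N.f 0 + Real.log p) -
      Real.exp (-N.f 1 + Real.log p) ≤
    1 - (∑ x, μcal x + (∑ x, μreg x + ∑ x, μexo x)) := by
  have hp' : (1 : ℝ) ≤ p := by exact_mod_cast hp
  have hq' : (1 : ℝ) ≤ q := by exact_mod_cast hq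
  have e1 : ∑ x, μcal x ≤ p * Real.exp (-N.f 0) + p * Real.exp (-N.f 1) := by
    refine (Finset.sum_le_sum fun x _ => h1 x).trans ?_
    rw [Fintype.sum_prod_type, Fin.sum_univ_two]
    simp
  have e2 : ∑ x, μreg x ≤ 4 * p * Real.exp (-(C * N.h)) := by
    refine (Finset.sum_le_sum fun x _ => h2 x).trans (le_of_eq ?_)
    simp
    ring
  have e3 : ∑ x, μexo x ≤ 4 * q * Real.exp (-(C * N.h)) := by
    refine (Finset.sum_le_sum fun x _ => h3 x).trans (le_of_eq ?_)
    simp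
    ring
  rw [Real.exp_add, Real.exp_add, Real.exp_add, Real.exp_log (by positivity),
    Real.exp_log (by positivity), neg_mul]
  have h4 : (p : ℝ) + q ≤ 2 * (p * q) := by nlinarith
  have h5 := mul_le_mul_of_nonneg_right h4 (Real.exp_pos (-(C * N.h))).le
  have h6 : (0 : ℝ) ≤ p * q * Real.exp (-(C * N.h)) := by positivity
  nlinarith

end Networks

/-! ### Arithmetic of the exponents and of the calibration part of the score -/

/-- Matches `C₅ h` with the Gaussian exponent of the first noise part: `32768 = 2 * 128²`, where
`128` is the denominator of the threshold, and `nk * nm ≤ n²`. The factor `1 + C` makes one constant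
serve here and in `tail_exponent_exo`. -/
lemma tail_exponent_reg {n nm nk D ℓ B P a τ v C h : ℝ} (hnm : 0 < nm) (hmn : nm ≤ n)
    (hnk : 0 < nk) (hkn : nk ≤ n) (hD : 0 < D) (hℓ : 0 ≤ ℓ) (hv : 0 < v) (hC : 0 ≤ C)
    (hh : h ≤ B ^ 2 * D * ℓ) :
    τ ^ 2 * a ^ 2 / (32768 * v * (1 + C)) * h * (2 * (v * (P ^ 2 * nk))) ≤
      (n * τ * (a * B * P * √(D * ℓ / nm)) / 128) ^ 2 := by
  have hs : √(D * ℓ / nm) ^ 2 = D * ℓ / nm := Real.sq_sqrt (by positivity)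
  have e1 : τ ^ 2 * a ^ 2 / (32768 * v * (1 + C)) * h * (2 * (v * (P ^ 2 * nk))) =
      τ ^ 2 * a ^ 2 * P ^ 2 * (h * nk / (16384 * (1 + C))) := by
    field_simp
    ring
  have e2 : (n * τ * (a * B * P * √(D * ℓ / nm)) / 128) ^ 2 =
      τ ^ 2 * a ^ 2 * P ^ 2 * (B ^ 2 * D * ℓ * (n ^ 2 / nm) / 16384) := by
    rw [div_pow, mul_pow, mul_pow (a * B * P), hs]
    field_simp
    ring
  rw [e1, e2]
  refine mul_le_mul_of_nonneg_left ?_ (by positivity)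
  have h1 : nk ≤ n ^ 2 / nm := by
    rw [le_div_iff₀ hnm]
    nlinarith
  have h2 : h * nk ≤ B ^ 2 * D * ℓ * (n ^ 2 / nm) :=
    (mul_le_mul_of_nonneg_right hh hnk.le).trans (mul_le_mul_of_nonneg_left h1 (by positivity))
  have h3 : 0 ≤ B ^ 2 * D * ℓ * (n ^ 2 / nm) := by positivity
  rw [div_le_div_iff₀ (by positivity) (by norm_num)]
  nlinarith [mul_nonneg h3 hC]

/-- The threshold is divided by the `ℓ₁` bound on the calibration error; `D / nm` cancels, which
leaves `n P² / d` as the decisive quantity. -/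
lemma tail_exponent_exo {n nm nk d D ℓ B P a τ v C h : ℝ} (hnm : 0 < nm)
    (hnk : 0 < nk) (hkn : nk ≤ n) (hd : 0 < d) (hD : 0 < D) (hℓ : 0 ≤ ℓ) (hv : 0 < v) (hC : 0 < C)
    (hh : h ≤ B ^ 2 * (n * P ^ 2 / d) * ℓ) :
    τ ^ 2 * a ^ 2 / (32768 * v * (1 + C)) * h * (2 * (v * nk)) ≤
      (n * τ * (a * B * P * √(D * ℓ / nm)) / (128 * √(d * C * D / nm))) ^ 2 := by
  have hn : 0 < n := hnk.trans_le hkn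
  have hs : √(D * ℓ / nm) ^ 2 = D * ℓ / nm := Real.sq_sqrt (by positivity)
  have hs' : √(d * C * D / nm) ^ 2 = d * C * D / nm := Real.sq_sqrt (by positivity)
  have e1 : τ ^ 2 * a ^ 2 / (32768 * v * (1 + C)) * h * (2 * (v * nk)) =
      τ ^ 2 * a ^ 2 * (h * nk / (16384 * (1 + C))) := by
    field_simp
    ring
  have e2 : (n * τ * (a * B * P * √(D * ℓ / nm)) / (128 * √(d * C * D / nm))) ^ 2 =
      τ ^ 2 * a ^ 2 * (B ^ 2 * (n * P ^ 2 / d) * ℓ * n / (16384 * C)) := by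
    rw [div_pow, mul_pow, mul_pow (a * B * P), mul_pow 128, hs, hs']
    field_simp
    ring
  rw [e1, e2]
  refine mul_le_mul_of_nonneg_left ?_ (by positivity)
  have h3 : 0 ≤ B ^ 2 * (n * P ^ 2 / d) * ℓ := by positivity
  have h2 : h * nk ≤ B ^ 2 * (n * P ^ 2 / d) * ℓ * n :=
    (mul_le_mul_of_nonneg_right hh hnk.le).trans (mul_le_mul_of_nonneg_left hkn h3)
  have h4 := mul_nonneg h3 hn.le
  rw [div_le_div_iff₀ (by positivity) (by positivity)]
  nlinarith [mul_le_mul_of_nonneg_right h2 hC.le]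

/-- Since `√(D/n) ≤ c/8`, the calibration error adds only a constant multiple to the norm of a
regressor, and the product is linear in `√(D/n)`. -/
lemma regressor_mul_error_le {n D C c z : ℝ} (hn : 0 < n) (hC : 0 ≤ C)
    (hz : z ≤ c * √n + √(C * D)) (hx : √(D / n) ≤ c / 8) :
    z * √(C * D) ≤ n * (c * (1 + √C / 8) * √C * √(D / n)) := by
  have h1 : √(C * D) = √C * (√n * √(D / n)) := by
    rw [← Real.sqrt_mul hn.le, mul_div_cancel₀ _ hn.ne', Real.sqrt_mul hC]
  have h2 : z ≤ √n * (c * (1 + √C / 8)) := by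
    refine hz.trans ?_
    rw [h1]
    have := mul_le_mul_of_nonneg_left hx (mul_nonneg (Real.sqrt_nonneg C) (Real.sqrt_nonneg n))
    linarith
  refine (mul_le_mul_of_nonneg_right h2 (Real.sqrt_nonneg _)).trans (le_of_eq ?_)
  rw [h1]
  have h3 : √n * √n = n := Real.mul_self_sqrt hn.le
  linear_combination (c * (1 + √C / 8) * √C * √(D / n)) * h3

/-! ### Assembly of the selection result -/

namespace Networks

variable {p q : ℕ} {N : Networks p q} {s κ : ℝ} {c₁ c₂ : Fin 2 → ℝ}

/-- The constant of the part of the score that is due to the calibration error. -/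
noncomputable def scoreConst (C₂ : ℝ) (c₁ : Fin 2 → ℝ) : ℝ :=
  max (c₁ 0) (c₁ 1) * (1 + √C₂ / 8) * √C₂

/-- The lower bound for the tuning parameter times the weights. -/
noncomputable def level (N : Networks p q) (a : ℝ) : ℝ :=
  a * N.oneB * matOne N.PiMat * √(N.D * Real.log p / N.nMin)

/-- The minimal weight cancels, so the score can be compared with a non-random level although
weights and tuning parameter depend on the data. -/
lemma level_le {i : Fin p} {w : Coef p i → ℝ} {a t : ℝ} [Nonempty (Coef p i)]
    (hw : ∀ j, 0 < w j) (ht : a * N.rate i w ≤ t) (ht0 : 0 ≤ t) (j : Coef p i) :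
    N.level a ≤ t * w j := by
  have hm : 0 < minAbs w := minAbs_pos fun j => (hw j).ne'
  have hle : minAbs w ≤ w j := (minAbs_le w j).trans_eq (abs_of_pos (hw j))
  calc N.level a = a * N.rate i w * minAbs w := by
        rw [level, rate]
        field_simp
    _ ≤ t * minAbs w := mul_le_mul_of_nonneg_right ht hm.le
    _ ≤ t * w j := mul_le_mul_of_nonneg_left hle ht0

/-- The part of the score that is due to the calibration error. -/
lemma calibration_score_le (hs : 0 < s) (hst : N.Standing) (h : N.Calibration s κ c₁ c₂)
    (hc₁ : ∀ k, 0 < c₁ k) (hc₂ : ∀ k, 0 < c₂ k) {v C₂ : ℝ}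
    (hC₂ : c₁ 0 ^ 2 * calConst v (c₁ 0) (c₂ 0) + c₁ 1 ^ 2 * calConst v (c₁ 1) (c₂ 1) ≤ C₂)
    (hC₂' : 1 ≤ C₂) {Ω : Type*} {Y : Ω → N.Obs} {ω : Ω} (hω : ∀ k l, ω ∉ N.calBad Y v c₁ k l)
    {i : Fin p} {τ φ₀ a : ℝ} (hτ : 0 < τ) (hτ1 : τ < 1) (hφ : 0 < φ₀) (ha : 0 < a)
    {w : Coef p i → ℝ} (hL : 0 ≤ Real.log p)
    (hta : 32 * scoreConst C₂ c₁ / τ ≤ a * √(Real.log p))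
    (hRE : ENNReal.ofReal φ₀ ≤ restrictedEigenvalue (N.H i * N.XX * N.PiMinus i) (N.S i))
    (hcal : (N.S i).Nonempty → √(N.D / N.nTot) + max (c₁ 0) (c₁ 1) * matOne N.PiMat ≤
      √((max (c₁ 0) (c₁ 1)) ^ 2 * matOne N.PiMat ^ 2 +
        min (φ₀ ^ 2 / 64) (τ * (4 - τ)⁻¹ * minAbs w / N.ψ i w) / (C₂ * (N.S i).card)))
    (j : Coef p i) :
    ltwo (fun r => N.ZHat (Y ω) i r j) * (lone (N.β i) * √(C₂ * N.D)) ≤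
      N.nTot * (τ * N.level a / 32) := by
  have hn := nTot_pos hst
  have hD := D_pos hst
  have hP := matOne_nonneg N.PiMat
  have hB := oneB_nonneg (N := N)
  have hcm : 0 < max (c₁ 0) (c₁ 1) := lt_max_of_lt_left (hc₁ 0)
  -- With empty support `β_i = 0` and this part of the score vanishes; the first-stage condition is
  -- needed, and available, only otherwise.
  rcases (N.S i).eq_empty_or_nonempty with hS | hS
  · have h0 : lone (N.β i) = 0 := Finset.sum_eq_zero fun j _ => by
      by_contra hne
      have : j ∈ N.S i := mem_supp.2 fun h => hne (by rw [h, abs_zero])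
      simp [hS] at this
    rw [h0, zero_mul, mul_zero, level]
    positivity
  · have hcal' := hcal hS
    rw [← mul_pow] at hcal'
    have hτ4 : 0 < 4 - τ := by linarith
    have hψ : 0 ≤ N.ψ i w := matInf_nonneg _
    have hmin : 0 ≤ minAbs w := Real.iInf_nonneg fun _ => abs_nonneg _
    have hx := (sq_bound_of_sqrt_bound (Real.sqrt_nonneg _) (mul_nonneg hcm.le hP) hC₂'
      hS.card_pos (le_min (by positivity) (by positivity)) (min_le_left _ _) hφ.le
      (re_le hs hst h hc₁ hc₂ hS hRE) hcal').2
    have hz : ltwo (fun r => N.ZHat (Y ω) i r j) ≤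
        max (c₁ 0) (c₁ 1) * matOne N.PiMat * √N.nTot + √(C₂ * N.D) := by
      have h1 : (fun r => N.ZHat (Y ω) i r j) = (fun r => (N.XX * N.PiMinus i) r j) +
          fun r => (N.ZHat (Y ω) i - N.XX * N.PiMinus i) r j := by
        ext r
        simp
      rw [h1]
      exact (ltwo_add_le _ _).trans (add_le_add (ltwo_XX_mul_PiMinus_col_le hs hst h hc₁ i j)
        (ltwo_ZHat_sub_col_le hs hst h hc₂ hC₂ hω i j))
    have h1 := regressor_mul_error_le hn (by linarith) hz hx
    have h2 : √(N.D / N.nTot) ≤ √(N.D / N.nMin) :=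
      Real.sqrt_le_sqrt (div_le_div_of_nonneg_left hD.le (nMin_pos hst)
        ((nMin_le 0).trans (n_le_nTot 0)))
    have h3 : √(N.D * Real.log p / N.nMin) = √(Real.log p) * √(N.D / N.nMin) := by
      rw [← Real.sqrt_mul hL]
      congr 1
      ring
    have h4 : scoreConst C₂ c₁ ≤ τ * (a * √(Real.log p)) / 32 := by
      rw [div_le_iff₀ hτ] at hta
      linarith
    calc ltwo (fun r => N.ZHat (Y ω) i r j) * (lone (N.β i) * √(C₂ * N.D))
        = lone (N.β i) * (ltwo (fun r => N.ZHat (Y ω) i r j) * √(C₂ * N.D)) := by ring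
      _ ≤ N.oneB * (N.nTot * (max (c₁ 0) (c₁ 1) * matOne N.PiMat * (1 + √C₂ / 8) * √C₂ *
            √(N.D / N.nTot))) :=
          mul_le_mul (lone_β_le i) h1 (mul_nonneg (ltwo_nonneg _) (Real.sqrt_nonneg _)) hB
      _ = N.nTot * (N.oneB * matOne N.PiMat) * (scoreConst C₂ c₁ * √(N.D / N.nTot)) := by
          rw [scoreConst]
          ring
      _ ≤ N.nTot * (N.oneB * matOne N.PiMat) *
            (τ * (a * √(Real.log p)) / 32 * √(N.D / N.nMin)) := by
          refine mul_le_mul_of_nonneg_left ?_ (by positivity)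
          exact mul_le_mul h4 h2 (Real.sqrt_nonneg _) (by positivity)
      _ = N.nTot * (τ * N.level a / 32) := by
          rw [level, h3]
          ring

/-- Variable selection consistency, for explicit constants. -/
lemma selection_probability {σmax : ℝ} (hs : 0 < s) (hσ : 0 < σmax) (hc₁ : ∀ k, 0 < c₁ k)
    (hc₂ : ∀ k, 0 < c₂ k) {τ φ₀ a v C₂ C : ℝ} (hτ : 0 < τ) (hτ1 : τ < 1) (hφ : 0 < φ₀)
    (ha : 0 < a) (hv : v = σmax ^ 2 / s ^ 2) (hC₂ : C₂ = predConst v c₁ c₂)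
    (hC : C = calConst v (c₁ 0) (c₂ 0) + calConst v (c₁ 1) (c₂ 1))
    (hN : N.Admissible s σmax κ c₁ c₂) {Ω : Type*} [MeasurableSpace Ω] {μ : Measure Ω}
    [IsProbabilityMeasure μ] {Y : Ω → N.Obs} (hY : N.IsSample μ Y) {i : Fin p}
    {w : Ω → Coef p i → ℝ} {lam : Ω → ℝ} {bHat : Ω → Coef p i → ℝ}
    (hw : ∀ᵐ ω ∂μ, ∀ j, 0 < w ω j)
    (hta : 32 * scoreConst C₂ c₁ / τ ≤ a * √(Real.log p))
    (hlam : ∀ᵐ ω ∂μ, a * N.rate i (w ω) ≤ lam ω)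
    (hb : ∀ᵐ ω ∂μ, N.IsAdaptiveLasso (Y ω) i (lam ω) (w ω) (bHat ω))
    (hRE : ENNReal.ofReal φ₀ ≤ restrictedEigenvalue (N.H i * N.XX * N.PiMinus i) (N.S i))
    (hirr : ∀ᵐ ω ∂μ, N.irrep i (w ω) < 1 - τ)
    (hunit : ∀ᵐ ω ∂μ, IsUnit (block11 (N.IHat (Y ω) i) (N.S i)))
    (hsig : (N.S i).Nonempty → ∀ᵐ ω ∂μ, lam ω * N.ψ i (w ω) / (2 - τ) < N.signal i)
    (hcal : (N.S i).Nonempty → ∀ᵐ ω ∂μ,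
      √(N.D / N.nTot) + max (c₁ 0) (c₁ 1) * matOne N.PiMat ≤
        √((max (c₁ 0) (c₁ 1)) ^ 2 * matOne N.PiMat ^ 2 +
          min (φ₀ ^ 2 / 64) (τ * (4 - τ)⁻¹ * minAbs (w ω) / N.ψ i (w ω)) /
            (C₂ * (N.S i).card))) :
    1 - 3 * Real.exp (-(τ ^ 2 * a ^ 2 / (32768 * v * (1 + C))) * N.h + Real.log (4 * p * q))
        - Real.exp (-N.f 0 + Real.log p) - Real.exp (-N.f 1 + Real.log p) ≤
      μ.real {ω | supp (bHat ω) = N.S i} := by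
  have hst := hN.standing
  have h := hN.calibration
  have hn := nTot_pos hst
  have hD := D_pos hst
  have hnm := nMin_pos hst
  have hmn : (N.nMin : ℝ) ≤ N.nTot := (nMin_le 0).trans (n_le_nTot 0)
  have hnk : ∀ k, (0 : ℝ) < N.n k := fun k => Nat.cast_pos.2 (hst.n_pos k)
  have hp : 0 < p := i.pos
  -- Needed for `exp (log (4pq)) = 4pq`; with `q = 0` the logarithm would take its default value.
  have hq : 0 < q := by
    by_contra! hq0
    have h1 := hN.sameOrder.p_le
    rw [Nat.le_zero.1 hq0, Nat.cast_zero, mul_zero] at h1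
    have : (0 : ℝ) < p := by exact_mod_cast hp
    linarith
  have hv0 : 0 < v := by
    rw [hv]
    positivity
  have hcC : ∀ k, 0 < calConst v (c₁ k) (c₂ k) := fun k => calConst_pos hv0 (hc₂ k)
  have hC0 : 0 < C := by
    rw [hC]
    exact add_pos (hcC 0) (hcC 1)
  have hCk : ∀ k, calConst v (c₁ k) (c₂ k) ≤ C := by
    rw [hC, Fin.forall_fin_two]
    exact ⟨by linarith [hcC 1], by linarith [hcC 0]⟩
  have hC₂1 : 1 ≤ C₂ := hC₂ ▸ le_max_left _ _
  have hC₂' : c₁ 0 ^ 2 * calConst v (c₁ 0) (c₂ 0) + c₁ 1 ^ 2 * calConst v (c₁ 1) (c₂ 1) ≤ C₂ :=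
    hC₂ ▸ le_max_right _ _
  have hcm : 0 < max (c₁ 0) (c₁ 1) := lt_max_of_lt_left (hc₁ 0)
  have hscore : 0 < scoreConst C₂ c₁ := by
    have : 0 < √C₂ := Real.sqrt_pos.2 (by linarith)
    rw [scoreConst]
    positivity
  have hsq : 0 < √(Real.log p) := by
    have : 0 < a * √(Real.log p) := lt_of_lt_of_le (by positivity) hta
    exact pos_of_mul_pos_right this ha.le
  have hL : 0 < Real.log p := Real.sqrt_pos.1 hsq
  have hp2 : 2 ≤ p := by
    by_contra! hlt
    have : p = 1 := by omega
    simp [this] at hL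
  have hne : Nonempty (Coef p i) := by
    have : Nontrivial (Fin p) := Fin.nontrivial_iff_two_le.2 hp2
    obtain ⟨l, hl⟩ := exists_ne i
    exact ⟨Sum.inl ⟨l, hl⟩⟩
  -- If `h = 0`, the claimed lower bound is nonpositive. Otherwise `‖B‖₁`, `‖Π‖₁` and `d` are
  -- positive, which makes the tuning parameter and the `ℓ₁` bound `L` positive.
  by_cases hh : N.h = 0
  · exact (bound_nonpos_of_h_eq_zero hp hq hh).trans measureReal_nonneg
  have hB : 0 < N.oneB := lt_of_le_of_ne oneB_nonneg fun h0 => hh (by simp [Networks.h, ← h0])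
  have hP : 0 < matOne N.PiMat := lt_of_le_of_ne (matOne_nonneg _) fun h0 => hh (by
    simp [Networks.h, ← h0, hD.le])
  have hd : (0 : ℝ) < N.d := lt_of_le_of_ne (Nat.cast_nonneg _) fun h0 => hh (by
    simp [Networks.h, ← h0, hD.le])
  have hlev : 0 < N.level a := by
    rw [level]
    have : 0 < √(N.D * Real.log p / N.nMin) := Real.sqrt_pos.2 (by positivity)
    positivity
  -- The thresholds satisfy `T₁ = L T₂`, so the noise contributes `2 T₁ + 2 L T₂ = n τ level / 32`.
  -- The calibration part takes as much, and the total `n τ level / 16` is within the allowed `(τ/8)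
  -- n t w_j / 2`.
  set T₁ := N.nTot * τ * N.level a / 128 with hT₁
  set L := √(N.d * C * N.D / N.nMin) with hLdef
  have hL0 : 0 < L := Real.sqrt_pos.2 (by positivity)
  set T₂ := N.nTot * τ * N.level a / (128 * L) with hT₂
  refine (bound_le_of_tails (N := N) hp hq
    (μcal := fun x => μ.real (N.calBad Y v c₁ x.1 x.2))
    (μreg := fun x => μ.real (N.regBad Y i T₁ x.1 x.2))
    (μexo := fun x => μ.real (N.exoBad Y i T₂ x.1 x.2)) (fun x => ?_) (fun x => ?_)
    (fun x => ?_)).trans ?_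
  · rw [hv]
    exact measure_calBad_le hs hσ hst h hN.sd_le hc₁ hY x.1 x.2
  · refine measure_regBad_le hs hσ hc₂ hN hY i (by positivity) x.1 x.2 hP ?_
    rw [← hv]
    exact tail_exponent_reg hnm hmn (hnk x.1) (n_le_nTot x.1) hD hL.le hv0 hC0.le
      (h_le_left hst hL.le)
  · refine measure_exoBad_le hs hσ hc₂ hN hY i (by positivity) x.1 x.2 ?_
    rw [← hv]
    exact tail_exponent_exo hnm (hnk x.1) (n_le_nTot x.1) hd hD hL.le hv0 hC0
      (h_le_right hst hL.le)
  have hsig' : ∀ᵐ ω ∂μ, (N.S i).Nonempty → lam ω * N.ψ i (w ω) / (2 - τ) < N.signal i := by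
    by_cases hS : (N.S i).Nonempty
    · filter_upwards [hsig hS] with ω hω _ using hω
    · exact Filter.Eventually.of_forall fun _ h0 => absurd h0 hS
  have hcal' : ∀ᵐ ω ∂μ, (N.S i).Nonempty →
      √(N.D / N.nTot) + max (c₁ 0) (c₁ 1) * matOne N.PiMat ≤
        √((max (c₁ 0) (c₁ 1)) ^ 2 * matOne N.PiMat ^ 2 +
          min (φ₀ ^ 2 / 64) (τ * (4 - τ)⁻¹ * minAbs (w ω) / N.ψ i (w ω)) /
            (C₂ * (N.S i).card)) := by
    by_cases hS : (N.S i).Nonempty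
    · filter_upwards [hcal hS] with ω hω _ using hω
    · exact Filter.Eventually.of_forall fun _ h0 => absurd h0 hS
  have hmain := one_sub_sum_le_measureReal (μ := μ) (G := {ω | supp (bHat ω) = N.S i})
    (bad := Sum.elim (fun x : Fin 2 × Fin p => N.calBad Y v c₁ x.1 x.2)
      (Sum.elim (fun x : Fin 2 × Fin p => N.regBad Y i T₁ x.1 x.2)
        fun x : Fin 2 × Fin q => N.exoBad Y i T₂ x.1 x.2)) ?_
  · rwa [Fintype.sum_sum_type, Fintype.sum_sum_type] at hmain
  filter_upwards [hw, hlam, hb, hirr, hunit, hsig', hcal'] with ω hw hlam hb hirr hunit hsig hcal hbad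
  have hg1 : ∀ k l, ω ∉ N.calBad Y v c₁ k l := fun k l => hbad (Sum.inl (k, l))
  have hg2 : ∀ k l, ω ∉ N.regBad Y i T₁ k l := fun k l => hbad (Sum.inr (Sum.inl (k, l)))
  have hg3 : ∀ k l, ω ∉ N.exoBad Y i T₂ k l := fun k l => hbad (Sum.inr (Sum.inr (k, l)))
  have hrate : 0 < N.rate i (w ω) := by
    have h1 : 0 < minAbs (w ω) := minAbs_pos fun j => (hw j).ne'
    have h2 : 0 < √(N.D * Real.log p / N.nMin) := Real.sqrt_pos.2 (by positivity)
    rw [rate]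
    positivity
  have ht : 0 < lam ω := (mul_pos ha hrate).trans_le hlam
  refine supp_eq_of_score_le hs hst h hc₁ hc₂ hC₂' hC₂1 hg1 hτ hτ1 hφ ht hw hb hRE hirr hunit
    hsig hcal fun j => ?_
  have h1 := abs_score_le hs hst h hc₂ hC₂' hg1 i (fun k l => (not_le.1 (hg2 k l)).le)
    (fun k l => (not_le.1 (hg3 k l)).le) (by positivity)
    (fun k l => lone_calErr_le hs hst h hc₂ hCk (hg1 k l)) j
  have h2 := calibration_score_le hs hst h hc₁ hc₂ hC₂' hC₂1 hg1 hτ hτ1 hφ ha hL.le hta hRE hcal j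
  have h3 : L * T₂ = N.nTot * τ * N.level a / 128 := by
    rw [hT₂]
    field_simp
  rw [← hLdef, h3] at h1
  rw [abs_mul, abs_of_pos (inv_pos.2 hn), inv_mul_le_iff₀ hn]
  refine h1.trans ((add_le_add_left h2 _).trans ?_)
  have h4 := mul_le_mul_of_nonneg_left (level_le hw hlam ht.le j) (mul_pos hn hτ).le
  rw [hT₁]
  linarith

end Networks

end ReDNet

open MeasureTheory ReDNet in
theorem theorem4 (c₁ c₂ : Fin 2 → ℝ) (hc₁ : ∀ k, 0 < c₁ k) (hc₂ : ∀ k, 0 < c₂ k)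
    (s σmax κ : ℝ) (hs : 0 < s) (hσ : 0 < σmax) (hκ : 0 < κ) :
    -- the constant of the prediction error of the calibration stage
    ∃ C₂ : ℝ, 0 < C₂ ∧
      (∀ (p q : ℕ) (N : Networks p q), N.Admissible s σmax κ c₁ c₂ →
        ∀ (Ω : Type u) [MeasurableSpace Ω] (μ : Measure Ω) [IsProbabilityMeasure μ] (Y : Ω → N.Obs),
        N.IsSample μ Y → ∀ j : Fin p ⊕ Fin p,
          1 - Real.exp (-N.f 0) - Real.exp (-N.f 1) ≤
            μ.real {ω | ltwo (N.XX *ᵥ fun l => N.PiHat (Y ω) l j - N.PiMat l j) ^ 2 ≤ C₂ * N.D}) ∧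
      ∀ τ φ₀ : ℝ, 0 < τ → τ < 1 → 0 < φ₀ →
      -- how large the tuning parameter has to be, and the constants of its order
      ∃ t₀ : ℝ, 0 < t₀ ∧ ∀ a b : ℝ, 0 < a → a ≤ b →
      ∃ C₅ : ℝ, 0 < C₅ ∧
        ∀ (p q : ℕ) (N : Networks p q), N.Admissible s σmax κ c₁ c₂ →
        ∀ (Ω : Type u) [MeasurableSpace Ω] (μ : Measure Ω) [IsProbabilityMeasure μ] (Y : Ω → N.Obs),
        N.IsSample μ Y →
        -- node, adaptive weights, tuning parameter, estimator
        ∀ (i : Fin p) (w : Ω → Coef p i → ℝ) (lam : Ω → ℝ) (bHat : Ω → Coef p i → ℝ),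
        (∀ᵐ ω ∂μ, ∀ j, 0 < w ω j) →
        t₀ ≤ a * √(Real.log p) →
        (∀ᵐ ω ∂μ, a * N.rate i (w ω) ≤ lam ω ∧ lam ω ≤ b * N.rate i (w ω)) →
        (∀ᵐ ω ∂μ, N.IsAdaptiveLasso (Y ω) i (lam ω) (w ω) (bHat ω)) →
        -- restricted eigenvalue condition
        ENNReal.ofReal φ₀ ≤ restrictedEigenvalue (N.H i * N.XX * N.PiMinus i) (N.S i) →
        (∀ᵐ ω ∂μ, ∀ j ∈ N.S i, ∀ l ∉ N.S i, |w ω j| ≤ |w ω l|) →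
        -- weighted irrepresentable condition
        (∀ᵐ ω ∂μ, N.irrep i (w ω) < 1 - τ) →
        -- the estimated Gram submatrix is invertible
        (∀ᵐ ω ∂μ, IsUnit (block11 (N.IHat (Y ω) i) (N.S i))) →
        -- signal strength
        ((N.S i).Nonempty → ∀ᵐ ω ∂μ, lam ω * N.ψ i (w ω) / (2 - τ) < N.signal i) →
        -- first-stage error
        ((N.S i).Nonempty → ∀ᵐ ω ∂μ,
          √(N.D / N.nTot) + max (c₁ 0) (c₁ 1) * matOne N.PiMat ≤
            √((max (c₁ 0) (c₁ 1)) ^ 2 * matOne N.PiMat ^ 2 +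
              min (φ₀ ^ 2 / 64) (τ * (4 - τ)⁻¹ * minAbs (w ω) / N.ψ i (w ω)) /
                (C₂ * (N.S i).card))) →
        1 - 3 * Real.exp (-C₅ * N.h + Real.log (4 * p * q))
            - Real.exp (-N.f 0 + Real.log p) - Real.exp (-N.f 1 + Real.log p) ≤
          μ.real {ω | supp (bHat ω) = N.S i} := by
  set v := σmax ^ 2 / s ^ 2 with hv
  have hv0 : 0 < v := by positivity
  -- `v` is the variance proxy of the reduced-form noise. The value of `t₀` makes the calibration
  -- part at most half of the admissible score; `C₅` is the exponent constant common to both noise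
  -- tails.
  refine ⟨Networks.predConst v c₁ c₂, lt_of_lt_of_le one_pos (le_max_left _ _),
    fun p q N hN Ω _ μ _ Y hY j => Networks.prediction_bound hs hσ hc₁ hc₂ hN hY j,
    fun τ φ₀ hτ hτ1 hφ => ⟨32 * Networks.scoreConst (Networks.predConst v c₁ c₂) c₁ / τ, ?_,
      fun a b ha _ => ⟨τ ^ 2 * a ^ 2 / (32768 * v * (1 + (Networks.calConst v (c₁ 0) (c₂ 0) +
        Networks.calConst v (c₁ 1) (c₂ 1)))), ?_, ?_⟩⟩⟩
  · have h1 : 0 < max (c₁ 0) (c₁ 1) := lt_max_of_lt_left (hc₁ 0)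
    have h2 : 0 < √(Networks.predConst v c₁ c₂) :=
      Real.sqrt_pos.2 (lt_of_lt_of_le one_pos (le_max_left _ _))
    rw [Networks.scoreConst]
    positivity
  · have h1 := Networks.calConst_pos (c₁ := c₁ 0) hv0 (hc₂ 0)
    have h2 := Networks.calConst_pos (c₁ := c₁ 1) hv0 (hc₂ 1)
    positivity
  · intro p q N hN Ω _ μ _ Y hY i w lam bHat hw hta hlam hb hRE _ hirr hunit hsig hcal
    exact Networks.selection_probability hs hσ hc₁ hc₂ hτ hτ1 hφ ha hv rfl rfl hN hY hw hta
      (hlam.mono fun _ h => h.1) hb hRE hirr hunit hsig hcal
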